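/- Conventions (in second-order arithmetic). A linear order has an underlying set contained in $\mathbb N$; it is well-founded if there is no infinite strictly descending sequence in it, and a well order if it is linear and well-founded. For a linear order $\gamma$, the order $2^\gamma$ consists of the finite sequences $\langle\delta_0,\dots,\delta_{n-1}\rangle$ with $\delta_0>\dots>\delta_{n-1}$ in $\gamma$ (written $2^{\delta_0}+\dots+2^{\delta_{n-1}}$), compared lexicographically, where smaller indices have higher priority and proper initial segments are smaller. For linear orders $\alpha,\beta$, the product $\alpha\cdot\beta$ has elements $\alpha\cdot b+a$ with $b\in\beta$, $a\in\alpha$, where $\alpha\cdot b+a<\alpha\cdot b'+a'$ iff $b<b'$, or $b=b'$ and $a<a'$. The order $(1+\alpha)^\gamma$ consists of the finite sequences $\langle(x_0,y_0),\dots,(x_{n-1},y_{n-1})\rangle$ with $x_0>\dots>x_{n-1}$ in $\gamma$ and $y_i\in\alpha$, compared lexicographically in the same sense, where $(x,y)<(x',y')$ iff $x<x'$, or $x=x'$ and $y<y'$. Let $L=(\mathbb N,\le_L)$ be a linear order with underlying set $\mathbb N$. For $n\in\mathbb N$ let $\pi^L_n$ be the permutation of $\{0,\dots,n-1\}$ with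 $\pi^L_n(i)\le\pi^L_n(j)\Leftrightarrow i\le_L j$. For a finite sequence $\sigma$ of length $l(\sigma)$ put $\sigma^L_i=\sigma(\pi^L_{l(\sigma)}(i))$. For a linear order $\alpha$, let $D_L(\alpha)$ be the set of finite strictly increasing sequences in $\alpha$, where $\sigma<\tau$ holds iff there is a $j<\min(l(\sigma),l(\tau))$ with $\sigma^L_j<\tau^L_j$ and $\sigma^L_i=\tau^L_i$ for all $i<j$, or we have $l(\sigma)<l(\tau)$ and $\sigma^L_i=\tau^L_i$ for all $i<l(\sigma)$. An order embedding $f:\alpha\to\beta$ induces $D_L(f):D_L(\alpha)\to D_L(\beta)$ by applying $f$ to all entries, $(1+f)^\gamma:(1+\alpha)^\gamma\to(1+\beta)^\gamma$ by applying $f$ to all $y_i$, and $f\cdot 2^\gamma:\alpha\cdot2^\gamma\to\beta\cdot2^\gamma$ by $\alpha\cdot\sigma+a\mapsto\beta\cdot\sigma+f(a)$. We say that $D_L$ is a dilator if $D_L(\alpha)$ is well-founded for every well order $\alpha$. Slow transfinite $\Pi^0_2$-induction is the statement that for every linear order $\gamma$ such that $2^\gamma$ is well-founded, $\Pi^0_2$-induction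 along $\gamma$ holds, i.e. for every $\Pi^0_2$-formula $\varphi$ (with number and set parameters), if each $x\in\gamma$ satisfies $\bigl(\forall y<_\gamma x\,\varphi(y)\bigr)\to\varphi(x)$, then $\varphi(x)$ holds for all $x\in\gamma$. Theorem. The following are provable in $\mathsf{RCA}_0$ (i.e. true in all models of $\mathsf{RCA}_0$, including those with nonstandard first-order part). (a) For arbitrary linear orders $L=(\mathbb N,\le_L)$ and $\gamma$, there is a natural family of order embeddings $$\eta_\alpha:(1+\alpha)^\gamma\to D_L(\alpha\cdot 2^\gamma),$$ where $\alpha$ ranges over all linear orders. Explicitly: there is a single $\Sigma^0_1$-formula that defines, from $L$, $\gamma$ and $\alpha$, the graph of a function $\eta_\alpha$ (which exists as a set) such that each $\eta_\alpha$ is an order embedding and $\eta_\beta\circ(1+f)^\gamma=D_L(f\cdot 2^\gamma)\circ\eta_\alpha$ holds for every order embedding $f:\alpha\to\beta$ of linear orders. (b) If $D_L$ is a dilator for some linear order $L=(\mathbb N,\le_L)$, then slow transfinite $\Pi^0_2$-induction holds. -/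

import Mathlib

/-!
Second-order arithmetic is interpreted in arbitrary structures `(M, S)`: a first-order part `M`
(possibly nonstandard) with `0, 1, +, *, <`, and a collection `S` of subsets of `M` over which the
set variables range.  A statement is a consequence of the theory `RCA₀` when it holds in every such
structure that satisfies the axioms of `RCA₀`.
-/

universe u

namespace SOA

/-- First-order part of a structure for the language of second-order arithmetic. -/
class Arith (M : Type u) extends Zero M, One M, Add M, Mul M, LT M

/-! ### Bounded formulas and the axioms of `RCA₀` -/

/-- Number terms; number variables are de Bruijn indices. -/
inductive NTerm : Type
  | var (i : ℕ) : NTerm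
  | zero : NTerm
  | one : NTerm
  | add (s t : NTerm) : NTerm
  | mul (s t : NTerm) : NTerm

/-- Bounded-quantifier formulas with free number variables and free set variables.
In `ball t φ` and `bex t φ` (that is `∀ x < t, φ` and `∃ x < t, φ`) the variable `0` of `φ` is the
bound one, and the variables of `t` are those of the context outside of the quantifier. -/
inductive BFormula : Type
  | eq (s t : NTerm) : BFormula
  | lt (s t : NTerm) : BFormula
  | mem (t : NTerm) (X : ℕ) : BFormula
  | neg (φ : BFormula) : BFormula
  | and (φ ψ : BFormula) : BFormula
  | or (φ ψ : BFormula) : BFormula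
  | ball (t : NTerm) (φ : BFormula) : BFormula
  | bex (t : NTerm) (φ : BFormula) : BFormula

section
variable {M : Type u} [Arith M]

/-- Extend an assignment by a value for variable `0`, shifting the others. -/
def cons (a : M) (v : ℕ → M) : ℕ → M
  | 0 => a
  | i + 1 => v i

def NTerm.eval (v : ℕ → M) : NTerm → M
  | .var i => v i
  | .zero => 0
  | .one => 1
  | .add s t => s.eval v + t.eval v
  | .mul s t => s.eval v * t.eval v

/-- Truth of a bounded formula under an assignment `v` of numbers and `V` of sets. -/
def BFormula.Holds (V : ℕ → Set M) : BFormula → (ℕ → M) → Prop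
  | .eq s t, v => s.eval v = t.eval v
  | .lt s t, v => s.eval v < t.eval v
  | .mem t X, v => t.eval v ∈ V X
  | .neg φ, v => ¬ φ.Holds V v
  | .and φ ψ, v => φ.Holds V v ∧ ψ.Holds V v
  | .or φ ψ, v => φ.Holds V v ∨ ψ.Holds V v
  | .ball t φ, v => ∀ x, x < t.eval v → φ.Holds V (cons x v)
  | .bex t φ, v => ∃ x, x < t.eval v ∧ φ.Holds V (cons x v)

/-- The `Σ⁰₁`-formula `∃ m, φ`. -/
def BFormula.Sigma1 (φ : BFormula) (V : ℕ → Set M) (v : ℕ → M) : Prop :=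
  ∃ m, φ.Holds V (cons m v)

/-- The `Π⁰₁`-formula `∀ m, φ`. -/
def BFormula.Pi1 (φ : BFormula) (V : ℕ → Set M) (v : ℕ → M) : Prop :=
  ∀ m, φ.Holds V (cons m v)

/-- The `Π⁰₂`-formula `∀ m, ∃ n, φ`. -/
def BFormula.Pi2 (φ : BFormula) (V : ℕ → Set M) (v : ℕ → M) : Prop :=
  ∀ m, ∃ n, φ.Holds V (cons n (cons m v))

/-- `(M, S)` is a model of `RCA₀`: basic axioms, `Σ⁰₁`-induction and `Δ⁰₁`-comprehension, where
number and set parameters are allowed in both schemata. -/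
structure ModelsRCA0 (S : Set (Set M)) : Prop where
  nonempty : S.Nonempty
  succ_ne_zero : ∀ n : M, n + 1 ≠ 0
  succ_inj : ∀ m n : M, m + 1 = n + 1 → m = n
  add_zero : ∀ m : M, m + 0 = m
  add_succ : ∀ m n : M, m + (n + 1) = (m + n) + 1
  mul_zero : ∀ m : M, m * 0 = 0
  mul_succ : ∀ m n : M, m * (n + 1) = m * n + m
  not_lt_zero : ∀ m : M, ¬ m < 0
  lt_succ : ∀ m n : M, m < n + 1 ↔ (m < n ∨ m = n)
  sigma1_induction : ∀ (φ : BFormula) (V : ℕ → Set M) (v : ℕ → M), (∀ i, V i ∈ S) →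
    φ.Sigma1 V (cons 0 v) →
    (∀ n, φ.Sigma1 V (cons n v) → φ.Sigma1 V (cons (n + 1) v)) →
    ∀ n, φ.Sigma1 V (cons n v)
  delta1_comprehension : ∀ (φ ψ : BFormula) (V : ℕ → Set M) (v : ℕ → M), (∀ i, V i ∈ S) →
    (∀ n, φ.Sigma1 V (cons n v) ↔ ψ.Pi1 V (cons n v)) →
    {n | φ.Sigma1 V (cons n v)} ∈ S

/-! ### Pairs, finite sets, finite sequences -/

/-- The pairing function `(i, j) = (i + j)² + i`. -/
def pair (i j : M) : M := (i + j) * (i + j) + i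

/-- `i` is an element of the finite set with code `c = ((k, m), n)`,
namely `{i < k | m (i + 1) + 1 divides n}`. -/
def FinMem (i c : M) : Prop :=
  ∃ k m n, c = pair (pair k m) n ∧ i < k ∧ ∃ q, n = (m * (i + 1) + 1) * q

/-- `c` is the code of a finite set: the least number of the form `((k, m), n)` that represents
this set. -/
def IsFinCode (c : M) : Prop :=
  (∃ k m n, c = pair (pair k m) n) ∧
  ∀ c', c' < c → (∃ k m n, c' = pair (pair k m) n) → ¬ ∀ i, FinMem i c' ↔ FinMem i c

/-- `x` is the entry of the sequence `s` at position `i`. -/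
def Entry (s i x : M) : Prop := FinMem (pair i x) s

/-- `s` is (the code of) a finite sequence of length `l`, i.e. a finite set of pairs that is the
graph of a function on `{i | i < l}`. -/
def IsSeq (s l : M) : Prop :=
  IsFinCode s ∧ (∀ p, FinMem p s → ∃ i x, p = pair i x ∧ i < l) ∧ ∀ i, i < l → ∃! x, Entry s i x

/-! ### Linear orders, represented by their non-strict relation as a set of pairs -/

def OrdLE (R : Set M) (x y : M) : Prop := pair x y ∈ R

def OrdLT (R : Set M) (x y : M) : Prop := pair x y ∈ R ∧ x ≠ y

/-- Membership in the underlying set of an order. -/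
def Fld (R : Set M) (x : M) : Prop := pair x x ∈ R

structure IsLinOrd (R : Set M) : Prop where
  pairs : ∀ p ∈ R, ∃ x y, p = pair x y ∧ Fld R x ∧ Fld R y
  antisymm : ∀ x y, OrdLE R x y → OrdLE R y x → x = y
  trans : ∀ x y z, OrdLE R x y → OrdLE R y z → OrdLE R x z
  total : ∀ x y, Fld R x → Fld R y → OrdLE R x y ∨ OrdLE R y x

/-- A linear order whose underlying set consists of all numbers. -/
def IsLinOrdOnNat (R : Set M) : Prop := IsLinOrd R ∧ ∀ x, Fld R x

/-- `F` is (the graph of) a function from numbers to numbers. -/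
def IsFun (F : Set M) : Prop :=
  (∀ p ∈ F, ∃ n x, p = pair n x) ∧ ∀ n, ∃! x, pair n x ∈ F

/-- No infinite sequence in `S` descends in `R`. -/
def WellFdd (S : Set (Set M)) (R : Set M) : Prop :=
  ¬ ∃ F ∈ S, IsFun F ∧ ∀ n x y, pair n x ∈ F → pair (n + 1) y ∈ F → OrdLT R y x

def IsWellOrd (S : Set (Set M)) (R : Set M) : Prop := IsLinOrd R ∧ WellFdd S R

/-- `F` is (the graph of) an order embedding of `R` into `R'`. -/
structure IsEmb (F R R' : Set M) : Prop where
  pairs : ∀ p ∈ F, ∃ x y, p = pair x y ∧ Fld R x ∧ Fld R' y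
  func : ∀ x, Fld R x → ∃! y, pair x y ∈ F
  le_iff : ∀ x x' y y', pair x y ∈ F → pair x' y' ∈ F → (OrdLE R x x' ↔ OrdLE R' y y')

/-- The order with underlying set `dom` and strict part `lt`. -/
def mkOrd (dom : M → Prop) (lt : M → M → Prop) : Set M :=
  {p | ∃ x y, p = pair x y ∧ dom x ∧ dom y ∧ (x = y ∨ lt x y)}

/-- Lexicographic comparison of sequences, with `lt` on the entries; here `ent s i x` says that `x`
is the entry of `s` with the `i`-th priority. -/
def LexLT (ent : M → M → M → Prop) (lt : M → M → Prop) (s t : M) : Prop :=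
  ∃ k l, IsSeq s k ∧ IsSeq t l ∧
    ((∃ j, j < k ∧ j < l ∧ (∃ x y, ent s j x ∧ ent t j y ∧ lt x y) ∧
        ∀ i, i < j → ∃ x, ent s i x ∧ ent t i x) ∨
      (k < l ∧ ∀ i, i < k → ∃ x, ent s i x ∧ ent t i x))

/-- The order `2^γ`: the term `2^(δ 0) + ... + 2^(δ (n-1))` with `δ 0 > ... > δ (n-1)` in `γ` is
the sequence `⟨δ 0, ..., δ (n-1)⟩`, and the largest exponents have the highest priority. -/
def twoPow (γ : Set M) : Set M :=
  mkOrd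
    (fun s => ∃ l, IsSeq s l ∧ (∀ i x, Entry s i x → Fld γ x) ∧
      ∀ i j x x', i < j → Entry s i x → Entry s j x' → OrdLT γ x' x)
    (LexLT Entry (OrdLT γ))

/-- The order `(1 + α)^γ` of all sequences `⟨(x 0, y 0), ..., (x (n-1), y (n-1))⟩` with
`x 0 > ... > x (n-1)` in `γ` and `y i` in `α`, compared lexicographically. -/
def onePlusPow (α γ : Set M) : Set M :=
  mkOrd
    (fun s => ∃ l, IsSeq s l ∧
      (∀ i p, Entry s i p → ∃ x y, p = pair x y ∧ Fld γ x ∧ Fld α y) ∧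
      ∀ i j x y x' y', i < j → Entry s i (pair x y) → Entry s j (pair x' y') → OrdLT γ x' x)
    (LexLT Entry fun p p' => ∃ x y x' y', p = pair x y ∧ p' = pair x' y' ∧
      ((x = x' ∧ OrdLT α y y') ∨ OrdLT γ x x'))

/-- The product `α · β`, with elements `α · b + a` for `b` in `β` and `a` in `α`; the element
`α · b + a` is the pair `(b, a)`, and the component in `β` is compared first. -/
def prodOrd (α β : Set M) : Set M :=
  mkOrd
    (fun p => ∃ b a, p = pair b a ∧ Fld β b ∧ Fld α a)
    (fun p p' => ∃ b a b' a', p = pair b a ∧ p' = pair b' a' ∧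
      ((b = b' ∧ OrdLT α a a') ∨ OrdLT β b b'))

/-! ### The predilator `D_L` -/

/-- `p` is the permutation `π` of `{i | i < n}` with `π i ≤ π j ↔ i ≤_L j`. -/
def IsPerm (L : Set M) (n p : M) : Prop :=
  IsSeq p n ∧ (∀ i k, Entry p i k → k < n) ∧ (∀ k, k < n → ∃ i, Entry p i k) ∧
  ∀ i j k k', Entry p i k → Entry p j k' → ((k < k' ∨ k = k') ↔ OrdLE L i j)

/-- `x` is the entry of `s` at position `π i`, for the permutation `π` that is determined by `L`
and the length of `s`. -/
def LEntry (L : Set M) (s i x : M) : Prop :=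
  ∃ n p k, IsSeq s n ∧ IsPerm L n p ∧ Entry p i k ∧ Entry s k x

/-- The order `D_L(α)` of finite strictly increasing sequences in `α`, compared lexicographically
after their entries have been permuted according to `L`. -/
def DL (L α : Set M) : Set M :=
  mkOrd
    (fun s => ∃ l, IsSeq s l ∧ (∀ i x, Entry s i x → Fld α x) ∧
      ∀ i j x x', i < j → Entry s i x → Entry s j x' → OrdLT α x x')
    (LexLT (LEntry L) (OrdLT α))

/-- `D_L` is a dilator: it maps well orders (in `S`) to well-founded orders.  (That `D_L` is a predilator is
no extra condition, since this holds for any linear order `L` on the numbers.) -/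
def DLIsDilator (S : Set (Set M)) (L : Set M) : Prop :=
  ∀ α ∈ S, IsWellOrd S α → WellFdd S (DL L α)

/-! ### The action on embeddings -/

/-- Entrywise application of (the function with graph) `F` to a sequence. -/
def SeqMap (F : Set M) (s s' : M) : Prop :=
  ∃ l, IsSeq s l ∧ IsSeq s' l ∧ ∀ i x, Entry s i x → ∃ x', pair x x' ∈ F ∧ Entry s' i x'

/-- Graph of `D_L(f) : D_L(α) → D_L(β)`, for `f : α → β` with graph `F`. -/
def DLMap (L α F : Set M) : Set M :=
  {q | ∃ s s', q = pair s s' ∧ Fld (DL L α) s ∧ SeqMap F s s'}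

/-- Graph of `f · δ : α · δ → β · δ`, `α · d + a ↦ β · d + f a`, for `f : α → β` with graph `F`. -/
def prodMap (F δ : Set M) : Set M :=
  {q | ∃ d a a', q = pair (pair d a) (pair d a') ∧ Fld δ d ∧ pair a a' ∈ F}

/-- Graph of `(1 + f)^γ : (1 + α)^γ → (1 + β)^γ`,
`⟨(x 0, y 0), ...⟩ ↦ ⟨(x 0, f (y 0)), ...⟩`, for `f : α → β` with graph `F`. -/
def onePlusPowMap (α γ F : Set M) : Set M :=
  {q | ∃ s s', q = pair s s' ∧ Fld (onePlusPow α γ) s ∧ SeqMap (prodMap F γ) s s'}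

/-! ### Slow transfinite induction -/

/-- `Π⁰₂`-induction along `γ`, with parameters. -/
def Pi2Induction (S : Set (Set M)) (γ : Set M) : Prop :=
  ∀ (φ : BFormula) (V : ℕ → Set M) (v : ℕ → M), (∀ i, V i ∈ S) →
    (∀ x, Fld γ x → (∀ y, OrdLT γ y x → φ.Pi2 V (cons y v)) → φ.Pi2 V (cons x v)) →
    ∀ x, Fld γ x → φ.Pi2 V (cons x v)

/-- Slow transfinite `Π⁰₂`-induction. -/
def SlowTI (S : Set (Set M)) : Prop :=
  ∀ γ ∈ S, IsLinOrd γ → WellFdd S (twoPow γ) → Pi2Induction S γ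

/-! ### Uniformly definable families of functions -/

/-- The relation between numbers `s` and `t` that is defined by the `Σ⁰₁`-formula `∃ m, θ`
from the sets `L`, `γ`, `α`, as a set of pairs. -/
def defGraph (θ : BFormula) (L γ α : Set M) : Set M :=
  {q | ∃ s t, q = pair s t ∧
    θ.Sigma1 (fun | 0 => L | 1 => γ | _ => α) (fun | 0 => s | _ => t)}

/-- `∃ m, θ` defines from `L`, `γ` and `α` a family of embeddings
`η α : (1 + α)^γ → D_L(α · 2^γ)`, natural in the linear order `α`. -/
structure IsNatFamily (S : Set (Set M)) (θ : BFormula) (L γ : Set M) : Prop where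
  mem : ∀ α ∈ S, IsLinOrd α → defGraph θ L γ α ∈ S
  emb : ∀ α ∈ S, IsLinOrd α →
    IsEmb (defGraph θ L γ α) (onePlusPow α γ) (DL L (prodOrd α (twoPow γ)))
  natural : ∀ α ∈ S, ∀ β ∈ S, ∀ F ∈ S, IsLinOrd α → IsLinOrd β → IsEmb F α β →
    ∀ s, Fld (onePlusPow α γ) s → ∃ s' t t',
      pair s s' ∈ onePlusPowMap α γ F ∧ pair s' t' ∈ defGraph θ L γ β ∧
      pair s t ∈ defGraph θ L γ α ∧
      pair t t' ∈ DLMap L (prodOrd α (twoPow γ)) (prodMap F (twoPow γ))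

end

end SOA

/-! Part (a). Write s in `(1+α)^γ` as the list of pairs `(x_i, y_i)`. Its image has the same length,
and in the priority order of `D_L` its i-th entry is `α·b_i + y_i`. Here `b_i` is the sum of
`2^(x_j)` over the records j of i: those `j ≤ i` with `j ≤_L i` such that every `k < j` with `k ≤_L
i` satisfies `k ≤_L j`. For `i <_L i'`, the least j with `i <_L j ≤_L i'` is a record of `i'` and
not of i, while the records before j are the same for both. Since the exponents x decrease, this
gives `b_i < b_{i'}` (`base_lt`), so the image is strictly increasing once arranged by the
permutation. As i is a record of itself and `b_i` depends only on the x-components up to index i,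
the first difference between two elements of `(1+α)^γ` reappears in the images with the same index
and direction (`image_lt`). Naturality holds because `b_i` ignores the y-components. Given the
permutation, all of this is bounded, so the permutation is the only unbounded witness of the
defining formula.

Part (b). If `2^γ` and α are well orders, so is `α·2^γ`. Hence `D_L(α·2^γ)` is well-founded, and
through the embedding so is `(1+α)^γ` (`wellFdd_onePlusPow`). It remains to deduce `Π⁰₂`-induction
along γ from this. Suppose that φ, of the form `∀ m ∃ n θ`, is progressive but fails at some point.
A candidate is a code e of a pair `(x, m)`; it is refuted once some n with `θ(x, m, n)` appears. By
progressivity, below each unrefutable candidate lies another one with smaller x, but these cannot be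
selected effectively.

Instead one follows finite approximations to a descending sequence of candidates, starting from a
genuine counterexample. Each entry e carries a counter c that runs through the possible successors
of e in their order as numbers. When the current successor is refuted, the approximation is cut back
to e. Otherwise the counter of the last entry is raised by one, and the number just passed is
appended if it is an unrefuted candidate below. Declaring larger counters to be smaller makes both
moves descend in `(1+α)^γ`, where α is the order of stages `(e, c, s)` (`exists_approx_succ`). This
α is a well order because the counter is bounded for each single e: by the moment of refutation if e
gets refuted, and by an unrefutable successor otherwise. Progressivity enters only here, and no
bound uniform in e is needed. The resulting infinite descent contradicts well-foundedness.

The coding rests on the classes `Tm` and `Df`: instance search produces one bounded formula that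
defines a relation in all models, to which comprehension and induction then apply. -/

set_option linter.unusedVariables false
set_option linter.unusedSectionVars false
namespace SOA

/-! ### Uniformly `Δ₀`-definable relations -/

/-- The first-order part of some model of `RCA₀`. -/
class RCA (M : Type u) [Arith M] : Prop where
  exists_model : ∃ S : Set (Set M), ModelsRCA0 S

/-- Functions of the set and number variables. -/
abbrev Fun1 := ∀ (M : Type u) [Arith M] [RCA M], (ℕ → Set M) → (ℕ → M) → M

/-- Relations between the set and number variables. -/
abbrev Rel1 := ∀ (M : Type u) [Arith M] [RCA M], (ℕ → Set M) → (ℕ → M) → Prop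

/-- `f` is given by a term. -/
class Tm (f : Fun1.{u}) : Prop where
  out : ∃ t : NTerm, ∀ (M : Type u) [Arith M] [RCA M] (V : ℕ → Set M) (v : ℕ → M),
    t.eval v = f M V v

/-- `P` is given by a bounded formula. -/
class Df (P : Rel1.{u}) : Prop where
  out : ∃ φ : BFormula, ∀ (M : Type u) [Arith M] [RCA M] (V : ℕ → Set M) (v : ℕ → M),
    φ.Holds V v ↔ P M V v

theorem Df.congr {P Q : Rel1.{u}} [h : Df P]
    (e : ∀ (M : Type u) [Arith M] [RCA M] (V : ℕ → Set M) (v : ℕ → M), Q M V v ↔ P M V v) :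
    Df Q :=
  let ⟨φ, hφ⟩ := h.out
  ⟨φ, fun M _ _ V v => (hφ M V v).trans (e M V v).symm⟩

instance Tm.var (i : ℕ) : Tm (fun _ _ _ _ v => v i) := ⟨.var i, fun _ _ _ _ _ => rfl⟩
instance Tm.zero : Tm.{u} (fun _ _ _ _ _ => 0) := ⟨.zero, fun _ _ _ _ _ => rfl⟩
instance Tm.one : Tm.{u} (fun _ _ _ _ _ => 1) := ⟨.one, fun _ _ _ _ _ => rfl⟩

section
variable {f g : Fun1.{u}} {P Q : Rel1.{u}}

instance Tm.add [hf : Tm f] [hg : Tm g] : Tm (fun M _ _ V v => f M V v + g M V v) :=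
  let ⟨s, hs⟩ := hf.out
  let ⟨t, ht⟩ := hg.out
  ⟨.add s t, fun M _ _ V v => by simp [NTerm.eval, hs M V v, ht M V v]⟩

instance Tm.mul [hf : Tm f] [hg : Tm g] : Tm (fun M _ _ V v => f M V v * g M V v) :=
  let ⟨s, hs⟩ := hf.out
  let ⟨t, ht⟩ := hg.out
  ⟨.mul s t, fun M _ _ V v => by simp [NTerm.eval, hs M V v, ht M V v]⟩

instance Tm.pair [Tm f] [Tm g] : Tm (fun M _ _ V v => pair (f M V v) (g M V v)) := by
  unfold SOA.pair; infer_instance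

instance Df.eq [hf : Tm f] [hg : Tm g] : Df (fun M _ _ V v => f M V v = g M V v) :=
  let ⟨s, hs⟩ := hf.out
  let ⟨t, ht⟩ := hg.out
  ⟨.eq s t, fun M _ _ V v => by simp [BFormula.Holds, hs M V v, ht M V v]⟩

instance Df.lt [hf : Tm f] [hg : Tm g] : Df (fun M _ _ V v => f M V v < g M V v) :=
  let ⟨s, hs⟩ := hf.out
  let ⟨t, ht⟩ := hg.out
  ⟨.lt s t, fun M _ _ V v => by simp [BFormula.Holds, hs M V v, ht M V v]⟩

instance Df.mem [hf : Tm f] (X : ℕ) : Df (fun M _ _ V v => f M V v ∈ V X) :=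
  let ⟨s, hs⟩ := hf.out
  ⟨.mem s X, fun M _ _ V v => by simp [BFormula.Holds, hs M V v]⟩

instance Df.and [hP : Df P] [hQ : Df Q] : Df (fun M _ _ V v => P M V v ∧ Q M V v) :=
  let ⟨s, hs⟩ := hP.out
  let ⟨t, ht⟩ := hQ.out
  ⟨.and s t, fun M _ _ V v => by simp [BFormula.Holds, hs M V v, ht M V v]⟩

instance Df.or [hP : Df P] [hQ : Df Q] : Df (fun M _ _ V v => P M V v ∨ Q M V v) :=
  let ⟨s, hs⟩ := hP.out
  let ⟨t, ht⟩ := hQ.out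
  ⟨.or s t, fun M _ _ V v => by simp [BFormula.Holds, hs M V v, ht M V v]⟩

instance Df.not [hP : Df P] : Df (fun M _ _ V v => ¬ P M V v) :=
  let ⟨s, hs⟩ := hP.out
  ⟨.neg s, fun M _ _ V v => by simp [BFormula.Holds, hs M V v]⟩

instance Df.ne [hf : Tm f] [hg : Tm g] : Df (fun M _ _ V v => f M V v ≠ g M V v) :=
  Df.not (P := fun M _ _ V v => f M V v = g M V v)

instance Df.imp [hP : Df P] [hQ : Df Q] : Df (fun M _ _ V v => P M V v → Q M V v) :=
  Df.congr (P := fun M _ _ V v => ¬ P M V v ∨ Q M V v)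
    fun _ _ _ _ _ => by tauto

instance Df.iff [hP : Df P] [hQ : Df Q] : Df (fun M _ _ V v => P M V v ↔ Q M V v) :=
  Df.congr (P := fun M _ _ V v => (P M V v → Q M V v) ∧ (Q M V v → P M V v))
    fun _ _ _ _ _ => by tauto

variable {R : ∀ (M : Type u) [Arith M] [RCA M], M → (ℕ → Set M) → (ℕ → M) → Prop}

/-- The relation `R` takes the bound variable as a separate argument so that unification can split a
quantified statement. The body is then required in the de Bruijn form of the formulas, with the
bound variable as `v 0` and all others shifted. -/
instance Df.ball [hf : Tm f] [hR : Df (fun M _ _ V v => R M (v 0) V (fun i => v (i + 1)))] :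
    Df (fun M _ _ V v => ∀ x, x < f M V v → R M x V v) :=
  let ⟨s, hs⟩ := hf.out
  let ⟨t, ht⟩ := hR.out
  ⟨.ball s t, fun M _ _ V v => by simp [BFormula.Holds, hs M V v, ht M V, cons]⟩

instance Df.bex [hf : Tm f] [hR : Df (fun M _ _ V v => R M (v 0) V (fun i => v (i + 1)))] :
    Df (fun M _ _ V v => ∃ x, x < f M V v ∧ R M x V v) :=
  let ⟨s, hs⟩ := hf.out
  let ⟨t, ht⟩ := hR.out
  ⟨.bex s t, fun M _ _ V v => by simp [BFormula.Holds, hs M V v, ht M V, cons]⟩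

end

/-! ### Substitution of terms into bounded formulas -/

def NTerm.subst (σ : ℕ → NTerm) : NTerm → NTerm
  | .var i => σ i
  | .zero => .zero
  | .one => .one
  | .add s t => .add (s.subst σ) (t.subst σ)
  | .mul s t => .mul (s.subst σ) (t.subst σ)

/-- Extend a substitution to a context with one more variable. -/
def liftSubst (σ : ℕ → NTerm) : ℕ → NTerm
  | 0 => .var 0
  | i + 1 => (σ i).subst fun j => .var (j + 1)

def BFormula.subst : BFormula → (ℕ → NTerm) → BFormula
  | .eq s t, σ => .eq (s.subst σ) (t.subst σ)
  | .lt s t, σ => .lt (s.subst σ) (t.subst σ)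
  | .mem t X, σ => .mem (t.subst σ) X
  | .neg φ, σ => .neg (φ.subst σ)
  | .and φ ψ, σ => .and (φ.subst σ) (ψ.subst σ)
  | .or φ ψ, σ => .or (φ.subst σ) (ψ.subst σ)
  | .ball t φ, σ => .ball (t.subst σ) (φ.subst (liftSubst σ))
  | .bex t φ, σ => .bex (t.subst σ) (φ.subst (liftSubst σ))

section
variable {M : Type u} [Arith M]

theorem NTerm.eval_subst (σ : ℕ → NTerm) (v : ℕ → M) (t : NTerm) :
    (t.subst σ).eval v = t.eval (fun i => (σ i).eval v) := by
  induction t <;> simp_all [NTerm.subst, NTerm.eval]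

theorem eval_liftSubst (σ : ℕ → NTerm) (x : M) (v : ℕ → M) :
    (fun i => (liftSubst σ i).eval (cons x v)) = cons x (fun i => (σ i).eval v) := by
  funext i
  cases i with
  | zero => rfl
  | succ i => exact NTerm.eval_subst _ _ _

theorem BFormula.holds_subst (V : ℕ → Set M) (φ : BFormula) (σ : ℕ → NTerm) (v : ℕ → M) :
    (φ.subst σ).Holds V v ↔ φ.Holds V (fun i => (σ i).eval v) := by
  induction φ generalizing σ v <;>
    simp_all [BFormula.subst, BFormula.Holds, NTerm.eval_subst, eval_liftSubst]

end

theorem Df.subst {P : Rel1.{u}} (h : Df P) (σ : ℕ → Fun1.{u}) (hσ : ∀ i, Tm (σ i)) :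
    Df (fun M _ _ V v => P M V (fun i => σ i M V v)) := by
  obtain ⟨φ, hφ⟩ := h.out
  choose τ hτ using fun i => (hσ i).out
  refine ⟨φ.subst τ, fun M _ _ V v => ?_⟩
  rw [BFormula.holds_subst, hφ]
  exact iff_of_eq (congrArg _ (funext fun i => hτ i M V v))

instance Df.holds (φ : BFormula) (ρ : ℕ → ℕ) :
    Df (fun _ _ _ V v => φ.Holds V (fun i => v (ρ i))) :=
  Df.subst (P := fun _ _ _ V v => φ.Holds V v) ⟨φ, fun _ _ _ _ _ => Iff.rfl⟩
    (fun i _ _ _ _ v => v (ρ i)) fun _ => inferInstance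

theorem Df.rename {P : Rel1.{u}} [h : Df P] (ρ : ℕ → ℕ) :
    Df (fun M _ _ V v => P M V (fun i => v (ρ i))) :=
  h.subst (fun i _ _ _ _ v => v (ρ i)) fun _ => inferInstance

section
variable {f g k : Fun1.{u}} [Tm f] [Tm g] [Tm k]

/-- These substitution rules reduce definability of a relation between arbitrary terms to the case
of variables, where the bounds for hidden quantifiers are easy to write down. -/
theorem Df.subst₁ {P : ∀ (M : Type u) [Arith M] [RCA M], (ℕ → Set M) → M → Prop}
    (h : Df (fun M _ _ V v => P M V (v 0))) : Df (fun M _ _ V v => P M V (f M V v)) :=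
  h.subst (fun _ => f) fun _ => inferInstance

theorem Df.subst₂ {P : ∀ (M : Type u) [Arith M] [RCA M], (ℕ → Set M) → M → M → Prop}
    (h : Df (fun M _ _ V v => P M V (v 0) (v 1))) :
    Df (fun M _ _ V v => P M V (f M V v) (g M V v)) :=
  h.subst (fun | 0 => f | _ => g) fun i => by
    obtain _ | i := i
    exacts [‹Tm f›, ‹Tm g›]

theorem Df.subst₃ {P : ∀ (M : Type u) [Arith M] [RCA M], (ℕ → Set M) → M → M → M → Prop}
    (h : Df (fun M _ _ V v => P M V (v 0) (v 1) (v 2))) :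
    Df (fun M _ _ V v => P M V (f M V v) (g M V v) (k M V v)) :=
  h.subst (fun | 0 => f | 1 => g | _ => k) fun i => by
    obtain _ | _ | i := i
    exacts [‹Tm f›, ‹Tm g›, ‹Tm k›]

end

theorem ModelsRCA0.rca {M : Type u} [Arith M] {S : Set (Set M)} (h : ModelsRCA0 S) : RCA M :=
  ⟨S, h⟩

/-! ### Comprehension and induction for definable relations -/

section
variable {M : Type u} [Arith M] [RCA M] {S : Set (Set M)}

/-- `Δ₀`-comprehension. -/
theorem ModelsRCA0.comp (h : ModelsRCA0 S) (P : Rel1.{u}) [hP : Df P] (V : ℕ → Set M)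
    (hV : ∀ i, V i ∈ S) (v : ℕ → M) : {n | P M V (cons n v)} ∈ S := by
  -- The shift frees variable 0 for a dummy unbounded quantifier, so that one formula serves both as
  -- the `Σ⁰₁` and as the `Π⁰₁` definition.
  obtain ⟨φ, hφ⟩ := (Df.rename (P := P) Nat.succ).out
  have key : ∀ m n, φ.Holds V (cons m (cons n v)) ↔ P M V (cons n v) := fun m n => hφ M V _
  convert h.delta1_comprehension φ φ V v hV fun n => ?_ using 3 with n
  · exact ⟨fun hn => ⟨0, (key _ _).2 hn⟩, fun ⟨m, hm⟩ => (key _ _).1 hm⟩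
  · exact ⟨fun ⟨m, hm⟩ m' => (key _ _).2 ((key _ _).1 hm), fun hm => ⟨0, hm 0⟩⟩

/-- `Σ⁰₁`-induction. -/
theorem ModelsRCA0.sigma_ind (h : ModelsRCA0 S) (P : Rel1.{u}) [hP : Df P] (V : ℕ → Set M)
    (hV : ∀ i, V i ∈ S) (v : ℕ → M) (h0 : ∃ m, P M V (cons m (cons 0 v)))
    (h1 : ∀ n, (∃ m, P M V (cons m (cons n v))) → ∃ m, P M V (cons m (cons (n + 1) v))) (n : M) :
    ∃ m, P M V (cons m (cons n v)) := by
  obtain ⟨φ, hφ⟩ := hP.out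
  have key : ∀ n, φ.Sigma1 V (cons n v) ↔ ∃ m, P M V (cons m (cons n v)) :=
    fun n => exists_congr fun m => hφ M V _
  exact (key n).1 (h.sigma1_induction φ V v hV ((key 0).2 h0)
    (fun n hn => (key _).2 (h1 n ((key n).1 hn))) n)

/-- `Δ⁰₁`-comprehension. -/
theorem ModelsRCA0.delta_comp (h : ModelsRCA0 S) (P Q : Rel1.{u}) [hP : Df P] [hQ : Df Q]
    (V : ℕ → Set M) (hV : ∀ i, V i ∈ S) (v : ℕ → M)
    (e : ∀ n, (∃ m, P M V (cons m (cons n v))) ↔ ∀ m, Q M V (cons m (cons n v))) :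
    {n | ∃ m, P M V (cons m (cons n v))} ∈ S := by
  obtain ⟨φ, hφ⟩ := hP.out
  obtain ⟨ψ, hψ⟩ := hQ.out
  have key : ∀ n, φ.Sigma1 V (cons n v) ↔ ∃ m, P M V (cons m (cons n v)) :=
    fun n => exists_congr fun m => hφ M V _
  have key' : ∀ n, ψ.Pi1 V (cons n v) ↔ ∀ m, Q M V (cons m (cons n v)) :=
    fun n => forall_congr' fun m => hψ M V _
  convert h.delta1_comprehension φ ψ V v hV fun n => ?_ using 3 with n
  · exact (key n).symm
  · rw [key, key', e]

end

end SOA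

namespace SOA

/-! ### Arithmetic in models of `RCA₀` -/

section
variable {M : Type u} [Arith M]

theorem ModelsRCA0.empty_mem {S : Set (Set M)} (h : ModelsRCA0 S) : ∅ ∈ S := by
  have := h.rca
  obtain ⟨A, hA⟩ := h.nonempty
  convert h.comp (fun M _ _ _ v => v 0 ≠ v 0) (fun _ => A) (fun _ => hA) (fun _ => 0) using 1
  simp

variable [RCA M]

theorem ModelsRCA0.ind {S : Set (Set M)} (h : ModelsRCA0 S) (P : Rel1.{u}) [hP : Df P]
    (V : ℕ → Set M) (hV : ∀ i, V i ∈ S) (v : ℕ → M) (h0 : P M V (cons 0 v))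
    (h1 : ∀ n, P M V (cons n v) → P M V (cons (n + 1) v)) (n : M) : P M V (cons n v) := by
  have := Df.rename (P := P) Nat.succ
  exact (h.sigma_ind (fun M _ _ V v => P M V (fun i => v i.succ)) V hV v ⟨0, h0⟩
    (fun n ⟨_, hn⟩ => ⟨0, h1 n hn⟩) n).elim fun _ h => h

/-- Facts about the first-order part involve no sets, so any model over `M` will do, with all set
variables interpreted by `∅`. -/
theorem RCA.ind (P : Rel1.{u}) [hP : Df P] (v : ℕ → M) (h0 : P M (fun _ => ∅) (cons 0 v))
    (h1 : ∀ n, P M (fun _ => ∅) (cons n v) → P M (fun _ => ∅) (cons (n + 1) v)) (n : M) :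
    P M (fun _ => ∅) (cons n v) :=
  let ⟨_, h⟩ := RCA.exists_model (M := M)
  h.ind P _ (fun _ => h.empty_mem) v h0 h1 n

namespace Arith

theorem add_zero (m : M) : m + 0 = m := (RCA.exists_model (M := M)).elim fun _ h => h.add_zero m
theorem add_succ (m n : M) : m + (n + 1) = (m + n) + 1 :=
  (RCA.exists_model (M := M)).elim fun _ h => h.add_succ m n
theorem mul_zero (m : M) : m * 0 = 0 := (RCA.exists_model (M := M)).elim fun _ h => h.mul_zero m
theorem mul_succ (m n : M) : m * (n + 1) = m * n + m :=
  (RCA.exists_model (M := M)).elim fun _ h => h.mul_succ m n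
theorem succ_ne_zero (n : M) : n + 1 ≠ 0 :=
  (RCA.exists_model (M := M)).elim fun _ h => h.succ_ne_zero n
theorem succ_inj {m n : M} : m + 1 = n + 1 → m = n :=
  (RCA.exists_model (M := M)).elim fun _ h => h.succ_inj m n
theorem not_lt_zero (m : M) : ¬ m < 0 :=
  (RCA.exists_model (M := M)).elim fun _ h => h.not_lt_zero m
theorem lt_succ {m n : M} : m < n + 1 ↔ (m < n ∨ m = n) :=
  (RCA.exists_model (M := M)).elim fun _ h => h.lt_succ m n

theorem zero_add (n : M) : 0 + n = n :=
  RCA.ind (fun M _ _ _ v => 0 + v 0 = v 0) (fun _ => 0) (add_zero 0)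
    (fun n (h : 0 + n = n) => show 0 + (n + 1) = n + 1 by rw [add_succ, h]) n

theorem add_assoc (a b c : M) : a + b + c = a + (b + c) :=
  RCA.ind (fun M _ _ _ v => v 1 + v 2 + v 0 = v 1 + (v 2 + v 0)) (cons a (cons b fun _ => 0))
    (show a + b + 0 = a + (b + 0) by rw [add_zero, add_zero])
    (fun n (h : a + b + n = a + (b + n)) => show a + b + (n + 1) = a + (b + (n + 1)) by
      rw [add_succ, add_succ, add_succ, h]) c

theorem succ_add (a b : M) : a + 1 + b = a + b + 1 :=
  RCA.ind (fun M _ _ _ v => v 1 + 1 + v 0 = v 1 + v 0 + 1) (cons a fun _ => 0)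
    (show a + 1 + 0 = a + 0 + 1 by rw [add_zero, add_zero])
    (fun n (h : a + 1 + n = a + n + 1) => show a + 1 + (n + 1) = a + (n + 1) + 1 by
      rw [add_succ, h, add_succ]) b

theorem add_comm (a b : M) : a + b = b + a :=
  RCA.ind (fun M _ _ _ v => v 1 + v 0 = v 0 + v 1) (cons a fun _ => 0)
    (show a + 0 = 0 + a by rw [add_zero, zero_add])
    (fun n (h : a + n = n + a) => show a + (n + 1) = n + 1 + a by
      rw [add_succ, h, succ_add]) b

theorem zero_mul (a : M) : 0 * a = 0 :=
  RCA.ind (fun M _ _ _ v => 0 * v 0 = 0) (fun _ => 0) (mul_zero 0)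
    (fun n (h : 0 * n = 0) => show 0 * (n + 1) = 0 by rw [mul_succ, h, add_zero]) a

theorem succ_mul (a b : M) : (a + 1) * b = a * b + b :=
  RCA.ind (fun M _ _ _ v => (v 1 + 1) * v 0 = v 1 * v 0 + v 0) (cons a fun _ => 0)
    (show (a + 1) * 0 = a * 0 + 0 by rw [mul_zero, mul_zero, add_zero])
    (fun n (h : (a + 1) * n = a * n + n) => show (a + 1) * (n + 1) = a * (n + 1) + (n + 1) by
      rw [mul_succ, mul_succ, h, add_succ, add_succ, add_assoc (a * n), add_comm n a, ← add_assoc]) b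

theorem mul_comm (a b : M) : a * b = b * a :=
  RCA.ind (fun M _ _ _ v => v 1 * v 0 = v 0 * v 1) (cons a fun _ => 0)
    (show a * 0 = 0 * a by rw [mul_zero, zero_mul])
    (fun n (h : a * n = n * a) => show a * (n + 1) = (n + 1) * a by
      rw [mul_succ, h, succ_mul]) b

theorem mul_add (a b c : M) : a * (b + c) = a * b + a * c :=
  RCA.ind (fun M _ _ _ v => v 1 * (v 2 + v 0) = v 1 * v 2 + v 1 * v 0)
    (cons a (cons b fun _ => 0))
    (show a * (b + 0) = a * b + a * 0 by rw [add_zero, mul_zero, add_zero])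
    (fun n (h : a * (b + n) = a * b + a * n) =>
      show a * (b + (n + 1)) = a * b + a * (n + 1) by
        rw [add_succ, mul_succ, h, mul_succ, add_assoc]) c

theorem mul_assoc (a b c : M) : a * b * c = a * (b * c) :=
  RCA.ind (fun M _ _ _ v => v 1 * v 2 * v 0 = v 1 * (v 2 * v 0)) (cons a (cons b fun _ => 0))
    (show a * b * 0 = a * (b * 0) by rw [mul_zero, mul_zero, mul_zero])
    (fun n (h : a * b * n = a * (b * n)) => show a * b * (n + 1) = a * (b * (n + 1)) by
      rw [mul_succ, mul_succ, mul_add, h]) c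

theorem mul_one (a : M) : a * 1 = a := by
  rw [← zero_add (1 : M), mul_succ, mul_zero, zero_add]

theorem add_right_cancel (a b c : M) : a + c = b + c → a = b :=
  RCA.ind (fun M _ _ _ v => v 1 + v 0 = v 2 + v 0 → v 1 = v 2) (cons a (cons b fun _ => 0))
    (show a + 0 = b + 0 → a = b by rw [add_zero, add_zero]; exact id)
    (fun n (h : a + n = b + n → a = b) => show a + (n + 1) = b + (n + 1) → a = b by
      rw [add_succ, add_succ]; exact fun e => h (succ_inj e)) c

theorem zero_lt_succ (n : M) : 0 < n + 1 :=
  RCA.ind (fun M _ _ _ v => 0 < v 0 + 1) (fun _ => 0) (lt_succ.2 (Or.inr rfl))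
    (fun n (h : 0 < n + 1) => lt_succ.2 (Or.inl h)) n

theorem succ_lt_succ (n : M) : ∀ x, x < n → x + 1 < n + 1 :=
  RCA.ind (fun M _ _ _ v => ∀ x, x < v 0 → x + 1 < v 0 + 1) (fun _ => 0)
    (fun x hx => (not_lt_zero x hx).elim)
    (fun n (h : ∀ x, x < n → x + 1 < n + 1) x hx => lt_succ.2 <| (lt_succ.1 hx).imp (h x)
      (congrArg (· + 1))) n

/-- The bound `z < y` is there to keep the induction formula bounded. -/
theorem exists_add_of_lt (x y : M) : x < y → ∃ z, z < y ∧ y = x + z + 1 :=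
  RCA.ind (fun M _ _ _ v => v 1 < v 0 → ∃ z, z < v 0 ∧ v 0 = v 1 + z + 1) (cons x fun _ => 0)
    (fun h => (not_lt_zero _ h).elim)
    (fun n (h : x < n → ∃ z, z < n ∧ n = x + z + 1) (hx : x < n + 1) => by
      change ∃ z, z < n + 1 ∧ n + 1 = x + z + 1
      obtain hx | rfl := lt_succ.1 hx
      · obtain ⟨z, hz, e⟩ := h hx
        exact ⟨z + 1, succ_lt_succ n z hz, by rw [add_succ, ← e]⟩
      · exact ⟨0, zero_lt_succ _, by rw [add_zero]⟩) y

theorem lt_add_succ (x z : M) : x < x + z + 1 :=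
  RCA.ind (fun M _ _ _ v => v 1 < v 1 + v 0 + 1) (cons x fun _ => 0)
    (show x < x + 0 + 1 by rw [add_zero]; exact lt_succ.2 (Or.inr rfl))
    (fun n (h : x < x + n + 1) => show x < x + (n + 1) + 1 by
      rw [add_succ]; exact lt_succ.2 (Or.inl h)) z

theorem lt_iff {x y : M} : x < y ↔ ∃ z, y = x + z + 1 :=
  ⟨fun h => let ⟨z, _, hz⟩ := exists_add_of_lt x y h; ⟨z, hz⟩,
    fun ⟨z, hz⟩ => hz ▸ lt_add_succ x z⟩

theorem lt_irrefl (x : M) : ¬ x < x := by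
  rw [lt_iff]; rintro ⟨z, hz⟩
  refine succ_ne_zero z (add_right_cancel _ _ x ?_)
  rw [zero_add, add_comm, ← add_assoc, ← hz]

theorem lt_trans {x y z : M} : x < y → y < z → x < z := by
  simp only [lt_iff]; rintro ⟨a, rfl⟩ ⟨b, rfl⟩
  exact ⟨a + 1 + b, by simp only [add_assoc]⟩

theorem lt_trichotomy (x y : M) : x < y ∨ x = y ∨ y < x :=
  RCA.ind (fun M _ _ _ v => v 1 < v 0 ∨ v 1 = v 0 ∨ v 0 < v 1) (cons x fun _ => 0)
    (RCA.ind (fun M _ _ _ v => v 0 < 0 ∨ v 0 = 0 ∨ 0 < v 0) (fun _ => 0) (Or.inr (Or.inl rfl))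
      (fun n _ => Or.inr (Or.inr (zero_lt_succ n))) x)
    (fun n (h : x < n ∨ x = n ∨ n < x) => show x < n + 1 ∨ x = n + 1 ∨ n + 1 < x by
      obtain h | h | h := h
      · exact Or.inl (lt_succ.2 (Or.inl h))
      · exact Or.inl (lt_succ.2 (Or.inr h))
      · obtain ⟨z, hz, e⟩ := exists_add_of_lt _ _ h
        subst e
        obtain ⟨w, hw⟩ | rfl : (∃ w, z = w + 1) ∨ z = 0 := by
          refine RCA.ind (fun M _ _ _ v => (∃ w, w < v 0 ∧ v 0 = w + 1) ∨ v 0 = 0) (fun _ => 0)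
            (Or.inr rfl) (fun n _ => Or.inl ⟨n, lt_succ.2 (Or.inr rfl), rfl⟩) z |>.imp
            (fun ⟨w, _, h⟩ => ⟨w, h⟩) id
        · subst hw
          exact Or.inr (Or.inr (lt_iff.2 ⟨w, by rw [succ_add, add_succ]⟩))
        · exact Or.inr (Or.inl (by rw [add_zero]))) y

end Arith

/-! ### The ordered semiring structure of the first-order part -/

instance : CommSemiring M where
  add_assoc := Arith.add_assoc
  zero_add := Arith.zero_add
  add_zero := Arith.add_zero
  add_comm := Arith.add_comm
  left_distrib := Arith.mul_add
  right_distrib a b c := by rw [Arith.mul_comm, Arith.mul_add, Arith.mul_comm c, Arith.mul_comm c]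
  zero_mul := Arith.zero_mul
  mul_zero := Arith.mul_zero
  mul_assoc := Arith.mul_assoc
  one_mul a := by rw [Arith.mul_comm, Arith.mul_one]
  mul_one := Arith.mul_one
  mul_comm := Arith.mul_comm
  nsmul := nsmulRec

noncomputable instance : LinearOrder M where
  le x y := x < y ∨ x = y
  le_refl x := Or.inr rfl
  le_trans x y z := by
    rintro (h | rfl) (h' | rfl)
    exacts [Or.inl (Arith.lt_trans h h'), Or.inl h, Or.inl h', Or.inr rfl]
  le_antisymm x y := by
    rintro (h | rfl) (h' | h')
    exacts [(Arith.lt_irrefl _ (Arith.lt_trans h h')).elim, h'.symm, rfl, rfl]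
  lt_iff_le_not_ge x y := by
    constructor
    · refine fun h => ⟨Or.inl h, ?_⟩
      rintro (h' | rfl)
      exacts [Arith.lt_irrefl _ (Arith.lt_trans h h'), Arith.lt_irrefl _ h]
    · rintro ⟨h | rfl, h'⟩
      exacts [h, (h' (Or.inr rfl)).elim]
  le_total x y := by
    obtain h | h | h := Arith.lt_trichotomy x y
    exacts [Or.inl (Or.inl h), Or.inl (Or.inr h), Or.inr (Or.inl h)]
  toDecidableLE := Classical.decRel _
  toDecidableEq := Classical.decEq _
  toDecidableLT := Classical.decRel _

namespace Arith

theorem lt_add_one_iff {x y : M} : x < y + 1 ↔ x ≤ y := lt_succ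

theorem add_one_le_iff {x y : M} : x + 1 ≤ y ↔ x < y := by
  constructor
  · exact fun h => lt_of_lt_of_le (lt_add_one_iff.2 le_rfl) h
  · intro h
    obtain ⟨z, rfl⟩ := lt_iff.1 h
    rw [← not_lt, lt_add_one_iff, not_le]
    exact lt_of_le_of_lt (lt_add_one_iff.1 (lt_add_succ x z)) (lt_add_one_iff.2 le_rfl)

theorem zero_le (x : M) : 0 ≤ x := not_lt.1 (not_lt_zero x)

theorem le_iff {x y : M} : x ≤ y ↔ ∃ z, y = x + z := by
  rw [← lt_add_one_iff, lt_iff]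
  exact exists_congr fun z => ⟨succ_inj, fun h => by rw [h]⟩

end Arith

instance : IsStrictOrderedRing M where
  add_le_add_left a b h c := by
    obtain ⟨d, rfl⟩ := Arith.le_iff.1 h
    exact Arith.le_iff.2 ⟨d, by ring⟩
  le_of_add_le_add_left a b c h := by
    obtain ⟨d, hd⟩ := Arith.le_iff.1 h
    exact Arith.le_iff.2 ⟨d, Arith.add_right_cancel _ _ a (by rw [Arith.add_comm, hd]; ring)⟩
  zero_le_one := Arith.zero_le 1
  mul_lt_mul_of_pos_left a ha b c h := by
    obtain ⟨d, rfl⟩ := Arith.lt_iff.1 h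
    obtain ⟨e, rfl⟩ := Arith.lt_iff.1 ha
    exact Arith.lt_iff.2 ⟨e * d + e + d, by ring⟩
  mul_lt_mul_of_pos_right a ha b c h := by
    obtain ⟨d, rfl⟩ := Arith.lt_iff.1 h
    obtain ⟨e, rfl⟩ := Arith.lt_iff.1 ha
    exact Arith.lt_iff.2 ⟨e * d + e + d, by ring⟩
  exists_pair_ne := ⟨0, 1, fun h => Arith.succ_ne_zero (0 : M) (by rw [Arith.zero_add, ← h])⟩

instance : CanonicallyOrderedAdd M where
  exists_add_of_le h := Arith.le_iff.1 h
  le_add_self a b := Arith.le_iff.2 ⟨b, Arith.add_comm b a⟩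
  le_self_add a b := Arith.le_iff.2 ⟨b, rfl⟩

end
end SOA

namespace SOA

/-! ### Pairs and codes of finite sets -/

section
variable {f g : Fun1.{u}} {R : ∀ (M : Type u) [Arith M] [RCA M], M → (ℕ → Set M) → (ℕ → M) → Prop}

instance Df.le [hf : Tm f] [hg : Tm g] : Df (fun M _ _ V v => f M V v ≤ g M V v) :=
  Df.congr (P := fun M _ _ V v => f M V v < g M V v ∨ f M V v = g M V v)
    fun M _ _ V v => Iff.rfl

instance Df.ball_le [Tm f] [hR : Df (fun M _ _ V v => R M (v 0) V (fun i => v (i + 1)))] :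
    Df (fun M _ _ V v => ∀ x, x ≤ f M V v → R M x V v) :=
  Df.congr (P := fun M _ _ V v => ∀ x, x < f M V v + 1 → R M x V v)
    fun M _ _ V v => by simp only [Arith.lt_add_one_iff]

instance Df.bex_le [Tm f] [hR : Df (fun M _ _ V v => R M (v 0) V (fun i => v (i + 1)))] :
    Df (fun M _ _ V v => ∃ x, x ≤ f M V v ∧ R M x V v) :=
  Df.congr (P := fun M _ _ V v => ∃ x, x < f M V v + 1 ∧ R M x V v)
    fun M _ _ V v => by simp only [Arith.lt_add_one_iff]

end

theorem cons_mem {M : Type u} {S : Set (Set M)} {A : Set M} {V : ℕ → Set M} (hA : A ∈ S)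
    (hV : ∀ i, V i ∈ S) (i : ℕ) : cons A V i ∈ S := by
  cases i
  exacts [hA, hV _]

section
variable {M : Type u} [Arith M] [RCA M] {S : Set (Set M)}

theorem left_le_pair (i j : M) : i ≤ pair i j := le_add_self

theorem right_le_pair (i j : M) : j ≤ pair i j := by
  have h : j ≤ j * j := by
    obtain h | h := (Arith.zero_le j).eq_or_lt
    · rw [← h, mul_zero]
    · exact le_mul_of_one_le_left' (by rw [← zero_add (1 : M), Arith.add_one_le_iff]; exact h)
  calc j ≤ j * j := h
    _ ≤ (i + j) * (i + j) := by gcongr <;> exact le_add_self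
    _ ≤ pair i j := le_self_add

theorem pair_inj {i j i' j' : M} : pair i j = pair i' j' ↔ i = i' ∧ j = j' := by
  refine ⟨fun h => ?_, fun h => by rw [h.1, h.2]⟩
  -- The code of `(i, j)` lies between `(i+j)²` and `(i+j+1)²`, the latter excluded, so it
  -- determines the sum `i + j`.
  have key : ∀ i j i' j' : M, pair i j = pair i' j' → ¬ i + j < i' + j' := by
    intro i j i' j' h hlt
    rw [← Arith.add_one_le_iff] at hlt
    have h1 : (i + j + 1) * (i + j + 1) ≤ (i' + j') * (i' + j') := by gcongr
    have h2 : pair i j < (i + j + 1) * (i + j + 1) := by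
      rw [Arith.lt_iff]
      exact ⟨i + j + j, by unfold pair; ring⟩
    have h3 : (i' + j') * (i' + j') ≤ pair i' j' := le_self_add
    exact absurd h (h2.trans_le (h1.trans h3)).ne
  have e : i + j = i' + j' := le_antisymm (not_lt.1 (key _ _ _ _ h.symm)) (not_lt.1 (key _ _ _ _ h))
  have e' : i = i' := by
    unfold pair at h
    rw [e] at h
    exact add_left_cancel h
  subst e'
  exact ⟨rfl, add_left_cancel e⟩

/-- The least number principle for bounded formulas. -/
theorem ModelsRCA0.exists_least (h : ModelsRCA0 S) (P : Rel1.{u}) [Df P] (V : ℕ → Set M)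
    (hV : ∀ i, V i ∈ S) (v : ℕ → M) (a : M) (ha : P M V (cons a v)) :
    ∃ b, P M V (cons b v) ∧ ∀ c, c < b → ¬ P M V (cons c v) := by
  by_contra! hne
  set X := {n | P M V (cons n v)} with hX
  have hXS : X ∈ S := h.comp P V hV v
  -- Without a least element, induction shows that no number below n belongs to `X`.
  have key := h.ind (fun M _ _ V v => ∀ x, x < v 0 → ¬ v 0 ∈ V 0 ∧ ¬ x ∈ V 0) (fun _ => X)
    (fun _ => hXS) (fun _ => 0) (fun x hx => (Arith.not_lt_zero _ hx).elim)
    (fun n hn => by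
      change ∀ x, x < n → ¬ n ∈ X ∧ ¬ x ∈ X at hn
      change ∀ x, x < n + 1 → ¬ n + 1 ∈ X ∧ ¬ x ∈ X
      have h1 : ∀ x, x < n → x ∉ X := fun x hx => (hn x hx).2
      have h2 : n ∉ X := fun hn' => by
        obtain ⟨c, hc, hc'⟩ := hne n hn'
        exact h1 c hc hc'
      have h3 : ∀ x, x < n + 1 → x ∉ X := fun x hx => by
        obtain hx | rfl := Arith.lt_succ.1 hx
        exacts [h1 x hx, h2]
      refine fun x hx => ⟨fun hn' => ?_, h3 x hx⟩
      obtain ⟨c, hc, hc'⟩ := hne (n + 1) hn'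
      exact h3 c hc hc') (a + 1)
  exact (key a (Arith.lt_add_one_iff.2 le_rfl)).2 ha

/-- The `Σ⁰₁` least number principle. -/
theorem ModelsRCA0.exists_least_sigma (h : ModelsRCA0 S) {X : Set M} (hX : X ∈ S) {a w : M}
    (ha : pair a w ∈ X) : ∃ b, (∃ m, pair b m ∈ X) ∧ ∀ c m, pair c m ∈ X → b ≤ c := by
  by_contra! hne
  -- If each element had a smaller one, then n steps down from a would lead to some y with `y + n ≤
  -- a`, which is absurd for `n = a + 1`. A single number bounds y and its witness, so the induction
  -- formula is `Σ⁰₁`.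
  obtain ⟨m, x, -, y, -, -, hx⟩ := h.sigma_ind
    (fun M _ _ V v => ∃ y, y ≤ v 0 ∧ ∃ m, m ≤ v 0 ∧ pair y m ∈ V 0 ∧ y + v 1 ≤ v 2)
    (fun _ => X) (fun _ => hX) (cons a fun _ => 0)
    ⟨pair a w, a, left_le_pair _ _, w, right_le_pair _ _, ha, by
      change a + 0 ≤ a; rw [_root_.add_zero]⟩
    (fun n ⟨_, y, _, m, _, hm, (hy : y + n ≤ a)⟩ => by
      obtain ⟨c, k, hk, hc⟩ := hne y ⟨m, hm⟩
      refine ⟨pair c k, c, left_le_pair _ _, k, right_le_pair _ _, hk, ?_⟩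
      change c + (n + 1) ≤ a
      rw [← Arith.add_one_le_iff] at hc
      grind) (a + 1)
  change x + (a + 1) ≤ a at hx
  have := Arith.zero_le x
  have := zero_lt_one (α := M)
  grind

instance Df.dvd {f g : Fun1.{u}} [Tm f] [Tm g] : Df (fun M _ _ V v => f M V v ∣ g M V v) :=
  Df.subst₂ (P := fun _ _ _ _ x y => x ∣ y) <|
    Df.congr (P := fun _ _ _ _ v => ∃ q, q ≤ v 1 ∧ v 1 = v 0 * q) fun M _ _ V v => by
      constructor
      · rintro ⟨q, hq⟩
        obtain h | h := (Arith.zero_le (v 0)).eq_or_lt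
        -- With divisor 0 the given quotient may exceed the bound; 0 works as well.
        · exact ⟨0, Arith.zero_le _, by rw [hq, ← h]; simp⟩
        · refine ⟨q, ?_, hq⟩
          rw [hq]
          exact le_mul_of_one_le_left' (by rw [← zero_add (1 : M), Arith.add_one_le_iff]; exact h)
      · rintro ⟨q, -, hq⟩
        exact ⟨q, hq⟩

theorem Arith.dvd_of_dvd_add {a x y : M} (hx : a ∣ x) (hy : a ∣ x + y) : a ∣ y := by
  obtain ⟨u, rfl⟩ := hx
  obtain ⟨w, hw⟩ := hy
  obtain h | h := le_total u w
  · obtain ⟨z, rfl⟩ := Arith.le_iff.1 h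
    exact ⟨z, by rw [mul_add] at hw; exact add_left_cancel hw⟩
  · have : a * w ≤ a * u := by gcongr
    rw [← hw] at this
    have hy : y = 0 := by have := Arith.zero_le y; grind
    rw [hy]; exact dvd_zero _

/-- Consecutive moduli of the beta function are coprime. -/
theorem Arith.dvd_of_dvd_mul {m i j d n : M} (hd : d ∣ m) (hij : i = j + d ∨ j = i + d)
    (h : m * (i + 1) + 1 ∣ n * (m * (j + 1) + 1)) : m * (i + 1) + 1 ∣ n := by
  obtain ⟨e, rfl⟩ := hd
  set a := d * e * (i + 1) + 1 with ha
  set b := d * e * (j + 1) + 1 with hb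
  obtain rfl | rfl := hij
  -- Bézout without subtraction, with `m = d·e`: here `e(i+1)²·b + 1 = a·(e(i+1)(j+1) + 1)`, and in
  -- the other case `a·e(j+1)(i+1) + 1 = e(i+1)²·b + a`.
  · refine Arith.dvd_of_dvd_add (h.mul_left (e * (j + d + 1) * (j + d + 1))) ?_
    refine ⟨(e * (j + d + 1) * (j + 1) + 1) * n, ?_⟩
    rw [ha, hb]; ring
  · refine Arith.dvd_of_dvd_add (x := a * (e * (i + d + 1) * (i + 1) * n)) (dvd_mul_right _ _) ?_
    have : a * (e * (i + d + 1) * (i + 1) * n) + n = e * (i + 1) * (i + 1) * (n * b) + a * n := by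
      rw [ha, hb]; ring
    rw [this]
    exact dvd_add (h.mul_left _) (dvd_mul_right _ _)

/-- Such an m is divisible by all differences of indices below b, which makes the moduli `m(i+1)+1`
pairwise coprime. -/
theorem Arith.exists_common_multiple (b : M) : ∃ m : M, 0 < m ∧ ∀ j, j ≤ b → 0 < j → j ∣ m := by
  obtain ⟨S, h⟩ := RCA.exists_model (M := M)
  refine h.sigma_ind (fun M _ _ V v => 0 < v 0 ∧ ∀ j, j ≤ v 1 → 0 < j → j ∣ v 0) (fun _ => ∅)
    (fun _ => h.empty_mem) (fun _ => 0) ⟨1, ?_, ?_⟩ ?_ b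
  · exact zero_lt_one (α := M)
  · exact fun j (hj : j ≤ 0) hj' => absurd hj (not_le.2 hj')
  · rintro n ⟨m, (hm : 0 < m), (hm' : ∀ j, j ≤ n → 0 < j → j ∣ m)⟩
    refine ⟨m * (n + 1), ?_, ?_⟩
    · exact mul_pos hm (Arith.zero_lt_succ n)
    · change ∀ j, j ≤ n + 1 → 0 < j → j ∣ m * (n + 1)
      intro j hj hj'
      obtain hj | rfl := hj.lt_or_eq
      · exact (hm' j (Arith.lt_add_one_iff.1 hj) hj').mul_right _
      · exact dvd_mul_left _ _

/-- Gödel's beta function: n is the product of the moduli `m(j+1)+1` over all `j < b` in `X`, built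
up by `Σ⁰₁`-induction. By coprimality no other modulus with index below b divides it. -/
theorem ModelsRCA0.exists_code_aux (h : ModelsRCA0 S) {X : Set M} (hX : X ∈ S) (b : M) :
    ∃ m n : M, ∀ i, i < b → (m * (i + 1) + 1 ∣ n ↔ i ∈ X) := by
  obtain ⟨m, hm, hm'⟩ := Arith.exists_common_multiple b
  obtain ⟨n, hn⟩ := h.sigma_ind
    (fun M _ _ V v => ∀ i, i < v 2 → (v 3 * (i + 1) + 1 ∣ v 0 ↔ i ∈ V 0 ∧ i < v 1)) (fun _ => X)
    (fun _ => hX) (cons b (cons m fun _ => 0))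
    ⟨1, by
      change ∀ i, i < b → (m * (i + 1) + 1 ∣ 1 ↔ i ∈ X ∧ i < 0)
      intro i _
      refine ⟨?_, fun hi => (Arith.not_lt_zero _ hi.2).elim⟩
      rintro ⟨q, hq⟩
      exfalso
      -- Since m is positive, the modulus exceeds 1 and does not divide the empty product.
      have h1 : 0 < m * (i + 1) := mul_pos hm (Arith.zero_lt_succ i)
      have h2 : 0 < q := by
        refine pos_of_ne_zero ?_
        rintro rfl
        simp at hq
      have h3 : 0 < m * (i + 1) * q := mul_pos h1 h2
      rw [← Arith.add_one_le_iff] at h2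
      rw [add_mul, one_mul] at hq
      grind⟩
    (fun j ⟨n, hn⟩ => by
      change ∀ i, i < b → (m * (i + 1) + 1 ∣ n ↔ i ∈ X ∧ i < j) at hn
      by_cases hj : j < b ∧ j ∈ X
      · refine ⟨n * (m * (j + 1) + 1), ?_⟩
        change ∀ i, i < b → (m * (i + 1) + 1 ∣ n * (m * (j + 1) + 1) ↔ i ∈ X ∧ i < j + 1)
        intro i hi
        obtain rfl | hne := eq_or_ne i j
        · exact ⟨fun _ => ⟨hj.2, Arith.lt_add_one_iff.2 le_rfl⟩, fun _ => dvd_mul_left _ _⟩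
        · have : (i < j + 1 ↔ i < j) := by
            rw [Arith.lt_add_one_iff]; exact ⟨fun h => lt_of_le_of_ne h hne, le_of_lt⟩
          rw [this, ← hn i hi]
          refine ⟨fun hd => ?_, fun hd => hd.mul_right _⟩
          obtain hlt | hlt := hne.lt_or_gt
          · obtain ⟨z, hz⟩ := Arith.lt_iff.1 hlt
            refine Arith.dvd_of_dvd_mul (d := z + 1) (hm' _ ?_ (Arith.zero_lt_succ z)) (Or.inr ?_) hd
            · have := Arith.zero_le i; grind
            · rw [hz, add_assoc]
          · obtain ⟨z, hz⟩ := Arith.lt_iff.1 hlt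
            refine Arith.dvd_of_dvd_mul (d := z + 1) (hm' _ ?_ (Arith.zero_lt_succ z)) (Or.inl ?_) hd
            · have := Arith.zero_le j; grind
            · rw [hz, add_assoc]
      · refine ⟨n, ?_⟩
        change ∀ i, i < b → (m * (i + 1) + 1 ∣ n ↔ i ∈ X ∧ i < j + 1)
        intro i hi
        rw [hn i hi, Arith.lt_add_one_iff]
        refine and_congr_right fun hiX => ⟨le_of_lt, fun hle => lt_of_le_of_ne hle ?_⟩
        rintro rfl
        exact hj ⟨hi, hiX⟩) b
  refine ⟨m, n, fun i hi => ?_⟩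
  change ∀ i, i < b → (m * (i + 1) + 1 ∣ n ↔ i ∈ X ∧ i < b) at hn
  rw [hn i hi, and_iff_left hi]

theorem finMem_pair {i k m n : M} :
    FinMem i (pair (pair k m) n) ↔ i < k ∧ m * (i + 1) + 1 ∣ n := by
  constructor
  · rintro ⟨k', m', n', e, hi, hd⟩
    obtain ⟨e', rfl⟩ := pair_inj.1 e
    obtain ⟨rfl, rfl⟩ := pair_inj.1 e'
    exact ⟨hi, hd⟩
  · exact fun ⟨hi, hd⟩ => ⟨k, m, n, rfl, hi, hd⟩

theorem FinMem.lt {i c : M} (h : FinMem i c) : i < c := by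
  obtain ⟨k, m, n, rfl, hi, -⟩ := h
  exact hi.trans_le ((left_le_pair _ _).trans (left_le_pair _ _))

theorem pairForm_iff {c : M} {Q : M → M → M → Prop} :
    (∃ k m n, c = pair (pair k m) n ∧ Q k m n) ↔
      ∃ k, k ≤ c ∧ ∃ m, m ≤ c ∧ ∃ n, n ≤ c ∧ c = pair (pair k m) n ∧ Q k m n := by
  constructor
  · rintro ⟨k, m, n, rfl, h⟩
    exact ⟨k, (left_le_pair _ _).trans (left_le_pair _ _), m,
      (right_le_pair _ _).trans (left_le_pair _ _), n, right_le_pair _ _, rfl, h⟩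
  · rintro ⟨k, -, m, -, n, -, h⟩
    exact ⟨k, m, n, h⟩

end

instance Df.finMem {f g : Fun1.{u}} [Tm f] [Tm g] :
    Df (fun M _ _ V v => FinMem (f M V v) (g M V v)) :=
  Df.subst₂ (P := fun _ _ _ _ x y => FinMem x y) <|
    Df.congr fun _ _ _ _ v => pairForm_iff (Q := fun k m _ => v 0 < k ∧ m * (v 0 + 1) + 1 ∣ _)

end SOA

namespace SOA

/-! ### Finite sequences -/

section
variable {M : Type u} [Arith M] [RCA M] {S : Set (Set M)}

theorem exists_pairForm_iff {c : M} :
    (∃ k m n, c = pair (pair k m) n) ↔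
      ∃ k, k ≤ c ∧ ∃ m, m ≤ c ∧ ∃ n, n ≤ c ∧ c = pair (pair k m) n := by
  simpa using pairForm_iff (c := c) (Q := fun _ _ _ => True)

theorem isFinCode_iff {c : M} : IsFinCode c ↔
    (∃ k, k ≤ c ∧ ∃ m, m ≤ c ∧ ∃ n, n ≤ c ∧ c = pair (pair k m) n) ∧
      ∀ c', c' < c → (∃ k, k ≤ c' ∧ ∃ m, m ≤ c' ∧ ∃ n, n ≤ c' ∧ c' = pair (pair k m) n) →
        ¬ ∀ i, i < c → (FinMem i c' ↔ FinMem i c) := by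
  simp only [IsFinCode, exists_pairForm_iff]
  refine and_congr_right fun _ => forall_congr' fun c' => forall_congr' fun hc => forall_congr'
    fun _ => not_congr ⟨fun h i _ => h i, fun h i => ?_⟩
  by_cases hi : i < c
  · exact h i hi
  · exact ⟨fun hf => (hi (hf.lt.trans hc)).elim, fun hf => (hi hf.lt).elim⟩

instance Df.isFinCode {f : Fun1.{u}} [Tm f] : Df (fun M _ _ V v => IsFinCode (f M V v)) :=
  Df.subst₁ (P := fun _ _ _ _ x => IsFinCode x) <| Df.congr fun _ _ _ _ _ => isFinCode_iff

instance Df.entry {f g k : Fun1.{u}} [Tm f] [Tm g] [Tm k] :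
    Df (fun M _ _ V v => Entry (f M V v) (g M V v) (k M V v)) := by
  unfold Entry; infer_instance

theorem Entry.lt {s i x : M} (h : Entry s i x) : pair i x < s := FinMem.lt h
theorem Entry.index_lt {s i x : M} (h : Entry s i x) : i < s := (left_le_pair _ _).trans_lt h.lt
theorem Entry.value_lt {s i x : M} (h : Entry s i x) : x < s := (right_le_pair _ _).trans_lt h.lt

theorem isSeq_iff {s l : M} : IsSeq s l ↔ IsFinCode s ∧
    (∀ p, p < s → FinMem p s → ∃ i, i ≤ p ∧ ∃ x, x ≤ p ∧ p = pair i x ∧ i < l) ∧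
      ∀ i, i < l → ∃ x, x < s ∧ Entry s i x ∧ ∀ y, y < s → Entry s i y → y = x := by
  refine and_congr_right fun _ => and_congr ?_ ?_
  · constructor
    · intro h p _ hp
      obtain ⟨i, x, rfl, hi⟩ := h p hp
      exact ⟨i, left_le_pair _ _, x, right_le_pair _ _, rfl, hi⟩
    · intro h p hp
      obtain ⟨i, -, x, -, e, hi⟩ := h p hp.lt hp
      exact ⟨i, x, e, hi⟩
  · refine forall_congr' fun i => forall_congr' fun hi => ?_
    constructor
    · rintro ⟨x, hx, hu⟩
      exact ⟨x, hx.value_lt, hx, fun y _ => hu y⟩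
    · rintro ⟨x, -, hx, hu⟩
      exact ⟨x, hx, fun y hy => hu y hy.value_lt hy⟩

instance Df.isSeq {f g : Fun1.{u}} [Tm f] [Tm g] :
    Df (fun M _ _ V v => IsSeq (f M V v) (g M V v)) :=
  Df.subst₂ (P := fun _ _ _ _ x y => IsSeq x y) <| Df.congr fun _ _ _ _ _ => isSeq_iff

theorem ModelsRCA0.exists_code (h : ModelsRCA0 S) {X : Set M} (hX : X ∈ S) (b : M) :
    ∃ c, IsFinCode c ∧ ∀ i, FinMem i c ↔ i < b ∧ i ∈ X := by
  obtain ⟨m, n, hmn⟩ := h.exists_code_aux hX b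
  set c := pair (pair b m) n with hc
  have hcX : ∀ i, FinMem i c ↔ i < b ∧ i ∈ X := fun i => by
    rw [hc, finMem_pair]
    exact and_congr_right fun hi => hmn i hi
  -- Elements of a coded set are smaller than the code, so two coded sets may be compared below the
  -- sum of their codes; this keeps the minimised formula bounded.
  obtain ⟨d, ⟨hd, hd'⟩, hmin⟩ := h.exists_least
    (fun M _ _ V v => (∃ k, k ≤ v 0 ∧ ∃ m, m ≤ v 0 ∧ ∃ n, n ≤ v 0 ∧ v 0 = pair (pair k m) n) ∧
      ∀ i, i < v 0 + v 1 → (FinMem i (v 0) ↔ FinMem i (v 1)))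
    (fun _ => X) (fun _ => hX) (cons c fun _ => 0) c
    ⟨exists_pairForm_iff.1 ⟨b, m, n, hc⟩, fun i _ => Iff.rfl⟩
  have ext : ∀ d : M, (∀ i, i < d + c → (FinMem i d ↔ FinMem i c)) →
      ∀ i, FinMem i d ↔ FinMem i c := fun d hd i => by
    by_cases hi : i < d + c
    · exact hd i hi
    · exact ⟨fun h => (hi (h.lt.trans_le le_self_add)).elim,
        fun h => (hi (h.lt.trans_le le_add_self)).elim⟩
  have hdc := ext d hd'
  refine ⟨d, ⟨exists_pairForm_iff.2 hd, fun c' hc' hf he => ?_⟩, fun i => (hdc i).trans (hcX i)⟩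
  exact hmin c' hc' ⟨exists_pairForm_iff.1 hf, fun i _ => (he i).trans (hdc i)⟩

theorem IsFinCode.ext {c d : M} (hc : IsFinCode c) (hd : IsFinCode d)
    (h : ∀ i, FinMem i c ↔ FinMem i d) : c = d := by
  obtain hlt | e | hlt := lt_trichotomy c d
  · exact (hd.2 c hlt hc.1 h).elim
  · exact e
  · exact (hc.2 d hlt hd.1 fun i => (h i).symm).elim

namespace IsSeq
variable {s t l k i x y : M}

theorem exists_entry (h : IsSeq s l) (hi : i < l) : ∃ x, Entry s i x := (h.2.2 i hi).exists

theorem index_lt (h : IsSeq s l) (hx : Entry s i x) : i < l := by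
  obtain ⟨j, y, e, hj⟩ := h.2.1 _ hx
  rwa [(pair_inj.1 e).1]

theorem unique (h : IsSeq s l) (hx : Entry s i x) (hy : Entry s i y) : x = y :=
  (h.2.2 i (h.index_lt hx)).unique hx hy

theorem length_le (h : IsSeq s l) : l ≤ s := by
  by_contra! hlt
  obtain ⟨x, hx⟩ := h.exists_entry hlt
  exact lt_irrefl _ hx.index_lt

theorem length_unique (h : IsSeq s l) (h' : IsSeq s k) : l = k := by
  obtain hlt | e | hlt := lt_trichotomy l k
  · obtain ⟨x, hx⟩ := h'.exists_entry hlt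
    exact (lt_irrefl _ (h.index_lt hx)).elim
  · exact e
  · obtain ⟨x, hx⟩ := h.exists_entry hlt
    exact (lt_irrefl _ (h'.index_lt hx)).elim

theorem ext (hs : IsSeq s l) (ht : IsSeq t l) (h : ∀ i, i < l → ∃ x, Entry s i x ∧ Entry t i x) :
    s = t := by
  refine hs.1.ext ht.1 fun p => ⟨fun hp => ?_, fun hp => ?_⟩
  · obtain ⟨i, x, rfl, hi⟩ := hs.2.1 p hp
    obtain ⟨y, hy, hy'⟩ := h i hi
    rwa [hs.unique (x := x) hp hy]
  · obtain ⟨i, x, rfl, hi⟩ := ht.2.1 p hp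
    obtain ⟨y, hy, hy'⟩ := h i hi
    rwa [ht.unique (x := x) hp hy']

end IsSeq

theorem ModelsRCA0.exists_seq_of_bdd (h : ModelsRCA0 S) {X : Set M} (hX : X ∈ S) (b l : M)
    (hp : ∀ p, p ∈ X → p < b → ∃ i x, p = pair i x ∧ i < l)
    (hu : ∀ i, i < l → ∃! x, pair i x < b ∧ pair i x ∈ X) :
    ∃ s, IsSeq s l ∧ ∀ i x, Entry s i x ↔ pair i x < b ∧ pair i x ∈ X := by
  obtain ⟨s, hs, hs'⟩ := h.exists_code hX b
  refine ⟨s, ⟨hs, fun p hp' => hp p ((hs' p).1 hp').2 ((hs' p).1 hp').1, fun i hi => ?_⟩,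
    fun i x => hs' _⟩
  simp only [Entry, hs']
  exact hu i hi

theorem ModelsRCA0.exists_empty_seq (h : ModelsRCA0 S) : ∃ s : M, IsSeq s 0 := by
  obtain ⟨s, hs, -⟩ := h.exists_seq_of_bdd h.empty_mem 0 0 (fun _ hp => hp.elim)
    fun i hi => (Arith.not_lt_zero _ hi).elim
  exact ⟨s, hs⟩

/-- Appending one entry to a sequence. -/
theorem ModelsRCA0.exists_append (h : ModelsRCA0 S) {s l : M} (hs : IsSeq s l) (a : M) :
    ∃ t, IsSeq t (l + 1) ∧ ∀ i x, Entry t i x ↔ Entry s i x ∨ (i = l ∧ x = a) := by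
  have hX := h.comp (fun M _ _ V v => FinMem (v 0) (v 1) ∨ v 0 = pair (v 2) (v 3)) (fun _ => ∅)
    (fun _ => h.empty_mem) (cons s (cons l (cons a fun _ => 0)))
  change {p | FinMem p s ∨ p = pair l a} ∈ S at hX
  have key : ∀ i x : M, pair i x ∈ {p | FinMem p s ∨ p = pair l a} ↔
      Entry s i x ∨ (i = l ∧ x = a) := fun i x => by
    simp only [Set.mem_ofPred_eq, pair_inj, Entry]
  have hlt : ∀ i x, Entry s i x ∨ (i = l ∧ x = a) → pair i x < s + pair l a + 1 := by
    rintro i x (hx | ⟨rfl, rfl⟩) <;> rw [Arith.lt_add_one_iff]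
    · exact hx.lt.le.trans le_self_add
    · exact le_add_self
  obtain ⟨t, ht, ht'⟩ := h.exists_seq_of_bdd hX (s + pair l a + 1) (l + 1)
    (by
      rintro p (hp | rfl) -
      · obtain ⟨i, x, rfl, hi⟩ := hs.2.1 p hp
        exact ⟨i, x, rfl, hi.trans (Arith.lt_add_one_iff.2 le_rfl)⟩
      · exact ⟨l, a, rfl, Arith.lt_add_one_iff.2 le_rfl⟩)
    (by
      intro i hi
      simp only [key]
      obtain hi | rfl := Arith.lt_succ.1 hi
      · obtain ⟨x, hx⟩ := hs.exists_entry hi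
        refine ⟨x, ⟨hlt _ _ (Or.inl hx), Or.inl hx⟩, ?_⟩
        rintro y ⟨-, hy | ⟨rfl, -⟩⟩
        exacts [hs.unique hy hx, (lt_irrefl _ hi).elim]
      · refine ⟨a, ⟨hlt _ _ (Or.inr ⟨rfl, rfl⟩), Or.inr ⟨rfl, rfl⟩⟩, ?_⟩
        rintro y ⟨-, hy | ⟨-, rfl⟩⟩
        exacts [(lt_irrefl _ (hs.index_lt hy)).elim, rfl])
  refine ⟨t, ht, fun i x => ?_⟩
  rw [ht', key]
  exact and_iff_right_of_imp (hlt i x)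

/-- Finite choice. -/
theorem ModelsRCA0.exists_seq_choice (h : ModelsRCA0 S) {X : Set M} (hX : X ∈ S) {l : M}
    (hl : ∀ i, i < l → ∃ x, pair i x ∈ X) :
    ∃ s, IsSeq s l ∧ ∀ i x, Entry s i x → pair i x ∈ X := by
  obtain ⟨e, he⟩ := h.exists_empty_seq
  obtain ⟨s, hs⟩ := h.sigma_ind
    (fun M _ _ V v => v 1 ≤ v 2 → IsSeq (v 0) (v 1) ∧
      ∀ i, i < v 0 → ∀ x, x < v 0 → Entry (v 0) i x → pair i x ∈ V 0)
    (fun _ => X) (fun _ => hX) (cons l fun _ => 0)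
    ⟨e, fun _ => ⟨he, fun i _ x _ hx => (Arith.not_lt_zero _ (he.index_lt hx)).elim⟩⟩
    (fun n ⟨s, hs⟩ => by
      change n ≤ l → IsSeq s n ∧ ∀ i, i < s → ∀ x, x < s → Entry s i x → pair i x ∈ X at hs
      by_cases hn : n + 1 ≤ l
      · have hn' := Arith.add_one_le_iff.1 hn
        obtain ⟨a, ha⟩ := hl n hn'
        obtain ⟨hs, hs'⟩ := hs hn'.le
        obtain ⟨t, ht, ht'⟩ := h.exists_append hs a
        refine ⟨t, fun _ => ⟨ht, fun i _ x _ hx => ?_⟩⟩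
        obtain hx | ⟨rfl, rfl⟩ := (ht' i x).1 hx
        exacts [hs' i hx.index_lt x hx.value_lt hx, ha]
      · exact ⟨0, fun h => (hn h).elim⟩) l
  obtain ⟨hs, hs'⟩ := hs le_rfl
  exact ⟨s, hs, fun i x hx => hs' i hx.index_lt x hx.value_lt hx⟩

theorem ModelsRCA0.exists_seq (h : ModelsRCA0 S) {X : Set M} (hX : X ∈ S) {l : M}
    (hl : ∀ i, i < l → ∃! x, pair i x ∈ X) :
    ∃ s, IsSeq s l ∧ ∀ i x, Entry s i x ↔ i < l ∧ pair i x ∈ X := by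
  obtain ⟨s, hs, hs'⟩ := h.exists_seq_choice hX fun i hi => (hl i hi).exists
  refine ⟨s, hs, fun i x => ⟨fun hx => ⟨hs.index_lt hx, hs' i x hx⟩, fun ⟨hi, hx⟩ => ?_⟩⟩
  obtain ⟨y, hy⟩ := hs.exists_entry hi
  rwa [(hl i hi).unique hx (hs' i y hy)]

theorem ModelsRCA0.finSet_mem (h : ModelsRCA0 S) (c : M) : {i | FinMem i c} ∈ S :=
  h.comp (fun M _ _ V v => FinMem (v 0) (v 1)) (fun _ => ∅) (fun _ => h.empty_mem)
    (cons c fun _ => 0)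

/-- Initial segments of sequences. -/
theorem ModelsRCA0.exists_restrict (h : ModelsRCA0 S) {s l k : M} (hs : IsSeq s l) (hk : k ≤ l) :
    ∃ t, IsSeq t k ∧ ∀ i x, Entry t i x ↔ i < k ∧ Entry s i x :=
  h.exists_seq (h.finSet_mem s) fun i hi => hs.2.2 i (hi.trans_le hk)

end
end SOA

namespace SOA

/-! ### Functions on the natural numbers -/

section
variable {M : Type u} [Arith M] [RCA M] {S : Set (Set M)}

theorem Arith.eq_zero_or_succ (n : M) : n = 0 ∨ ∃ m, n = m + 1 := by
  obtain h | h := (Arith.zero_le n).eq_or_lt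
  · exact Or.inl h.symm
  · obtain ⟨z, hz⟩ := Arith.lt_iff.1 h
    exact Or.inr ⟨z, by rw [hz, Arith.zero_add]⟩

theorem exists_pair_iff {p : M} {Q : M → M → Prop} :
    (∃ x y, p = pair x y ∧ Q x y) ↔ ∃ x, x ≤ p ∧ ∃ y, y ≤ p ∧ p = pair x y ∧ Q x y := by
  constructor
  · rintro ⟨x, y, rfl, h⟩
    exact ⟨x, left_le_pair _ _, y, right_le_pair _ _, rfl, h⟩
  · rintro ⟨x, -, y, -, h⟩
    exact ⟨x, y, h⟩

/-- The set of pairs that is given by a relation. -/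
def pairs (R : M → M → Prop) : Set M := {p | ∃ x y, p = pair x y ∧ R x y}

theorem pair_mem_pairs {R : M → M → Prop} {x y : M} : pair x y ∈ pairs R ↔ R x y := by
  constructor
  · rintro ⟨x', y', e, h⟩
    obtain ⟨rfl, rfl⟩ := pair_inj.1 e
    exact h
  · exact fun h => ⟨x, y, rfl, h⟩

/-- `Δ₀`-comprehension for binary relations. -/
theorem ModelsRCA0.comp₂ (h : ModelsRCA0 S) (P : Rel1.{u}) [hP : Df P] (V : ℕ → Set M)
    (hV : ∀ i, V i ∈ S) (v : ℕ → M) :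
    pairs (fun x y => P M V (cons x (cons y v))) ∈ S := by
  -- Under the two bounded quantifiers the variables are y, x, the code p, and then the parameters.
  -- The renaming swaps x and y and skips p.
  let ρ : ℕ → ℕ := fun | 0 => 1 | 1 => 0 | i + 2 => i + 3
  have hd : Df (fun M _ _ V v => P M V (fun i => v (ρ i))) := Df.rename ρ
  have hd' : Df (fun M _ _ V v =>
      P M V (cons (v (0 + 1)) (cons (v 0) (fun i => v (i + 1 + 1 + 1))))) := by
    have e : ∀ (M : Type u) (v : ℕ → M), cons (v (0 + 1)) (cons (v 0) (fun i => v (i + 1 + 1 + 1))) =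
        fun i => v (ρ i) := fun M v => by
      funext i
      obtain _ | _ | i := i <;> rfl
    simpa only [e] using hd
  convert h.comp (fun M _ _ V v => ∃ x, x ≤ v 0 ∧ ∃ y, y ≤ v 0 ∧ v 0 = pair x y ∧
    P M V (cons x (cons y (fun i => v (i + 1))))) V hV v using 1
  ext p
  exact exists_pair_iff (Q := fun x y => P M V (cons x (cons y v)))

/-- Composition of functions. -/
theorem ModelsRCA0.exists_fun_comp (h : ModelsRCA0 S) {F E : Set M} (hF : F ∈ S) (hE : E ∈ S)
    (hF' : IsFun F) (hE' : ∀ n s, pair n s ∈ F → ∃! t, pair s t ∈ E) :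
    ∃ G ∈ S, IsFun G ∧ ∀ n t, pair n t ∈ G ↔ ∃ s, pair n s ∈ F ∧ pair s t ∈ E := by
  -- As `F` is single-valued and total, "some value s works" agrees with "every value s works".
  have key := h.delta_comp
    (fun M _ _ V v => ∃ n, n ≤ v 1 ∧ ∃ t, t ≤ v 1 ∧ v 1 = pair n t ∧ pair n (v 0) ∈ V 0 ∧
      pair (v 0) t ∈ V 1)
    (fun M _ _ V v => ∃ n, n ≤ v 1 ∧ ∃ t, t ≤ v 1 ∧ v 1 = pair n t ∧ (pair n (v 0) ∈ V 0 →
      pair (v 0) t ∈ V 1))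
    (cons F (fun _ => E)) (cons_mem hF fun _ => hE) (fun _ => 0)
    (fun p => by
      change (∃ s, ∃ n, n ≤ p ∧ ∃ t, t ≤ p ∧ p = pair n t ∧ pair n s ∈ F ∧ pair s t ∈ E) ↔
        ∀ s, ∃ n, n ≤ p ∧ ∃ t, t ≤ p ∧ p = pair n t ∧ (pair n s ∈ F → pair s t ∈ E)
      constructor
      · rintro ⟨s, n, hn, t, ht, e, hs, hst⟩ s'
        exact ⟨n, hn, t, ht, e, fun hs' => (hF'.2 n).unique hs hs' ▸ hst⟩
      · intro hp
        obtain ⟨n, hn, t, ht, e, -⟩ := hp 0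
        obtain ⟨s, hs⟩ := (hF'.2 n).exists
        obtain ⟨n', -, t', -, e', hs'⟩ := hp s
        obtain ⟨rfl, rfl⟩ := pair_inj.1 (e.symm.trans e')
        exact ⟨s, n, hn, t, ht, e, hs, hs' hs⟩)
  change {p | ∃ s, ∃ n, n ≤ p ∧ ∃ t, t ≤ p ∧ p = pair n t ∧ pair n s ∈ F ∧ pair s t ∈ E} ∈ S at key
  refine ⟨_, key, ⟨?_, fun n => ?_⟩, ?_⟩
  · rintro p ⟨s, n, -, t, -, e, -⟩
    exact ⟨n, t, e⟩
  all_goals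
    have hG : ∀ n t, pair n t ∈ {p | ∃ s, ∃ n, n ≤ p ∧ ∃ t, t ≤ p ∧ p = pair n t ∧
        pair n s ∈ F ∧ pair s t ∈ E} ↔ ∃ s, pair n s ∈ F ∧ pair s t ∈ E := fun n t => by
      constructor
      · rintro ⟨s, n', -, t', -, e, h⟩
        obtain ⟨rfl, rfl⟩ := pair_inj.1 e
        exact ⟨s, h⟩
      · rintro ⟨s, h⟩
        exact ⟨s, n, left_le_pair _ _, t, right_le_pair _ _, rfl, h⟩
  · obtain ⟨s, hs, hu⟩ := hF'.2 n
    obtain ⟨t, ht, hu'⟩ := hE' n s hs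
    refine ⟨t, (hG n t).2 ⟨s, hs, ht⟩, fun t' ht' => ?_⟩
    obtain ⟨s', hs', ht'⟩ := (hG n t').1 ht'
    obtain rfl := hu s' hs'
    exact hu' _ ht'
  · exact hG

/-- Induction for decidable properties of the values of a function. -/
theorem ModelsRCA0.fun_ind (h : ModelsRCA0 S) {F Y : Set M} (hF : F ∈ S) (hY : Y ∈ S)
    (hF' : IsFun F) (h0 : ∀ x, pair 0 x ∈ F → pair 0 x ∈ Y)
    (h1 : ∀ n x y, pair n x ∈ F → pair n x ∈ Y → pair (n + 1) y ∈ F → pair (n + 1) y ∈ Y)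
    (n x : M) (hx : pair n x ∈ F) : pair n x ∈ Y := by
  by_contra hne
  have hX := h.comp (fun M _ _ V v => v 0 ∈ V 0 ∧ ¬ v 0 ∈ V 1) (cons F fun _ => Y)
    (cons_mem hF fun _ => hY) (fun _ => 0)
  obtain ⟨b, ⟨y, hb, hb'⟩, hmin⟩ := h.exists_least_sigma hX (a := n) (w := x) ⟨hx, hne⟩
  change pair b y ∈ F at hb
  change ¬ pair b y ∈ Y at hb'
  obtain rfl | ⟨c, rfl⟩ := Arith.eq_zero_or_succ b
  · exact hb' (h0 y hb)
  · obtain ⟨z, hz⟩ := (hF'.2 c).exists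
    refine hb' (h1 c z y hz ?_ hb)
    by_contra hz'
    exact (hmin c z ⟨hz, hz'⟩).not_gt (Arith.lt_add_one_iff.2 le_rfl)

/-- `t` is a sequence of length `n + 1` that starts in `a`, where each entry is followed by the
least possible one. -/
def IsPath (I X : Set M) (t n a : M) : Prop :=
  IsSeq t (n + 1) ∧ Entry t 0 a ∧ ∀ i, i < n → ∃ z, z < t ∧ ∃ z', z' < t ∧
    Entry t i z ∧ Entry t (i + 1) z' ∧ (pair (i + 1) z' ∈ I ∧ pair z z' ∈ X) ∧
    ∀ w, w < z' → ¬ (pair (i + 1) w ∈ I ∧ pair z w ∈ X)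

instance Df.isPath {f g k : Fun1.{u}} [Tm f] [Tm g] [Tm k] (I X : ℕ) :
    Df (fun M _ _ V v => IsPath (V I) (V X) (f M V v) (g M V v) (k M V v)) :=
  Df.subst₃ (P := fun _ _ _ V x y z => IsPath (V I) (V X) x y z) <| by
    unfold IsPath; infer_instance

theorem IsPath.mem {I X : Set M} {t n a i z : M} (h : IsPath I X t n a) (ha : pair 0 a ∈ I)
    (hz : Entry t i z) : pair i z ∈ I := by
  obtain rfl | ⟨j, rfl⟩ := Arith.eq_zero_or_succ i
  · rwa [h.1.unique hz h.2.1]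
  · obtain ⟨y, -, y', -, -, hy', ⟨hI, -⟩, -⟩ := h.2.2 j (lt_of_add_lt_add_right (h.1.index_lt hz))
    rwa [h.1.unique hz hy']

/-- Taking the least admissible successor at every step makes paths deterministic. This is what
turns the `Σ⁰₁` union of all paths into a `Δ⁰₁` set. -/
theorem ModelsRCA0.path_unique (h : ModelsRCA0 S) {I X : Set M} {t t' n n' a : M}
    (ht : IsPath I X t n a) (ht' : IsPath I X t' n' a) {i : M} (hi : i ≤ n) (hi' : i ≤ n') {z z' : M}
    (hz : Entry t i z) (hz' : Entry t' i z') : z = z' := by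
  refine h.ind (fun M _ _ V v => v 0 ≤ v 1 → v 0 ≤ v 2 → ∀ z, z < v 3 → ∀ z', z' < v 4 →
    Entry (v 3) (v 0) z → Entry (v 4) (v 0) z' → z = z') (fun _ => ∅) (fun _ => h.empty_mem)
    (cons n (cons n' (cons t (fun _ => t')))) ?_ ?_ i hi hi' z hz.value_lt z' hz'.value_lt hz hz'
  · intro _ _ z _ z' _ hz hz'
    exact (ht.1.unique hz ht.2.1).trans (ht'.1.unique hz' ht'.2.1).symm
  · intro j IH hj hj' z _ z' _ hz hz'
    replace hj := Arith.add_one_le_iff.1 hj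
    replace hj' := Arith.add_one_le_iff.1 hj'
    obtain ⟨y, hyt, w, -, hy, hw, hw1, hw2⟩ := ht.2.2 j hj
    obtain ⟨y', hyt', w', -, hy', hw', hw1', hw2'⟩ := ht'.2.2 j hj'
    obtain rfl : y = y' := IH hj.le hj'.le y hyt y' hyt' hy hy'
    obtain rfl : w = w' := le_antisymm (not_lt.1 fun hlt => hw2 _ hlt hw1')
      (not_lt.1 fun hlt => hw2' _ hlt hw1)
    exact (ht.1.unique hz hw).trans (ht'.1.unique hz' hw').symm

/-- Dependent choice for relations in the model. -/
theorem ModelsRCA0.exists_path (h : ModelsRCA0 S) {I X : Set M} (hI : I ∈ S) (hX : X ∈ S) {a : M}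
    (ha : pair 0 a ∈ I)
    (hstep : ∀ n z, pair n z ∈ I → ∃ z', pair (n + 1) z' ∈ I ∧ pair z z' ∈ X) :
    ∃ F ∈ S, IsFun F ∧ (∀ n z, pair n z ∈ F → pair n z ∈ I) ∧
      ∀ n z z', pair n z ∈ F → pair (n + 1) z' ∈ F → pair z z' ∈ X := by
  have hVS := cons_mem hI fun _ : ℕ => hX
  have hpath : ∀ n, ∃ t, IsPath I X t n a := fun n => by
    refine h.sigma_ind (fun M _ _ V v => IsPath (V 0) (V 1) (v 0) (v 1) (v 2))
      (cons I (fun _ => X)) hVS (fun _ => a) ?_ ?_ n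
    · obtain ⟨e, he⟩ := h.exists_empty_seq
      obtain ⟨t, ht, ht'⟩ := h.exists_append he a
      exact ⟨t, ht, (ht' 0 a).2 (Or.inr ⟨rfl, rfl⟩), fun i hi => (Arith.not_lt_zero _ hi).elim⟩
    · rintro n ⟨t, ht⟩
      change IsPath I X t n a at ht
      have hn : n < n + 1 := Arith.lt_add_one_iff.2 le_rfl
      obtain ⟨z, hz⟩ := ht.1.exists_entry hn
      obtain ⟨z₀, hz₀⟩ := hstep n z (ht.mem ha hz)
      obtain ⟨z', hz', hmin⟩ := h.exists_least
        (fun M _ _ V v => pair (v 1 + 1) (v 0) ∈ V 0 ∧ pair (v 2) (v 0) ∈ V 1)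
        (cons I (fun _ => X)) hVS (cons n (fun _ => z)) z₀ (by exact hz₀)
      obtain ⟨s, hs, hs'⟩ := h.exists_append ht.1 z'
      refine ⟨s, hs, (hs' _ _).2 (Or.inl ht.2.1), fun i hi => ?_⟩
      obtain hi | rfl := Arith.lt_succ.1 hi
      · obtain ⟨y, -, y', -, hy, hy', h1, h2⟩ := ht.2.2 i hi
        have hy := (hs' _ _).2 (Or.inl hy)
        have hy' := (hs' _ _).2 (Or.inl hy')
        exact ⟨y, hy.value_lt, y', hy'.value_lt, hy, hy', h1, h2⟩
      · have hy := (hs' _ _).2 (Or.inl hz)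
        have hy' := (hs' (i + 1) z').2 (Or.inr ⟨rfl, rfl⟩)
        exact ⟨z, hy.value_lt, z', hy'.value_lt, hy, hy', hz', hmin⟩
  -- The value at n is the last entry of some path of length `n + 1`, equivalently of every such
  -- path, by existence and uniqueness.
  have key := h.delta_comp
    (fun M _ _ V v => ∃ n, n ≤ v 1 ∧ ∃ z, z ≤ v 1 ∧ v 1 = pair n z ∧
      IsPath (V 0) (V 1) (v 0) n (v 2) ∧ Entry (v 0) n z)
    (fun M _ _ V v => ∃ n, n ≤ v 1 ∧ ∃ z, z ≤ v 1 ∧ v 1 = pair n z ∧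
      (IsPath (V 0) (V 1) (v 0) n (v 2) → Entry (v 0) n z))
    (cons I (fun _ => X)) hVS (fun _ => a)
    (fun p => by
      change (∃ t, ∃ n, n ≤ p ∧ ∃ z, z ≤ p ∧ p = pair n z ∧ IsPath I X t n a ∧ Entry t n z) ↔
        ∀ t, ∃ n, n ≤ p ∧ ∃ z, z ≤ p ∧ p = pair n z ∧ (IsPath I X t n a → Entry t n z)
      constructor
      · rintro ⟨t, n, hn, z, hz, e, ht, htz⟩ t'
        refine ⟨n, hn, z, hz, e, fun ht' => ?_⟩
        obtain ⟨z', hz'⟩ := ht'.1.exists_entry (Arith.lt_add_one_iff.2 le_rfl)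
        rwa [h.path_unique ht ht' le_rfl le_rfl htz hz']
      · intro hp
        obtain ⟨n, hn, z, hz, e, -⟩ := hp 0
        obtain ⟨t, ht⟩ := hpath n
        obtain ⟨n', -, z', -, e', ht'⟩ := hp t
        obtain ⟨rfl, rfl⟩ := pair_inj.1 (e.symm.trans e')
        exact ⟨t, n, hn, z, hz, e, ht, ht' ht⟩)
  set F := {p | ∃ t, ∃ n, n ≤ p ∧ ∃ z, z ≤ p ∧ p = pair n z ∧ IsPath I X t n a ∧ Entry t n z}
    with hFdef
  change F ∈ S at key
  have hF : ∀ n z, pair n z ∈ F ↔ ∃ t, IsPath I X t n a ∧ Entry t n z := fun n z => by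
    constructor
    · rintro ⟨t, n', -, z', -, e, h⟩
      obtain ⟨rfl, rfl⟩ := pair_inj.1 e
      exact ⟨t, h⟩
    · rintro ⟨t, h⟩
      exact ⟨t, n, left_le_pair _ _, z, right_le_pair _ _, rfl, h⟩
  refine ⟨F, key, ⟨?_, fun n => ?_⟩, fun n z hz => ?_, fun n z z' hz hz' => ?_⟩
  · rintro p ⟨t, n, -, z, -, e, -⟩
    exact ⟨n, z, e⟩
  · obtain ⟨t, ht⟩ := hpath n
    obtain ⟨z, hz⟩ := ht.1.exists_entry (Arith.lt_add_one_iff.2 le_rfl)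
    refine ⟨z, (hF n z).2 ⟨t, ht, hz⟩, fun z' hz' => ?_⟩
    obtain ⟨t', ht', hz'⟩ := (hF n z').1 hz'
    exact h.path_unique ht' ht le_rfl le_rfl hz' hz
  · obtain ⟨t, ht, hz⟩ := (hF n z).1 hz
    exact ht.mem ha hz
  · obtain ⟨t, ht, hz⟩ := (hF n z).1 hz
    obtain ⟨t', ht', hz'⟩ := (hF _ z').1 hz'
    have hn : n < n + 1 := Arith.lt_add_one_iff.2 le_rfl
    obtain ⟨y, -, y', -, hy, hy', ⟨-, h1⟩, -⟩ := ht'.2.2 n hn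
    rw [h.path_unique ht ht' le_rfl hn.le hz hy, ht'.1.unique hz' hy']
    exact h1

end
end SOA

namespace SOA

/-! ### Linear orders -/

section
variable {M : Type u} [Arith M] [RCA M] {S : Set (Set M)}

namespace IsLinOrd
variable {R : Set M} {x y z : M}

theorem fld_left (h : IsLinOrd R) (hxy : OrdLE R x y) : Fld R x := by
  obtain ⟨x', y', e, hx, hy⟩ := h.pairs _ hxy
  rwa [(pair_inj.1 e).1]

theorem lt_trans (h : IsLinOrd R) (hxy : OrdLT R x y) (hyz : OrdLT R y z) : OrdLT R x z := by
  refine ⟨h.trans _ _ _ hxy.1 hyz.1, ?_⟩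
  rintro rfl
  exact hxy.2 (h.antisymm _ _ hxy.1 hyz.1)

theorem not_le_of_lt (h : IsLinOrd R) (hxy : OrdLT R x y) : ¬ OrdLE R y x :=
  fun hyx => hxy.2 (h.antisymm _ _ hxy.1 hyx)

theorem trichotomy (h : IsLinOrd R) (hx : Fld R x) (hy : Fld R y) :
    OrdLT R x y ∨ x = y ∨ OrdLT R y x := by
  by_cases e : x = y
  · exact Or.inr (Or.inl e)
  · obtain h | h := h.total x y hx hy
    exacts [Or.inl ⟨h, e⟩, Or.inr (Or.inr ⟨h, Ne.symm e⟩)]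

theorem lt_of_not_le (h : IsLinOrd R) (hx : Fld R x) (hy : Fld R y) (hn : ¬ OrdLE R x y) :
    OrdLT R y x := by
  obtain h | rfl | h := h.trichotomy hx hy
  exacts [(hn h.1).elim, (hn hx).elim, h]

end IsLinOrd

theorem OrdLT.irrefl {R : Set M} {x : M} : ¬ OrdLT R x x := fun h => h.2 rfl

section
variable {dom : M → Prop} {lt : M → M → Prop} {x y : M}

theorem ordLE_mkOrd : OrdLE (mkOrd dom lt) x y ↔ dom x ∧ dom y ∧ (x = y ∨ lt x y) :=
  pair_mem_pairs

theorem fld_mkOrd : Fld (mkOrd dom lt) x ↔ dom x :=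
  ordLE_mkOrd.trans ⟨fun h => h.1, fun h => ⟨h, h, Or.inl rfl⟩⟩

theorem ordLT_mkOrd (irr : ∀ x, ¬ lt x x) :
    OrdLT (mkOrd dom lt) x y ↔ dom x ∧ dom y ∧ lt x y := by
  refine (and_congr_left' ordLE_mkOrd).trans ⟨?_, ?_⟩
  · rintro ⟨⟨hx, hy, e | h⟩, hne⟩
    exacts [(hne e).elim, ⟨hx, hy, h⟩]
  · rintro ⟨hx, hy, h⟩
    refine ⟨⟨hx, hy, Or.inr h⟩, ?_⟩
    rintro rfl
    exact irr _ h

theorem isLinOrd_mkOrd (irr : ∀ x, ¬ lt x x) (tr : ∀ x y z, lt x y → lt y z → lt x z)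
    (tri : ∀ x y, dom x → dom y → lt x y ∨ x = y ∨ lt y x) : IsLinOrd (mkOrd dom lt) where
  pairs := by
    rintro p ⟨x, y, e, hx, hy, -⟩
    exact ⟨x, y, e, fld_mkOrd.2 hx, fld_mkOrd.2 hy⟩
  antisymm x y h h' := by
    obtain ⟨-, -, e | h⟩ := ordLE_mkOrd.1 h
    · exact e
    obtain ⟨-, -, e | h'⟩ := ordLE_mkOrd.1 h'
    · exact e.symm
    exact (irr _ (tr _ _ _ h h')).elim
  trans x y z h h' := by
    obtain ⟨hx, hy, e | h⟩ := ordLE_mkOrd.1 h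
    · rwa [e]
    obtain ⟨-, hz, e | h'⟩ := ordLE_mkOrd.1 h'
    · exact e ▸ ordLE_mkOrd.2 ⟨hx, hy, Or.inr h⟩
    exact ordLE_mkOrd.2 ⟨hx, hz, Or.inr (tr _ _ _ h h')⟩
  total x y hx hy := by
    rw [fld_mkOrd] at hx hy
    rw [ordLE_mkOrd, ordLE_mkOrd]
    obtain h | h | h := tri x y hx hy
    exacts [Or.inl ⟨hx, hy, Or.inr h⟩, Or.inl ⟨hx, hy, Or.inl h⟩, Or.inr ⟨hy, hx, Or.inr h⟩]

end

/-! ### Lexicographic comparison -/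

section
variable {ent : M → M → M → Prop} {lt : M → M → Prop} {s t r : M}

theorem LexLT.irrefl (hent : ∀ s l, IsSeq s l → ∀ i, i < l → ∃! x, ent s i x)
    (irr : ∀ x, ¬ lt x x) : ¬ LexLT ent lt s s := by
  rintro ⟨k, l, hk, hl, ⟨j, hj, -, ⟨x, y, hx, hy, h⟩, -⟩ | ⟨h, -⟩⟩
  · rw [(hent s k hk j hj).unique hx hy] at h
    exact irr _ h
  · exact h.ne (hk.length_unique hl)

theorem LexLT.trans (hent : ∀ s l, IsSeq s l → ∀ i, i < l → ∃! x, ent s i x)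
    (tr : ∀ x y z, lt x y → lt y z → lt x z) (h : LexLT ent lt s t) (h' : LexLT ent lt t r) :
    LexLT ent lt s r := by
  obtain ⟨k, l, hk, hl, h⟩ := h
  obtain ⟨l', m, hl', hm, h'⟩ := h'
  obtain rfl := hl.length_unique hl'
  refine ⟨k, m, hk, hm, ?_⟩
  have eq : ∀ i, i < l → (∃ x, ent s i x ∧ ent t i x) → (∃ x, ent t i x ∧ ent r i x) →
      ∃ x, ent s i x ∧ ent r i x := by
    rintro i hi ⟨x, hx, hx'⟩ ⟨y, hy, hy'⟩
    rw [(hent t l hl i hi).unique hy hx'] at hy'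
    exact ⟨x, hx, hy'⟩
  have left : ∀ i, i < l → (∃ x y, ent s i x ∧ ent t i y ∧ lt x y) → (∃ x, ent t i x ∧ ent r i x) →
      ∃ x y, ent s i x ∧ ent r i y ∧ lt x y := by
    rintro i hi ⟨x, y, hx, hy, h⟩ ⟨z, hz, hz'⟩
    rw [(hent t l hl i hi).unique hz hy] at hz'
    exact ⟨x, y, hx, hz', h⟩
  have right : ∀ i, i < l → (∃ x, ent s i x ∧ ent t i x) → (∃ x y, ent t i x ∧ ent r i y ∧ lt x y) →
      ∃ x y, ent s i x ∧ ent r i y ∧ lt x y := by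
    rintro i hi ⟨z, hz, hz'⟩ ⟨x, y, hx, hy, h⟩
    rw [(hent t l hl i hi).unique hx hz'] at h
    exact ⟨z, y, hz, hy, h⟩
  obtain ⟨j, hjk, hjl, hj, hlt⟩ | ⟨hkl, hk'⟩ := h <;>
    obtain ⟨j', hjl', hjm', hj', hlt'⟩ | ⟨hlm, hl''⟩ := h'
  · obtain hjj | rfl | hjj := lt_trichotomy j j'
    · exact Or.inl ⟨j, hjk, hjj.trans hjm', left j hjl hj (hlt' j hjj),
        fun i hi => eq i (hi.trans hjl) (hlt i hi) (hlt' i (hi.trans hjj))⟩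
    · refine Or.inl ⟨j, hjk, hjm', ?_, fun i hi => eq i (hi.trans hjl) (hlt i hi) (hlt' i hi)⟩
      obtain ⟨x, y, hx, hy, h⟩ := hj
      obtain ⟨y', z, hy', hz, h'⟩ := hj'
      rw [(hent t l hl j hjl).unique hy' hy] at h'
      exact ⟨x, z, hx, hz, tr _ _ _ h h'⟩
    · exact Or.inl ⟨j', hjj.trans hjk, hjm', right j' hjl' (hlt j' hjj) hj',
        fun i hi => eq i (hi.trans hjl') (hlt i (hi.trans hjj)) (hlt' i hi)⟩
  · exact Or.inl ⟨j, hjk, hjl.trans hlm, left j hjl hj (hl'' j hjl),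
      fun i hi => eq i (hi.trans hjl) (hlt i hi) (hl'' i (hi.trans hjl))⟩
  · obtain hjk | hkj := lt_or_ge j' k
    · exact Or.inl ⟨j', hjk, hjm', right j' hjl' (hk' j' hjk) hj',
        fun i hi => eq i (hi.trans hjl') (hk' i (hi.trans hjk)) (hlt' i hi)⟩
    · exact Or.inr ⟨hkj.trans_lt hjm', fun i hi => eq i (hi.trans hkl) (hk' i hi)
        (hlt' i (hi.trans_le hkj))⟩
  · exact Or.inr ⟨hkl.trans hlm, fun i hi => eq i (hi.trans hkl) (hk' i hi)
      (hl'' i (hi.trans hkl))⟩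

theorem entry_existsUnique (s l : M) (h : IsSeq s l) (i : M) (hi : i < l) : ∃! x, Entry s i x :=
  h.2.2 i hi

theorem lexLT_trichotomy {k l : M} (hs : IsSeq s k) (ht : IsSeq t l)
    (tri : ∀ i x y, Entry s i x → Entry t i y → lt x y ∨ x = y ∨ lt y x) :
    LexLT Entry lt s t ∨ s = t ∨ LexLT Entry lt t s := by
  by_cases hne : ∃ j, (j < k ∧ j < l) ∧ ∀ x, x < s → Entry s j x → ¬ Entry t j x
  · obtain ⟨j₀, hj₀⟩ := hne
    obtain ⟨S, h⟩ := RCA.exists_model (M := M)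
    obtain ⟨j, ⟨⟨hjk, hjl⟩, hj⟩, hmin⟩ := h.exists_least
      (fun M _ _ V v => (v 0 < v 1 ∧ v 0 < v 2) ∧ ∀ x, x < v 3 → Entry (v 3) (v 0) x →
        ¬ Entry (v 4) (v 0) x) (fun _ => ∅) (fun _ => h.empty_mem)
        (cons k (cons l (cons s (fun _ => t)))) j₀ hj₀
    change j < k at hjk
    change j < l at hjl
    change ∀ x, x < s → Entry s j x → ¬ Entry t j x at hj
    change ∀ i, i < j → ¬ ((i < k ∧ i < l) ∧ ∀ x, x < s → Entry s i x → ¬ Entry t i x) at hmin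
    have agree : ∀ i, i < j → ∃ x, Entry s i x ∧ Entry t i x := fun i hi => by
      by_contra! hc
      exact hmin i hi ⟨⟨hi.trans hjk, hi.trans hjl⟩, fun x _ => hc x⟩
    obtain ⟨x, hx⟩ := hs.exists_entry hjk
    obtain ⟨y, hy⟩ := ht.exists_entry hjl
    obtain h | rfl | h := tri j x y hx hy
    · exact Or.inl ⟨k, l, hs, ht, Or.inl ⟨j, hjk, hjl, ⟨x, y, hx, hy, h⟩, agree⟩⟩
    · exact (hj x hx.value_lt hx hy).elim
    · exact Or.inr (Or.inr ⟨l, k, ht, hs, Or.inl ⟨j, hjl, hjk, ⟨y, x, hy, hx, h⟩, fun i hi =>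
        (agree i hi).imp fun _ => And.symm⟩⟩)
  · have agree : ∀ i, i < k → i < l → ∃ x, Entry s i x ∧ Entry t i x := fun i hi hi' => by
      by_contra! hc
      exact hne ⟨i, ⟨hi, hi'⟩, fun x _ => hc x⟩
    obtain hkl | rfl | hkl := lt_trichotomy k l
    · exact Or.inl ⟨k, l, hs, ht, Or.inr ⟨hkl, fun i hi => agree i hi (hi.trans hkl)⟩⟩
    · exact Or.inr (Or.inl (hs.ext ht fun i hi => agree i hi hi))
    · exact Or.inr (Or.inr ⟨l, k, ht, hs, Or.inr ⟨hkl, fun i hi =>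
        (agree i (hi.trans hkl) hi).imp fun _ => And.symm⟩⟩)

end

/-! ### Products -/

/-- The strict order on `α · β`. -/
def ProdLT (α β : Set M) (p p' : M) : Prop :=
  ∃ b a b' a', p = pair b a ∧ p' = pair b' a' ∧ ((b = b' ∧ OrdLT α a a') ∨ OrdLT β b b')

theorem prodLT_pair {α β : Set M} {a b a' b' : M} :
    ProdLT α β (pair b a) (pair b' a') ↔ (b = b' ∧ OrdLT α a a') ∨ OrdLT β b b' := by
  constructor
  · rintro ⟨b₁, a₁, b₂, a₂, e₁, e₂, h⟩
    obtain ⟨rfl, rfl⟩ := pair_inj.1 e₁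
    obtain ⟨rfl, rfl⟩ := pair_inj.1 e₂
    exact h
  · exact fun h => ⟨b, a, b', a', rfl, rfl, h⟩

section
variable {α β : Set M}

theorem ProdLT.irrefl (p : M) : ¬ ProdLT α β p p := by
  rintro ⟨b, a, b', a', rfl, e, h⟩
  obtain ⟨rfl, rfl⟩ := pair_inj.1 e
  obtain ⟨-, h⟩ | h := h <;> exact OrdLT.irrefl h

theorem ProdLT.trans (hα : IsLinOrd α) (hβ : IsLinOrd β) (p q r : M) (h : ProdLT α β p q)
    (h' : ProdLT α β q r) : ProdLT α β p r := by
  obtain ⟨b, a, b', a', rfl, rfl, h⟩ := h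
  obtain ⟨b₁, a₁, b'', a'', e, rfl, h'⟩ := h'
  obtain ⟨rfl, rfl⟩ := pair_inj.1 e
  refine ⟨b, a, b'', a'', rfl, rfl, ?_⟩
  obtain ⟨rfl, h⟩ | h := h <;> obtain ⟨rfl, h'⟩ | h' := h'
  exacts [Or.inl ⟨rfl, hα.lt_trans h h'⟩, Or.inr h', Or.inr h, Or.inr (hβ.lt_trans h h')]

theorem ProdLT.trichotomy (hα : IsLinOrd α) (hβ : IsLinOrd β) {p q : M}
    (hp : ∃ b a, p = pair b a ∧ Fld β b ∧ Fld α a) (hq : ∃ b a, q = pair b a ∧ Fld β b ∧ Fld α a) :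
    ProdLT α β p q ∨ p = q ∨ ProdLT α β q p := by
  obtain ⟨b, a, rfl, hb, ha⟩ := hp
  obtain ⟨b', a', rfl, hb', ha'⟩ := hq
  simp only [prodLT_pair]
  obtain h | rfl | h := hβ.trichotomy hb hb'
  · exact Or.inl (Or.inr h)
  · obtain h | rfl | h := hα.trichotomy ha ha'
    exacts [Or.inl (Or.inl ⟨rfl, h⟩), Or.inr (Or.inl rfl), Or.inr (Or.inr (Or.inl ⟨rfl, h⟩))]
  · exact Or.inr (Or.inr (Or.inr h))

theorem isLinOrd_prodOrd (hα : IsLinOrd α) (hβ : IsLinOrd β) : IsLinOrd (prodOrd α β) :=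
  isLinOrd_mkOrd ProdLT.irrefl (ProdLT.trans hα hβ) fun _ _ => ProdLT.trichotomy hα hβ

theorem fld_prodOrd {a b : M} : Fld (prodOrd α β) (pair b a) ↔ Fld β b ∧ Fld α a := by
  refine fld_mkOrd.trans ⟨?_, fun h => ⟨b, a, rfl, h⟩⟩
  rintro ⟨b', a', e, h⟩
  obtain ⟨rfl, rfl⟩ := pair_inj.1 e
  exact h

theorem ordLT_prodOrd {p q : M} :
    OrdLT (prodOrd α β) p q ↔ Fld (prodOrd α β) p ∧ Fld (prodOrd α β) q ∧ ProdLT α β p q :=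
  (ordLT_mkOrd ProdLT.irrefl).trans (by unfold prodOrd; rw [fld_mkOrd, fld_mkOrd])

end

end

/-! ### Definability -/

section
variable {f g k : Fun1.{u}} [Tm f] [Tm g] [Tm k] (X Y : ℕ)

instance Df.ordLE : Df (fun M _ _ V v => OrdLE (V X) (f M V v) (g M V v)) := by
  unfold OrdLE; infer_instance

instance Df.ordLT : Df (fun M _ _ V v => OrdLT (V X) (f M V v) (g M V v)) := by
  unfold OrdLT; infer_instance

instance Df.fld : Df (fun M _ _ V v => Fld (V X) (f M V v)) := by
  unfold Fld; infer_instance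

/-- Components of a pair do not exceed its code, so this kind of pattern matching is a bounded
quantification. -/
instance Df.exists_pair
    {R : ∀ (M : Type u) [Arith M] [RCA M], M → M → (ℕ → Set M) → (ℕ → M) → Prop}
    [hR : Df (fun M _ _ V v => R M (v (0 + 1)) (v 0) V (fun i => v (i + 1 + 1)))] :
    Df (fun M _ _ V v => ∃ x y, f M V v = pair x y ∧ R M x y V v) := by
  have shift : ∀ f : Fun1.{u}, Tm f → Tm (fun M _ _ V v => f M V (fun i => v (i + 1))) := by
    intro f hf
    obtain ⟨t, ht⟩ := hf.out
    refine ⟨t.subst fun i => .var (i + 1), fun M _ _ V v => ?_⟩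
    rw [NTerm.eval_subst, ← ht]; rfl
  have h1 := shift f inferInstance
  have h2 := shift _ h1
  exact Df.congr fun M _ _ V v => exists_pair_iff (Q := fun x y => R M x y V v)

instance Df.prodLT : Df (fun M _ _ V v => ProdLT (V X) (V Y) (f M V v) (g M V v)) :=
  Df.subst₂ (P := fun _ _ _ V x y => ProdLT (V X) (V Y) x y) <|
    Df.congr (P := fun M _ _ V v => ∃ b a, v 0 = pair b a ∧ ∃ b' a', v 1 = pair b' a' ∧
      ((b = b' ∧ OrdLT (V X) a a') ∨ OrdLT (V Y) b b')) fun M _ _ V v => by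
        constructor
        · rintro ⟨b, a, b', a', e, e', h⟩
          exact ⟨b, a, e, b', a', e', h⟩
        · rintro ⟨b, a, e, b', a', e', h⟩
          exact ⟨b, a, b', a', e, e', h⟩

theorem lexLT_entry_iff {M : Type u} [Arith M] [RCA M] {lt : M → M → Prop} {s t : M} :
    LexLT Entry lt s t ↔ ∃ k, k ≤ s ∧ ∃ l, l ≤ t ∧ IsSeq s k ∧ IsSeq t l ∧
      ((∃ j, j < k ∧ j < l ∧ (∃ x, x < s ∧ ∃ y, y < t ∧ Entry s j x ∧ Entry t j y ∧ lt x y) ∧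
        ∀ i, i < j → ∃ x, x < s ∧ Entry s i x ∧ Entry t i x) ∨
      (k < l ∧ ∀ i, i < k → ∃ x, x < s ∧ Entry s i x ∧ Entry t i x)) := by
  have h1 : ∀ i, (∃ x, Entry s i x ∧ Entry t i x) ↔ ∃ x, x < s ∧ Entry s i x ∧ Entry t i x :=
    fun i => exists_congr fun x => ⟨fun h => ⟨h.1.value_lt, h⟩, fun h => h.2⟩
  have h2 : ∀ j, (∃ x y, Entry s j x ∧ Entry t j y ∧ lt x y) ↔
      ∃ x, x < s ∧ ∃ y, y < t ∧ Entry s j x ∧ Entry t j y ∧ lt x y := fun i =>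
    exists_congr fun x => ⟨fun ⟨y, h⟩ => ⟨h.1.value_lt, y, h.2.1.value_lt, h⟩,
      fun ⟨_, y, _, h⟩ => ⟨y, h⟩⟩
  simp only [← h1, ← h2]
  exact exists_congr fun k => ⟨fun ⟨l, h⟩ => ⟨h.1.length_le, l, h.2.1.length_le, h⟩,
    fun ⟨_, l, _, h⟩ => ⟨l, h⟩⟩

instance Df.lexLT {lt : ∀ (M : Type u) [Arith M] [RCA M], (ℕ → Set M) → M → M → Prop}
    [hlt : Df (fun M _ _ V v => lt M V (v 0) (v 1))] :
    Df (fun M _ _ V v => LexLT Entry (lt M V) (f M V v) (g M V v)) := by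
  have : ∀ (f g : Fun1.{u}) [Tm f] [Tm g], Df (fun M _ _ V v => lt M V (f M V v) (g M V v)) :=
    fun f g _ _ => Df.subst₂ hlt
  exact Df.subst₂ (P := fun M _ _ V x y => LexLT Entry (lt M V) x y)
    (Df.congr fun M _ _ V v => lexLT_entry_iff)

end

section
variable {M : Type u} [Arith M] [RCA M] {S : Set (Set M)} {α β : Set M}

theorem ModelsRCA0.prodOrd_mem (h : ModelsRCA0 S) (hα : α ∈ S) (hβ : β ∈ S) : prodOrd α β ∈ S :=
  h.comp₂ (fun M _ _ V v => (∃ b a, v 0 = pair b a ∧ Fld (V 1) b ∧ Fld (V 0) a) ∧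
    (∃ b a, v 1 = pair b a ∧ Fld (V 1) b ∧ Fld (V 0) a) ∧
    (v 0 = v 1 ∨ ProdLT (V 0) (V 1) (v 0) (v 1)))
    (cons α (fun _ => β)) (cons_mem hα fun _ => hβ) (fun _ => 0)

/-- The product of two well orders is well-founded. -/
theorem ModelsRCA0.wellFdd_prodOrd (h : ModelsRCA0 S) (hα : α ∈ S) (hβ : β ∈ S) (lβ : IsLinOrd β)
    (wα : WellFdd S α) (wβ : WellFdd S β) : WellFdd S (prodOrd α β) := by
  rintro ⟨F, hF, hF', hdesc⟩
  have hval : ∀ n p, pair n p ∈ F → ∃ b a, p = pair b a ∧ Fld β b ∧ Fld α a := fun n p hp => by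
    obtain ⟨q, hq⟩ := (hF'.2 (n + 1)).exists
    exact (ordLT_mkOrd ProdLT.irrefl).1 (hdesc n p q hp hq) |>.2.1
  have hdesc' : ∀ n b a b' a', pair n (pair b a) ∈ F → pair (n + 1) (pair b' a') ∈ F →
      (b' = b ∧ OrdLT α a' a) ∨ OrdLT β b' b := fun n b a b' a' hp hq =>
    prodLT_pair.1 (ordLT_prodOrd.1 (hdesc n _ _ hp hq)).2.2
  -- Either every first component that occurs has a smaller one somewhere in the sequence, which
  -- yields a descent in β, or one of them is never undercut and the descent continues in α.
  by_cases hc : ∀ n b a, pair n (pair b a) ∈ F → ∃ m b' a', pair m (pair b' a') ∈ F ∧ OrdLT β b' b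
  · obtain ⟨p₀, hp₀⟩ := (hF'.2 0).exists
    have hI := h.comp₂ (fun M _ _ V v => v 1 ∈ V 0) (fun _ => F) (fun _ => hF) (fun _ => 0)
    have hX := h.comp₂ (fun M _ _ V v => ∃ m p, v 0 = pair m p ∧ ∃ b a, p = pair b a ∧
      ∃ m' p', v 1 = pair m' p' ∧ ∃ b' a', p' = pair b' a' ∧ OrdLT (V 0) b' b) (fun _ => β)
      (fun _ => hβ) (fun _ => 0)
    -- The path runs through elements of the graph `F` itself, so that each term carries the proof
    -- that it occurs. First components are projected out afterwards.
    obtain ⟨G, hG, hG', hGF, hGX⟩ := h.exists_path hI hX (a := pair 0 p₀) (pair_mem_pairs.2 hp₀)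
      (fun n z hz => by
        have hz : z ∈ F := pair_mem_pairs.1 hz
        obtain ⟨m, p, rfl⟩ := hF'.1 z hz
        obtain ⟨b, a, rfl, -⟩ := hval m p hz
        obtain ⟨m', b', a', hm', hlt⟩ := hc m b a hz
        exact ⟨pair m' (pair b' a'), pair_mem_pairs.2 hm', pair_mem_pairs.2
          ⟨m, _, rfl, b, a, rfl, m', _, rfl, b', a', rfl, hlt⟩⟩)
    have hE := h.comp₂ (fun M _ _ V v => ∃ m p, v 0 = pair m p ∧ ∃ b a, p = pair b a ∧ v 1 = b)
      (fun _ => β) (fun _ => hβ) (fun _ => 0)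
    have key : ∀ m b a t : M, pair (pair m (pair b a)) t ∈ pairs (fun x y => ∃ m p, x = pair m p ∧
        ∃ b a, p = pair b a ∧ y = b) ↔ t = b := fun m b a t => by
      rw [pair_mem_pairs]
      constructor
      · rintro ⟨m, p, e, b, a, rfl, h⟩
        rw [pair_inj, pair_inj] at e
        rw [h, e.2.1]
      · exact fun h => ⟨_, _, rfl, _, _, rfl, h⟩
    obtain ⟨H, hH, hH', hHG⟩ := h.exists_fun_comp hG hE hG' (fun n s hs => by
      have hs : s ∈ F := pair_mem_pairs.1 (hGF n s hs)
      obtain ⟨m, p, rfl⟩ := hF'.1 s hs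
      obtain ⟨b, a, rfl, -⟩ := hval m p hs
      exact ⟨b, (key _ _ _ _).2 rfl, fun t ht => (key _ _ _ _).1 ht⟩)
    refine wβ ⟨H, hH, hH', fun n x y hx hy => ?_⟩
    obtain ⟨s, hs, hsx⟩ := (hHG _ _).1 hx
    obtain ⟨t, ht, hty⟩ := (hHG _ _).1 hy
    obtain ⟨m, p, rfl, b, a, rfl, m', p', rfl, b', a', rfl, hlt⟩ :=
      pair_mem_pairs.1 (hGX n s t hs ht)
    rw [(key _ _ _ _).1 hsx, (key _ _ _ _).1 hty]
    exact hlt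
  · push Not at hc
    obtain ⟨N, b, a, hN, hmin⟩ := hc
    have hGS := h.comp₂ (fun M _ _ V v => pair (v 2 + v 0) (v 1) ∈ V 0) (fun _ => F) (fun _ => hF)
      (fun _ => N)
    have hG' : IsFun (pairs (fun x y => pair (N + x) y ∈ F)) := by
      refine ⟨fun p ⟨x, y, e, _⟩ => ⟨x, y, e⟩, fun n => ?_⟩
      simp only [pair_mem_pairs]
      exact hF'.2 _
    have hY := h.comp₂ (fun M _ _ V v => ∃ b a, v 1 = pair b a ∧ b = v 2) (fun _ => F)
      (fun _ => hF) (fun _ => b)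
    -- From position `N` on the first component stays b: each step keeps or lowers it, and lowering
    -- is excluded by the choice of `N`.
    have hconst := h.fun_ind hGS hY hG'
      (fun x hx => by
        have hx := pair_mem_pairs.1 hx
        change pair (N + 0) x ∈ F at hx
        rw [_root_.add_zero] at hx
        rw [(hF'.2 N).unique hx hN]
        exact pair_mem_pairs.2 ⟨b, a, rfl, rfl⟩)
      (fun n x y hx hxY hy => by
        obtain ⟨_, a₁, rfl, rfl⟩ := pair_mem_pairs.1 hxY
        have hx := pair_mem_pairs.1 hx
        have hy := pair_mem_pairs.1 hy
        change pair (N + (n + 1)) y ∈ F at hy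
        obtain ⟨b₂, a₂, rfl, hb₂, -⟩ := hval _ _ hy
        rw [← add_assoc] at hy
        refine pair_mem_pairs.2 ⟨b₂, a₂, rfl, ?_⟩
        obtain ⟨e, -⟩ | hlt := hdesc' _ _ _ _ _ hx hy
        exacts [e, (hmin _ _ _ hy hlt).elim])
    have hE := h.comp₂ (fun M _ _ V v => ∃ b a, v 0 = pair b a ∧ v 1 = a)
      (fun _ => β) (fun _ => hβ) (fun _ => 0)
    have key : ∀ b a t : M, pair (pair b a) t ∈ pairs (fun x y => ∃ b a, x = pair b a ∧ y = a) ↔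
        t = a := fun b a t => by
      rw [pair_mem_pairs]
      constructor
      · rintro ⟨m, p, e, h⟩
        rw [h, (pair_inj.1 e).2]
      · exact fun h => ⟨_, _, rfl, h⟩
    obtain ⟨H, hH, hH', hHG⟩ := h.exists_fun_comp hGS hE hG' (fun n s hs => by
      obtain ⟨b', a', rfl, -⟩ := hval _ s (pair_mem_pairs.1 hs)
      exact ⟨a', (key _ _ _).2 rfl, fun t ht => (key _ _ _).1 ht⟩)
    refine wα ⟨H, hH, hH', fun n x y hx hy => ?_⟩
    obtain ⟨s, hs, hsx⟩ := (hHG _ _).1 hx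
    obtain ⟨t, ht, hty⟩ := (hHG _ _).1 hy
    obtain ⟨_, a₁, rfl, rfl⟩ := pair_mem_pairs.1 (hconst _ _ hs)
    obtain ⟨b₂, a₂, rfl, e⟩ := pair_mem_pairs.1 (hconst _ _ ht)
    rw [(key _ _ _).1 hsx, (key _ _ _).1 hty]
    have hs := pair_mem_pairs.1 hs
    have ht := pair_mem_pairs.1 ht
    change pair (N + (n + 1)) _ ∈ F at ht
    rw [← add_assoc] at ht
    obtain ⟨-, hlt⟩ | hlt := hdesc' _ _ _ _ _ hs ht
    exacts [hlt, (hmin _ _ _ ht hlt).elim]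

end
end SOA

namespace SOA

/-! ### The orders `2^γ` and `(1 + α)^γ` -/

section
variable {M : Type u} [Arith M] [RCA M] {S : Set (Set M)} {α γ : Set M} {s t : M}

theorem fld_twoPow : Fld (twoPow γ) s ↔ ∃ l, IsSeq s l ∧ (∀ i x, Entry s i x → Fld γ x) ∧
    ∀ i j x x', i < j → Entry s i x → Entry s j x' → OrdLT γ x' x := fld_mkOrd

theorem fld_onePlusPow : Fld (onePlusPow α γ) s ↔ ∃ l, IsSeq s l ∧
    (∀ i p, Entry s i p → ∃ x y, p = pair x y ∧ Fld γ x ∧ Fld α y) ∧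
    ∀ i j x y x' y', i < j → Entry s i (pair x y) → Entry s j (pair x' y') → OrdLT γ x' x :=
  fld_mkOrd

theorem ordLT_twoPow : OrdLT (twoPow γ) s t ↔
    Fld (twoPow γ) s ∧ Fld (twoPow γ) t ∧ LexLT Entry (OrdLT γ) s t :=
  (ordLT_mkOrd fun _ => LexLT.irrefl entry_existsUnique fun _ => OrdLT.irrefl).trans
    (by rw [fld_twoPow, fld_twoPow])

theorem ordLT_onePlusPow : OrdLT (onePlusPow α γ) s t ↔
    Fld (onePlusPow α γ) s ∧ Fld (onePlusPow α γ) t ∧ LexLT Entry (ProdLT α γ) s t :=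
  (ordLT_mkOrd fun _ => LexLT.irrefl entry_existsUnique ProdLT.irrefl).trans
    (by rw [fld_onePlusPow, fld_onePlusPow])

theorem isLinOrd_twoPow (hγ : IsLinOrd γ) : IsLinOrd (twoPow γ) :=
  isLinOrd_mkOrd (fun _ => LexLT.irrefl entry_existsUnique fun _ => OrdLT.irrefl)
    (fun _ _ _ => LexLT.trans entry_existsUnique fun _ _ _ => hγ.lt_trans) <| by
    rintro s t ⟨k, hs, hs', -⟩ ⟨l, ht, ht', -⟩
    exact lexLT_trichotomy hs ht fun i x y hx hy => hγ.trichotomy (hs' i x hx) (ht' i y hy)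

theorem isLinOrd_onePlusPow (hα : IsLinOrd α) (hγ : IsLinOrd γ) : IsLinOrd (onePlusPow α γ) :=
  isLinOrd_mkOrd (fun _ => LexLT.irrefl entry_existsUnique ProdLT.irrefl)
    (fun _ _ _ => LexLT.trans entry_existsUnique (ProdLT.trans hα hγ)) <| by
    rintro s t ⟨k, hs, hs', -⟩ ⟨l, ht, ht', -⟩
    exact lexLT_trichotomy hs ht fun i x y hx hy =>
      ProdLT.trichotomy hα hγ (hs' i x hx) (ht' i y hy)

end

section
variable {f g k : Fun1.{u}} [Tm f] [Tm g] [Tm k] (X Y : ℕ)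

instance Df.fld_twoPow : Df (fun M _ _ V v => Fld (twoPow (V X)) (f M V v)) :=
  Df.subst₁ (P := fun _ _ _ V s => Fld (twoPow (V X)) s) <|
    Df.congr (P := fun M _ _ V v => ∃ l, l ≤ v 0 ∧ IsSeq (v 0) l ∧
      (∀ i, i < v 0 → ∀ x, x < v 0 → Entry (v 0) i x → Fld (V X) x) ∧
      ∀ i, i < v 0 → ∀ j, j < v 0 → ∀ x, x < v 0 → ∀ x', x' < v 0 → i < j →
        Entry (v 0) i x → Entry (v 0) j x' → OrdLT (V X) x' x) fun M _ _ V v => by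
      rw [SOA.fld_twoPow]
      refine exists_congr fun l => ⟨fun ⟨h1, h2, h3⟩ => ⟨h1.length_le, h1, fun i _ x _ => h2 i x,
        fun i _ j _ x _ x' _ => h3 i j x x'⟩, fun ⟨_, h1, h2, h3⟩ => ⟨h1, fun i x hx =>
          h2 i hx.index_lt x hx.value_lt hx, fun i j x x' hij hx hx' =>
          h3 i hx.index_lt j hx'.index_lt x hx.value_lt x' hx'.value_lt hij hx hx'⟩⟩

instance Df.fld_onePlusPow : Df (fun M _ _ V v => Fld (onePlusPow (V X) (V Y)) (f M V v)) :=
  Df.subst₁ (P := fun _ _ _ V s => Fld (onePlusPow (V X) (V Y)) s) <|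
    Df.congr (P := fun M _ _ V v => ∃ l, l ≤ v 0 ∧ IsSeq (v 0) l ∧
      (∀ i, i < v 0 → ∀ p, p < v 0 → Entry (v 0) i p →
        ∃ x y, p = pair x y ∧ Fld (V Y) x ∧ Fld (V X) y) ∧
      ∀ i, i < v 0 → ∀ j, j < v 0 → ∀ x, x < v 0 → ∀ y, y < v 0 → ∀ x', x' < v 0 →
        ∀ y', y' < v 0 → i < j →
        Entry (v 0) i (pair x y) → Entry (v 0) j (pair x' y') → OrdLT (V Y) x' x)
      fun M _ _ V v => by
      rw [SOA.fld_onePlusPow]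
      refine exists_congr fun l => ⟨fun ⟨h1, h2, h3⟩ => ⟨h1.length_le, h1, fun i _ x _ => h2 i x,
        fun i _ j _ x _ y _ x' _ y' _ => h3 i j x y x' y'⟩, fun ⟨_, h1, h2, h3⟩ =>
        ⟨h1, fun i x hx => h2 i hx.index_lt x hx.value_lt hx, fun i j x y x' y' hij hx hx' =>
          h3 i hx.index_lt j hx'.index_lt x ((left_le_pair _ _).trans_lt hx.value_lt)
            y ((right_le_pair _ _).trans_lt hx.value_lt)
            x' ((left_le_pair _ _).trans_lt hx'.value_lt)
            y' ((right_le_pair _ _).trans_lt hx'.value_lt) hij hx hx'⟩⟩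

instance Df.ordLT_onePlusPow :
    Df (fun M _ _ V v => OrdLT (onePlusPow (V X) (V Y)) (f M V v) (g M V v)) :=
  Df.congr fun M _ _ V v => SOA.ordLT_onePlusPow

end

section
variable {M : Type u} [Arith M] [RCA M] {S : Set (Set M)} {α γ : Set M} {s t : M}

theorem ModelsRCA0.twoPow_mem (h : ModelsRCA0 S) (hγ : γ ∈ S) : twoPow γ ∈ S := by
  have := h.comp₂ (fun M _ _ V v => Fld (twoPow (V 0)) (v 0) ∧ Fld (twoPow (V 0)) (v 1) ∧
    (v 0 = v 1 ∨ LexLT Entry (OrdLT (V 0)) (v 0) (v 1))) (fun _ => γ) (fun _ => hγ) (fun _ => 0)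
  convert this using 1
  change _ = pairs fun s t => Fld (twoPow γ) s ∧ Fld (twoPow γ) t ∧
    (s = t ∨ LexLT Entry (OrdLT γ) s t)
  simp only [fld_twoPow]
  rfl

/-- In `2^γ`, a term is smaller than another one if the largest exponent in which they differ
occurs in the latter. -/
theorem twoPow_lt_of_range (hγ : IsLinOrd γ) (hs : Fld (twoPow γ) s) (ht : Fld (twoPow γ) t) {z : M}
    (hz : ∃ k, Entry t k z) (hz' : ∀ k, ¬ Entry s k z)
    (h : ∀ w, OrdLT γ z w → ((∃ k, Entry s k w) ↔ ∃ k, Entry t k w)) : OrdLT (twoPow γ) s t := by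
  obtain hlt | rfl | hlt := (isLinOrd_twoPow hγ).trichotomy hs ht
  · exact hlt
  · exact (hz' _ hz.choose_spec).elim
  exfalso
  obtain ⟨l, hs, hsγ, hsd⟩ := fld_twoPow.1 hs
  obtain ⟨k, ht, htγ, htd⟩ := fld_twoPow.1 ht
  obtain ⟨i, hi⟩ := hz
  obtain ⟨-, -, k', l', ht', hs', hlt⟩ := ordLT_twoPow.1 hlt
  obtain rfl := ht.length_unique ht'
  obtain rfl := hs.length_unique hs'
  obtain ⟨j, hjk, hjl, ⟨y, x, hy, hx, hyx⟩, hag⟩ | ⟨hkl, hag⟩ := hlt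
  -- At the first difference t has y and s has `x > y`. An x above z would occur in t as well, which
  -- its ordering rules out; `x = z` is excluded; and if z is above x, then z must stand among the
  -- earlier, common entries.
  · obtain hzx | rfl | hxz := hγ.trichotomy (htγ _ _ hi) (hsγ _ _ hx)
    · obtain ⟨m, hm⟩ := (h x hzx).1 ⟨j, hx⟩
      obtain hmj | rfl | hmj := lt_trichotomy m j
      · obtain ⟨w, hw, hw'⟩ := hag m hmj
        obtain rfl := ht.unique hm hw
        exact OrdLT.irrefl (hsd _ _ _ _ hmj hw' hx)
      · rw [ht.unique hm hy] at hyx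
        exact OrdLT.irrefl hyx
      · exact OrdLT.irrefl (hγ.lt_trans (htd _ _ _ _ hmj hy hm) hyx)
    · exact hz' _ hx
    · obtain hij | rfl | hij := lt_trichotomy i j
      · obtain ⟨w, hw, hw'⟩ := hag i hij
        rw [ht.unique hw hi] at hw'
        exact hz' _ hw'
      · rw [ht.unique hi hy] at hxz
        exact OrdLT.irrefl (hγ.lt_trans hyx hxz)
      · exact OrdLT.irrefl (hγ.lt_trans (htd _ _ _ _ hij hy hi) (hγ.lt_trans hyx hxz))
  · obtain ⟨w, hw, hw'⟩ := hag i (ht.index_lt hi)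
    rw [ht.unique hw hi] at hw'
    exact hz' _ hw'

/-- A term is determined by its set of exponents. An entry of t witnessing the difference would have
to occur in s, but it is too small for the earlier places, which are shared, and too large for the
others. -/
theorem twoPow_not_lt_of_range (hγ : IsLinOrd γ)
    (h : ∀ w, (∃ k, Entry s k w) ↔ ∃ k, Entry t k w) : ¬ OrdLT (twoPow γ) s t := by
  intro hlt
  obtain ⟨hs, ht, k, l, hs', ht', hlt⟩ := ordLT_twoPow.1 hlt
  obtain ⟨-, -, hsγ, hsd⟩ := fld_twoPow.1 hs
  obtain ⟨-, -, htγ, htd⟩ := fld_twoPow.1 ht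
  obtain ⟨j, hjk, hjl, ⟨x, y, hx, hy, hxy⟩, hag⟩ | ⟨hkl, hag⟩ := hlt
  · obtain ⟨m, hm⟩ := (h y).2 ⟨j, hy⟩
    obtain hmj | rfl | hmj := lt_trichotomy m j
    · obtain ⟨w, hw, hw'⟩ := hag m hmj
      obtain rfl := hs'.unique hm hw
      exact OrdLT.irrefl (htd _ _ _ _ hmj hw' hy)
    · rw [hs'.unique hm hx] at hxy
      exact OrdLT.irrefl hxy
    · exact OrdLT.irrefl (hγ.lt_trans (hsd _ _ _ _ hmj hx hm) hxy)
  · obtain ⟨y, hy⟩ := ht'.exists_entry hkl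
    obtain ⟨m, hm⟩ := (h y).2 ⟨k, hy⟩
    obtain ⟨w, hw, hw'⟩ := hag m (hs'.index_lt hm)
    obtain rfl := hs'.unique hm hw
    exact OrdLT.irrefl (htd _ _ _ _ (hs'.index_lt hm) hw' hy)

theorem twoPow_ext (hγ : IsLinOrd γ) (hs : Fld (twoPow γ) s) (ht : Fld (twoPow γ) t)
    (h : ∀ w, (∃ k, Entry s k w) ↔ ∃ k, Entry t k w) : s = t := by
  obtain hlt | rfl | hlt := (isLinOrd_twoPow hγ).trichotomy hs ht
  · exact (twoPow_not_lt_of_range hγ h hlt).elim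
  · rfl
  · exact (twoPow_not_lt_of_range hγ (fun w => (h w).symm) hlt).elim

end
end SOA

namespace SOA

/-! ### The permutations that are induced by an order on the natural numbers -/

section
variable {f g k : Fun1.{u}} [Tm f] [Tm g] [Tm k] (X : ℕ)

instance Df.isPerm : Df (fun M _ _ V v => IsPerm (V X) (f M V v) (g M V v)) :=
  Df.subst₂ (P := fun _ _ _ V n p => IsPerm (V X) n p) <|
    Df.congr (P := fun M _ _ V v => IsSeq (v 1) (v 0) ∧
      (∀ i, i < v 1 → ∀ k, k < v 1 → Entry (v 1) i k → k < v 0) ∧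
      (∀ k, k < v 0 → ∃ i, i < v 1 ∧ Entry (v 1) i k) ∧
      ∀ i, i < v 1 → ∀ j, j < v 1 → ∀ k, k < v 1 → ∀ k', k' < v 1 → Entry (v 1) i k →
        Entry (v 1) j k' → ((k < k' ∨ k = k') ↔ OrdLE (V X) i j)) fun M _ _ V v => by
      refine and_congr_right fun _ => and_congr ?_ (and_congr ?_ ?_)
      · exact ⟨fun h i _ k _ => h i k, fun h i k hk => h i hk.index_lt k hk.value_lt hk⟩
      · exact forall_congr' fun k => forall_congr' fun _ => exists_congr fun i =>
          ⟨fun h => ⟨h.index_lt, h⟩, fun h => h.2⟩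
      · exact ⟨fun h i _ j _ k _ k' _ => h i j k k', fun h i j k k' hk hk' =>
          h i hk.index_lt j hk'.index_lt k hk.value_lt k' hk'.value_lt hk hk'⟩

end

section
variable {M : Type u} [Arith M] [RCA M] {S : Set (Set M)} {L : Set M} {n p p' i j k k' : M}

namespace IsPerm

theorem le_iff (h : IsPerm L n p) (hk : Entry p i k) (hk' : Entry p j k') :
    k ≤ k' ↔ OrdLE L i j := h.2.2.2 i j k k' hk hk'

theorem lt_iff (hL : IsLinOrdOnNat L) (h : IsPerm L n p) (hk : Entry p i k) (hk' : Entry p j k') :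
    k < k' ↔ OrdLT L i j := by
  rw [← not_le, h.le_iff hk' hk]
  exact ⟨hL.1.lt_of_not_le (hL.2 _) (hL.2 _), hL.1.not_le_of_lt⟩

theorem inj (hL : IsLinOrdOnNat L) (h : IsPerm L n p) (hk : Entry p i k) (hk' : Entry p j k) :
    i = j :=
  hL.1.antisymm _ _ ((h.le_iff hk hk').1 le_rfl) ((h.le_iff hk' hk).1 le_rfl)

end IsPerm

/-- Look at the least value that is placed differently. The two indices carrying it differ; the one
that is smaller in L receives a smaller value from the other permutation, and smaller values are
already known to be placed alike. -/
theorem ModelsRCA0.perm_unique (h : ModelsRCA0 S) (hL : IsLinOrdOnNat L) (hp : IsPerm L n p)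
    (hp' : IsPerm L n p') : p = p' := by
  by_contra hne
  have hd : ∃ k₀, ∃ i, i < n ∧ Entry p i k₀ ∧ ¬ Entry p' i k₀ := by
    by_contra! hc
    exact hne (hp.1.ext hp'.1 fun i hi => by
      obtain ⟨k, hk⟩ := hp.1.exists_entry hi
      exact ⟨k, hk, hc k i hi hk⟩)
  obtain ⟨k₀, hk₀⟩ := hd
  obtain ⟨k, ⟨i, hi, hk, hk'⟩, hmin⟩ := h.exists_least
    (fun M _ _ V v => ∃ i, i < v 1 ∧ Entry (v 2) i (v 0) ∧ ¬ Entry (v 3) i (v 0)) (fun _ => ∅)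
    (fun _ => h.empty_mem) (cons n (cons p (fun _ => p'))) k₀ hk₀
  change i < n at hi
  change Entry p i k at hk
  change ¬ Entry p' i k at hk'
  change ∀ c, c < k → ¬ ∃ i, i < n ∧ Entry p i c ∧ ¬ Entry p' i c at hmin
  replace hmin : ∀ i c, c < k → Entry p i c → Entry p' i c := fun i c hc hi => by
    by_contra hi'
    exact hmin c hc ⟨i, hp.1.index_lt hi, hi, hi'⟩
  obtain ⟨j, hj⟩ := hp'.2.2.1 k (hp.2.1 i k hk)
  obtain hij | rfl | hij := hL.1.trichotomy (hL.2 i) (hL.2 j)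
  · obtain ⟨c, hc⟩ := hp'.1.exists_entry hi
    have hck : c < k := (hp'.lt_iff hL hc hj).2 hij
    obtain ⟨m, hm⟩ := hp.2.2.1 c (hck.trans (hp.2.1 i k hk))
    obtain rfl := hp'.inj hL (hmin m c hck hm) hc
    exact hck.ne (hp.1.unique hm hk)
  · exact hk' hj
  · obtain ⟨c, hc⟩ := hp.1.exists_entry (hp'.1.index_lt hj)
    have hck : c < k := (hp.lt_iff hL hc hk).2 hij
    exact hck.ne (hp'.1.unique (hmin j c hck hc) hj)

/-- Insertion: n receives a rank c, and the old values from c on move up by one. To avoid counting,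
c is found as the least strict upper bound for the values at indices below n in the sense of L. -/
theorem ModelsRCA0.exists_perm (h : ModelsRCA0 S) (hLS : L ∈ S) (hL : IsLinOrdOnNat L) (n : M) :
    ∃ p, IsPerm L n p := by
  refine h.sigma_ind (fun M _ _ V v => IsPerm (V 0) (v 1) (v 0)) (fun _ => L) (fun _ => hLS)
    (fun _ => 0) ?_ ?_ n
  · obtain ⟨e, he⟩ := h.exists_empty_seq
    have hn : ∀ i x, ¬ Entry e i x := fun i x hx => Arith.not_lt_zero _ (he.index_lt hx)
    exact ⟨e, he, fun i k hk => (hn _ _ hk).elim, fun k hk => (Arith.not_lt_zero _ hk).elim,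
      fun i j k k' hk => (hn _ _ hk).elim⟩
  · rintro n ⟨p, hp⟩
    change IsPerm L n p at hp
    change ∃ q, IsPerm L (n + 1) q
    obtain ⟨c, hc, hmin⟩ := h.exists_least (fun M _ _ V v => ∀ i, i < v 1 → ∀ k, k < v 2 →
      Entry (v 2) i k → OrdLT (V 0) i (v 1) → k < v 0) (fun _ => L) (fun _ => hLS)
      (cons n (fun _ => p)) n (fun i _ k _ hk _ => hp.2.1 i k hk)
    change ∀ i, i < n → ∀ k, k < p → Entry p i k → OrdLT L i n → k < c at hc
    change ∀ d, d < c → ¬ ∀ i, i < n → ∀ k, k < p → Entry p i k → OrdLT L i n → k < d at hmin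
    have hcn : c ≤ n := not_lt.1 fun hlt => hmin n hlt fun i _ k _ hk _ => hp.2.1 i k hk
    have hiff : ∀ i k, Entry p i k → (OrdLT L i n ↔ k < c) := fun i k hk => by
      refine ⟨hc i (hp.1.index_lt hk) k hk.value_lt hk, fun hlt => ?_⟩
      by_contra hn
      have hni : OrdLT L n i := by
        obtain h | h | h := hL.1.trichotomy (hL.2 i) (hL.2 n)
        exacts [(hn h).elim, (((hp.1.index_lt hk).ne h).elim), h]
      exact hmin k hlt fun i' _ k' _ hk' hlt' => (hp.lt_iff hL hk' hk).2 (hL.1.lt_trans hlt' hni)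
    have hX := h.comp₂ (fun M _ _ V v => (∃ k, k < v 2 ∧ Entry (v 2) (v 0) k ∧
      ((k < v 3 ∧ v 1 = k) ∨ (v 3 ≤ k ∧ v 1 = k + 1))) ∨ v 0 = v 4 ∧ v 1 = v 3)
      (fun _ => ∅) (fun _ => h.empty_mem) (cons p (cons c (fun _ => n)))
    change pairs (fun i x => (∃ k, k < p ∧ Entry p i k ∧ ((k < c ∧ x = k) ∨ (c ≤ k ∧ x = k + 1))) ∨
      i = n ∧ x = c) ∈ S at hX
    have hold : ∀ i k, Entry p i k → ∀ x, ((k < c ∧ x = k) ∨ (c ≤ k ∧ x = k + 1)) ↔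
        (∃ k, k < p ∧ Entry p i k ∧ ((k < c ∧ x = k) ∨ (c ≤ k ∧ x = k + 1))) ∨ i = n ∧ x = c := by
      intro i k hk x
      constructor
      · exact fun h => Or.inl ⟨k, hk.value_lt, hk, h⟩
      · rintro (⟨k', -, hk', h⟩ | ⟨rfl, -⟩)
        · rwa [hp.1.unique hk hk']
        · exact (lt_irrefl _ (hp.1.index_lt hk)).elim
    obtain ⟨q, hq, hqe⟩ := h.exists_seq hX (l := n + 1) (fun i hi => by
      simp only [pair_mem_pairs]
      obtain hi | rfl := Arith.lt_succ.1 hi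
      · obtain ⟨k, hk⟩ := hp.1.exists_entry hi
        simp only [← hold i k hk]
        obtain hkc | hkc := lt_or_ge k c
        · exact ⟨k, Or.inl ⟨hkc, rfl⟩, by rintro y (⟨-, h⟩ | ⟨h, -⟩); exacts [h, (hkc.not_ge h).elim]⟩
        · exact ⟨k + 1, Or.inr ⟨hkc, rfl⟩, by
            rintro y (⟨h, -⟩ | ⟨-, h⟩); exacts [(hkc.not_gt h).elim, h]⟩
      · refine ⟨c, Or.inr ⟨rfl, rfl⟩, ?_⟩
        rintro y (⟨k, -, hk, -⟩ | ⟨-, h⟩)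
        exacts [(lt_irrefl _ (hp.1.index_lt hk)).elim, h])
    simp only [pair_mem_pairs] at hqe
    have hlast : ∀ x, Entry q n x ↔ x = c := fun x => by
      rw [hqe]
      constructor
      · rintro ⟨-, ⟨k, -, hk, -⟩ | ⟨-, h⟩⟩
        exacts [(lt_irrefl _ (hp.1.index_lt hk)).elim, h]
      · exact fun h => ⟨Arith.lt_add_one_iff.2 le_rfl, Or.inr ⟨rfl, h⟩⟩
    have hprev : ∀ i k, Entry p i k → ∀ x, Entry q i x ↔
        ((k < c ∧ x = k) ∨ (c ≤ k ∧ x = k + 1)) := fun i k hk x => by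
      rw [hqe, hold i k hk, and_iff_right ((hp.1.index_lt hk).trans (Arith.lt_add_one_iff.2 le_rfl))]
    have hcases : ∀ i x, Entry q i x → (∃ k, Entry p i k ∧
        ((k < c ∧ x = k) ∨ (c ≤ k ∧ x = k + 1))) ∨ i = n ∧ x = c := fun i x hx => by
      obtain ⟨-, ⟨k, -, hk⟩ | h⟩ := (hqe i x).1 hx
      exacts [Or.inl ⟨k, hk⟩, Or.inr h]
    refine ⟨q, hq, fun i x hx => ?_, fun x hx => ?_, fun i j x y hx hy => ?_⟩
    · rw [Arith.lt_add_one_iff]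
      obtain ⟨k, hk, ⟨-, rfl⟩ | ⟨-, rfl⟩⟩ | ⟨-, rfl⟩ := hcases i x hx
      exacts [(hp.2.1 i _ hk).le, Arith.add_one_le_iff.2 (hp.2.1 i _ hk), hcn]
    · obtain hxc | rfl | hxc := lt_trichotomy x c
      · obtain ⟨i, hi⟩ := hp.2.2.1 x (hxc.trans_le hcn)
        exact ⟨i, (hprev i x hi x).2 (Or.inl ⟨hxc, rfl⟩)⟩
      · exact ⟨n, (hlast x).2 rfl⟩
      · obtain rfl | ⟨y, rfl⟩ := Arith.eq_zero_or_succ x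
        · exact (Arith.not_lt_zero _ hxc).elim
        · obtain ⟨i, hi⟩ := hp.2.2.1 y (lt_of_add_lt_add_right hx)
          exact ⟨i, (hprev i y hi _).2 (Or.inr ⟨Arith.lt_add_one_iff.1 hxc, rfl⟩)⟩
    · change x ≤ y ↔ OrdLE L i j
      have hlt1 : ∀ z : M, z < z + 1 := fun z => Arith.lt_add_one_iff.2 le_rfl
      obtain ⟨k, hk, hkx⟩ | ⟨rfl, rfl⟩ := hcases i x hx <;>
        obtain ⟨m, hm, hmy⟩ | ⟨rfl, rfl⟩ := hcases j y hy
      · rw [← hp.le_iff hk hm]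
        obtain ⟨hkc, rfl⟩ | ⟨hkc, rfl⟩ := hkx <;> obtain ⟨hmc, rfl⟩ | ⟨hmc, rfl⟩ := hmy
        · rfl
        · exact iff_of_true (hkc.le.trans (hmc.trans (hlt1 m).le)) (hkc.le.trans hmc)
        · exact iff_of_false (not_le.2 ((hmc.trans_le hkc).trans (hlt1 k)))
            (not_le.2 (hmc.trans_le hkc))
        · exact add_le_add_iff_right 1
      · have : OrdLE L i j ↔ k < y := by
          rw [← hiff i k hk]
          exact ⟨fun h => ⟨h, (hp.1.index_lt hk).ne⟩, fun h => h.1⟩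
        rw [this]
        obtain ⟨hkc, rfl⟩ | ⟨hkc, rfl⟩ := hkx
        · exact iff_of_true hkc.le hkc
        · exact iff_of_false (not_le.2 (hkc.trans_lt (hlt1 k))) hkc.not_gt
      · have : OrdLE L i j ↔ ¬ m < x := by
          rw [← hiff j m hm]
          exact ⟨fun h h' => hL.1.not_le_of_lt h' h, fun h => by
            by_contra hn
            exact h (hL.1.lt_of_not_le (hL.2 _) (hL.2 _) hn)⟩
        rw [this]
        obtain ⟨hkc, rfl⟩ | ⟨hkc, rfl⟩ := hmy
        · exact iff_of_false (not_le.2 hkc) (not_not.2 hkc)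
        · exact iff_of_true (hkc.trans (hlt1 m).le) hkc.not_gt
      · exact iff_of_true le_rfl (hL.2 _)

/-- The entries of a sequence after permutation. -/
theorem ModelsRCA0.lEntry_existsUnique (h : ModelsRCA0 S) (hLS : L ∈ S) (hL : IsLinOrdOnNat L)
    (s l : M) (hs : IsSeq s l) (i : M) (hi : i < l) : ∃! x, LEntry L s i x := by
  obtain ⟨p, hp⟩ := h.exists_perm hLS hL l
  obtain ⟨k, hk⟩ := hp.1.exists_entry hi
  obtain ⟨x, hx⟩ := hs.exists_entry (hp.2.1 i k hk)
  refine ⟨x, ⟨l, p, k, hs, hp, hk, hx⟩, ?_⟩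
  rintro y ⟨l', p', k', hs', hp', hk', hy⟩
  obtain rfl := hs.length_unique hs'
  obtain rfl := h.perm_unique hL hp hp'
  obtain rfl := hp.1.unique hk hk'
  exact hs.unique hy hx

end
end SOA

namespace SOA

/-! ### The embedding of `(1 + α)^γ` into `D_L(α · 2^γ)` -/

section
variable {M : Type u} [Arith M]

/-- `j` is a left-to-right maximum, with respect to `L`, among the numbers up to `i` that are at most
`i` in the sense of `L`. -/
def IsRecord (L : Set M) (i j : M) : Prop :=
  (j < i ∨ j = i) ∧ OrdLE L j i ∧ ∀ k, k < j → OrdLE L k i → OrdLE L k j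

/-- `b` is the element of `2^γ` whose exponents are the first components of the entries of `s` at
records below `i`. -/
def IsBase (L γ : Set M) (s i b : M) : Prop :=
  Fld (twoPow γ) b ∧
    ∀ z, (∃ k, Entry b k z) ↔ ∃ j, IsRecord L i j ∧ ∃ y, Entry s j (pair z y)

/-- `t` is the image of `s` in `D_L(α · 2^γ)`, where `p` is the permutation given by `L`. -/
def IsImage (L γ α : Set M) (p s t : M) : Prop :=
  Fld (onePlusPow α γ) s ∧ ∃ n, IsSeq s n ∧ IsSeq t n ∧ IsPerm L n p ∧
    ∀ i, i < n → ∃ x y k b, Entry s i (pair x y) ∧ Entry p i k ∧ IsBase L γ s i b ∧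
      Entry t k (pair b y)

end

section
variable {f g k : Fun1.{u}} [Tm f] [Tm g] [Tm k] (X Y Z : ℕ)

instance Df.isRecord : Df (fun M _ _ V v => IsRecord (V X) (f M V v) (g M V v)) :=
  Df.subst₂ (P := fun _ _ _ V x y => IsRecord (V X) x y) <| by
    unfold IsRecord; infer_instance

instance Df.isBase :
    Df (fun M _ _ V v => IsBase (V X) (V Y) (f M V v) (g M V v) (k M V v)) :=
  Df.subst₃ (P := fun _ _ _ V s i b => IsBase (V X) (V Y) s i b) <|
    Df.congr (P := fun M _ _ V v => Fld (twoPow (V Y)) (v 2) ∧ ∀ z, z < v 0 + v 2 →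
      ((∃ k, k < v 2 ∧ Entry (v 2) k z) ↔ ∃ j, j < v 0 ∧ IsRecord (V X) (v 1) j ∧
        ∃ y, y < v 0 ∧ Entry (v 0) j (pair z y))) fun M _ _ V v => by
      have h1 : ∀ z, (∃ k, Entry (v 2) k z) ↔ ∃ k, k < v 2 ∧ Entry (v 2) k z := fun z =>
        exists_congr fun k => ⟨fun h => ⟨h.index_lt, h⟩, fun h => h.2⟩
      have h2 : ∀ z, (∃ j, IsRecord (V X) (v 1) j ∧ ∃ y, Entry (v 0) j (pair z y)) ↔
          ∃ j, j < v 0 ∧ IsRecord (V X) (v 1) j ∧ ∃ y, y < v 0 ∧ Entry (v 0) j (pair z y) :=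
        fun z => exists_congr fun j => ⟨fun ⟨hj, y, h⟩ => ⟨h.index_lt, hj, y,
          (right_le_pair _ _).trans_lt h.value_lt, h⟩, fun ⟨_, hj, y, _, h⟩ => ⟨hj, y, h⟩⟩
      refine and_congr_right fun _ => forall_congr' fun z => ?_
      rw [← h1, ← h2]
      refine ⟨fun h _ => h, fun h => ?_⟩
      by_cases hz : z < v 0 + v 2
      · exact h hz
      · refine iff_of_false ?_ ?_
        · rintro ⟨k, hk⟩
          exact hz (hk.value_lt.trans_le le_add_self)
        · rintro ⟨j, -, y, hy⟩
          exact hz (((left_le_pair _ _).trans_lt hy.value_lt).trans_le le_self_add)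

instance Df.isImage :
    Df (fun M _ _ V v => IsImage (V X) (V Y) (V Z) (f M V v) (g M V v) (k M V v)) :=
  Df.subst₃ (P := fun _ _ _ V p s t => IsImage (V X) (V Y) (V Z) p s t) <|
    Df.congr (P := fun M _ _ V v => Fld (onePlusPow (V Z) (V Y)) (v 1) ∧ ∃ n, n ≤ v 1 ∧
      IsSeq (v 1) n ∧ IsSeq (v 2) n ∧ IsPerm (V X) n (v 0) ∧
      ∀ i, i < n → ∃ x, x < v 1 ∧ ∃ y, y < v 1 ∧ ∃ k, k < v 0 ∧ ∃ b, b < v 2 ∧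
        Entry (v 1) i (pair x y) ∧ Entry (v 0) i k ∧ IsBase (V X) (V Y) (v 1) i b ∧
        Entry (v 2) k (pair b y)) fun M _ _ V v => by
      refine and_congr_right fun _ => exists_congr fun n => ?_
      constructor
      · rintro ⟨h1, h2, h3, h⟩
        refine ⟨h1.length_le, h1, h2, h3, fun i hi => ?_⟩
        obtain ⟨x, y, k, b, hs, hp, hb, ht⟩ := h i hi
        exact ⟨x, (left_le_pair _ _).trans_lt hs.value_lt, y,
          (right_le_pair _ _).trans_lt hs.value_lt, k, hp.value_lt, b,
          (left_le_pair _ _).trans_lt ht.value_lt, hs, hp, hb, ht⟩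
      · rintro ⟨-, h1, h2, h3, h⟩
        refine ⟨h1, h2, h3, fun i hi => ?_⟩
        obtain ⟨x, -, y, -, k, -, b, -, h⟩ := h i hi
        exact ⟨x, y, k, b, h⟩

end

/-- The permutation p is the unbounded witness of the `Σ⁰₁`-formula; the other quantifiers in
`IsImage` can be bounded by s, t and p. -/
theorem exists_eta_formula : ∃ θ : BFormula, ∀ (M : Type u) [Arith M] [RCA M] (L γ α : Set M),
    defGraph θ L γ α = pairs fun s t => ∃ p, IsImage L γ α p s t := by
  obtain ⟨θ, hθ⟩ := (inferInstance : Df.{u} fun M _ _ V v =>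
    IsImage (V 0) (V 1) (V 2) (v 0) (v 1) (v 2)).out
  refine ⟨θ, fun M _ _ L γ α => ?_⟩
  ext q
  exact exists_congr fun s => exists_congr fun t => and_congr_right fun _ =>
    exists_congr fun p => hθ M _ _

section
variable {M : Type u} [Arith M] [RCA M] {S : Set (Set M)} {L α β γ : Set M}
  {s s' t t' p i i' j b b' n x x' y y' : M}

theorem isRecord_self (hL : IsLinOrdOnNat L) : IsRecord L i i :=
  ⟨Or.inr rfl, hL.2 i, fun _ _ h => h⟩

theorem entry_lt_iff (hγ : IsLinOrd γ) (hs : Fld (onePlusPow α γ) s) (h : Entry s i (pair x y))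
    (h' : Entry s j (pair x' y')) : OrdLT γ x' x ↔ i < j := by
  obtain ⟨n, hs, -, hd⟩ := fld_onePlusPow.1 hs
  refine ⟨fun hlt => ?_, fun hij => hd _ _ _ _ _ _ hij h h'⟩
  obtain hij | rfl | hij := lt_trichotomy i j
  · exact hij
  · rw [(pair_inj.1 (hs.unique h h')).1] at hlt
    exact (OrdLT.irrefl hlt).elim
  · exact (OrdLT.irrefl (hγ.lt_trans hlt (hd _ _ _ _ _ _ hij h' h))).elim

theorem entry_index_inj (hs : Fld (onePlusPow α γ) s) (h : Entry s i (pair x y))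
    (h' : Entry s j (pair x y')) : i = j := by
  obtain ⟨n, hs, -, hd⟩ := fld_onePlusPow.1 hs
  obtain hij | rfl | hij := lt_trichotomy i j
  · exact (OrdLT.irrefl (hd _ _ _ _ _ _ hij h h')).elim
  · rfl
  · exact (OrdLT.irrefl (hd _ _ _ _ _ _ hij h' h)).elim

/-- Run through the indices of s and append the exponent at m whenever m is a record. The exponents
of s descend, so those of b do. -/
theorem ModelsRCA0.exists_base (h : ModelsRCA0 S) (hLS : L ∈ S) (hγS : γ ∈ S)
    (hs : Fld (onePlusPow α γ) s) (i : M) : ∃ b, IsBase L γ s i b := by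
  obtain ⟨n, hsn, hs1, hs2⟩ := fld_onePlusPow.1 hs
  have key := h.sigma_ind (fun M _ _ V v => v 1 ≤ v 2 → Fld (twoPow (V 1)) (v 0) ∧
    ∀ z, z < v 3 + v 0 → ((∃ k, k < v 0 ∧ Entry (v 0) k z) ↔ ∃ j, j < v 1 ∧ IsRecord (V 0) (v 4) j ∧
        ∃ y, y < v 3 ∧ Entry (v 3) j (pair z y)))
    (cons L (fun _ => γ)) (cons_mem hLS fun _ => hγS) (cons n (cons s (fun _ => i)))
  change (∃ b, 0 ≤ n → Fld (twoPow γ) b ∧ ∀ z, z < s + b → ((∃ k, k < b ∧ Entry b k z) ↔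
      ∃ j, j < 0 ∧ IsRecord L i j ∧ ∃ y, y < s ∧ Entry s j (pair z y))) →
    (∀ m, (∃ b, m ≤ n → Fld (twoPow γ) b ∧ ∀ z, z < s + b → ((∃ k, k < b ∧ Entry b k z) ↔
      ∃ j, j < m ∧ IsRecord L i j ∧ ∃ y, y < s ∧ Entry s j (pair z y))) →
    (∃ b, m + 1 ≤ n → Fld (twoPow γ) b ∧ ∀ z, z < s + b → ((∃ k, k < b ∧ Entry b k z) ↔
      ∃ j, j < m + 1 ∧ IsRecord L i j ∧ ∃ y, y < s ∧ Entry s j (pair z y)))) →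
    ∀ m, (∃ b, m ≤ n → Fld (twoPow γ) b ∧ ∀ z, z < s + b → ((∃ k, k < b ∧ Entry b k z) ↔
      ∃ j, j < m ∧ IsRecord L i j ∧ ∃ y, y < s ∧ Entry s j (pair z y))) at key
  have simp_iff : ∀ b m : M, (∀ z, z < s + b → ((∃ k, k < b ∧ Entry b k z) ↔
      ∃ j, j < m ∧ IsRecord L i j ∧ ∃ y, y < s ∧ Entry s j (pair z y))) ↔
      ∀ z, (∃ k, Entry b k z) ↔ ∃ j, j < m ∧ IsRecord L i j ∧ ∃ y, Entry s j (pair z y) := by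
    intro b m
    refine forall_congr' fun z => ?_
    have h1 : (∃ k, k < b ∧ Entry b k z) ↔ ∃ k, Entry b k z :=
      exists_congr fun k => ⟨fun h => h.2, fun h => ⟨h.index_lt, h⟩⟩
    have h2 : ∀ j, (∃ y, y < s ∧ Entry s j (pair z y)) ↔ ∃ y, Entry s j (pair z y) := fun j =>
      exists_congr fun y => ⟨fun h => h.2, fun h => ⟨(right_le_pair _ _).trans_lt h.value_lt, h⟩⟩
    simp only [h1, h2]
    refine ⟨fun h => ?_, fun h _ => h⟩
    by_cases hz : z < s + b
    · exact h hz
    · refine iff_of_false ?_ ?_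
      · rintro ⟨k, hk⟩
        exact hz (hk.value_lt.trans_le le_add_self)
      · rintro ⟨j, -, -, y, hy⟩
        exact hz (((left_le_pair _ _).trans_lt hy.value_lt).trans_le le_self_add)
  simp only [simp_iff] at key
  refine (key ?_ ?_ n).elim fun b hb => ?_
  rotate_left 2
  · obtain ⟨hb, hb'⟩ := hb le_rfl
    refine ⟨b, hb, fun z => (hb' z).trans ?_⟩
    exact exists_congr fun j => ⟨fun h => h.2, fun h => ⟨h.2.elim fun y hy => hsn.index_lt hy, h⟩⟩
  · obtain ⟨e, he⟩ := h.exists_empty_seq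
    have hn : ∀ i x, ¬ Entry e i x := fun i x hx => Arith.not_lt_zero _ (he.index_lt hx)
    refine ⟨e, fun _ => ⟨fld_twoPow.2 ⟨0, he, fun i x hx => (hn i x hx).elim,
      fun i j x x' _ hx => (hn i x hx).elim⟩, fun z => iff_of_false ?_ ?_⟩⟩
    · rintro ⟨k, hk⟩
      exact hn k z hk
    · rintro ⟨j, hj, -⟩
      exact Arith.not_lt_zero _ hj
  · rintro m ⟨b, hb⟩
    by_cases hmn : m + 1 ≤ n
    swap
    · exact ⟨b, fun h => (hmn h).elim⟩
    have hm := Arith.add_one_le_iff.1 hmn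
    obtain ⟨hb, hb'⟩ := hb hm.le
    obtain ⟨q, hq⟩ := hsn.exists_entry hm
    obtain ⟨x, y, rfl, hx, -⟩ := hs1 m q hq
    by_cases hr : IsRecord L i m
    · obtain ⟨l, hbl, hb1, hb2⟩ := fld_twoPow.1 hb
      obtain ⟨c, hc, hc'⟩ := h.exists_append hbl x
      refine ⟨c, fun _ => ⟨fld_twoPow.2 ⟨l + 1, hc, fun k z hz => ?_, fun k k' z z' hkk hz hz' => ?_⟩,
        fun z => ?_⟩⟩
      · obtain hz | ⟨-, rfl⟩ := (hc' k z).1 hz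
        exacts [hb1 k z hz, hx]
      · obtain hz | ⟨rfl, -⟩ := (hc' k z).1 hz
        · obtain hz' | ⟨-, rfl⟩ := (hc' k' z').1 hz'
          · exact hb2 _ _ _ _ hkk hz hz'
          · obtain ⟨j, hj, -, y', hy'⟩ := (hb' z).1 ⟨k, hz⟩
            exact hs2 _ _ _ _ _ _ hj hy' hq
        · exact ((Arith.lt_add_one_iff.1 (hc.index_lt hz')).not_gt hkk).elim
      · constructor
        · rintro ⟨k, hk⟩
          obtain hk | ⟨-, rfl⟩ := (hc' k z).1 hk
          · obtain ⟨j, hj, h⟩ := (hb' z).1 ⟨k, hk⟩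
            exact ⟨j, hj.trans (Arith.lt_add_one_iff.2 le_rfl), h⟩
          · exact ⟨m, Arith.lt_add_one_iff.2 le_rfl, hr, y, hq⟩
        · rintro ⟨j, hj, hjr, y', hy'⟩
          obtain hj | rfl := Arith.lt_succ.1 hj
          · obtain ⟨k, hk⟩ := (hb' z).2 ⟨j, hj, hjr, y', hy'⟩
            exact ⟨k, (hc' _ _).2 (Or.inl hk)⟩
          · exact ⟨l, (hc' _ _).2 (Or.inr ⟨rfl, (pair_inj.1 (hsn.unique hy' hq)).1⟩)⟩
    · refine ⟨b, fun _ => ⟨hb, fun z => (hb' z).trans (exists_congr fun j => and_congr_left fun hj => ?_)⟩⟩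
      rw [Arith.lt_add_one_iff]
      refine ⟨le_of_lt, fun hle => lt_of_le_of_ne hle ?_⟩
      rintro rfl
      exact hr hj.1

/-- Whether j is a record does not depend on s, so only the first components up to index i matter.
This is used both for lexicographic comparison and for naturality. -/
theorem IsBase.eq_of_agree (hγ : IsLinOrd γ) (hb : IsBase L γ s i b) (hb' : IsBase L γ s' i b')
    (h : ∀ j, j ≤ i → ∀ z, (∃ y, Entry s j (pair z y)) ↔ ∃ y, Entry s' j (pair z y)) : b = b' :=
  twoPow_ext hγ hb.1 hb'.1 fun w => by
    rw [hb.2, hb'.2]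
    exact exists_congr fun j => and_congr_right fun hj => h j hj.1 w

theorem IsBase.unique (hγ : IsLinOrd γ) (hb : IsBase L γ s i b) (hb' : IsBase L γ s i b') :
    b = b' := hb.eq_of_agree hγ hb' fun _ _ _ => Iff.rfl

/-- As j is a record of itself, its exponent always occurs. The larger exponent `x'` is thus in `b'`
but not in b, and the exponents above it come from the common entries before j. -/
theorem IsBase.lt_of_entry_lt (hγ : IsLinOrd γ) (hL : IsLinOrdOnNat L)
    (hs : Fld (onePlusPow α γ) s) (hs' : Fld (onePlusPow α γ) s') (hb : IsBase L γ s j b)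
    (hb' : IsBase L γ s' j b') (hag : ∀ i, i < j → ∃ q, Entry s i q ∧ Entry s' i q)
    (hx : Entry s j (pair x y)) (hx' : Entry s' j (pair x' y')) (hlt : OrdLT γ x x') :
    OrdLT (twoPow γ) b b' := by
  obtain ⟨n, hsn, -⟩ := fld_onePlusPow.1 hs
  obtain ⟨n', hsn', -⟩ := fld_onePlusPow.1 hs'
  have hagree : ∀ i q, i < j → (Entry s i q ↔ Entry s' i q) := fun i q hi => by
    obtain ⟨r, hr, hr'⟩ := hag i hi
    exact ⟨fun h => hsn.unique hr h ▸ hr', fun h => hsn'.unique hr' h ▸ hr⟩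
  refine twoPow_lt_of_range hγ hb.1 hb'.1 (z := x') ?_ ?_ fun w hw => ?_
  · exact (hb'.2 x').2 ⟨j, isRecord_self hL, y', hx'⟩
  · intro k hk
    obtain ⟨m, ⟨hm | rfl, -⟩, y₁, hy₁⟩ := (hb.2 x').1 ⟨k, hk⟩
    · exact hm.ne (entry_index_inj hs' ((hagree _ _ hm).1 hy₁) hx')
    · rw [(pair_inj.1 (hsn.unique hx hy₁)).1] at hlt
      exact OrdLT.irrefl hlt
  · rw [hb.2, hb'.2]
    refine exists_congr fun m => and_congr_right fun hm => ?_
    obtain ⟨hm | rfl, -⟩ := hm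
    · simp only [hagree _ _ hm]
    · refine iff_of_false ?_ ?_
      · rintro ⟨y₁, hy₁⟩
        rw [(pair_inj.1 (hsn.unique hx hy₁)).1] at hlt
        exact OrdLT.irrefl (hγ.lt_trans hw hlt)
      · rintro ⟨y₁, hy₁⟩
        rw [(pair_inj.1 (hsn'.unique hx' hy₁)).1] at hw
        exact OrdLT.irrefl hw

/-- The reason for using records: the least j with `i <_L j ≤_L i'` contributes its exponent to `b'`
only, and all larger exponents are shared. -/
theorem ModelsRCA0.base_lt (h : ModelsRCA0 S) (hLS : L ∈ S) (hγ : IsLinOrd γ)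
    (hL : IsLinOrdOnNat L) (hs : Fld (onePlusPow α γ) s) (hb : IsBase L γ s i b)
    (hb' : IsBase L γ s i' b') (hx : Entry s i' (pair x y)) (hlt : OrdLT L i i') :
    OrdLT (twoPow γ) b b' := by
  obtain ⟨n, hsn, hs1, -⟩ := fld_onePlusPow.1 hs
  obtain ⟨j, ⟨hji, hij, hji'⟩, hmin⟩ := h.exists_least
    (fun M _ _ V v => v 0 ≤ v 2 ∧ OrdLT (V 0) (v 1) (v 0) ∧ OrdLE (V 0) (v 0) (v 2)) (fun _ => L)
    (fun _ => hLS) (cons i (fun _ => i')) i' ⟨le_rfl, hlt, hL.2 i'⟩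
  change j ≤ i' at hji
  change OrdLT L i j at hij
  change OrdLE L j i' at hji'
  change ∀ c, c < j → ¬ (c ≤ i' ∧ OrdLT L i c ∧ OrdLE L c i') at hmin
  replace hmin : ∀ c, c < j → OrdLE L c i' → OrdLE L c i := fun c hc hci => by
    by_contra hn
    exact hmin c hc ⟨hc.le.trans hji, hL.1.lt_of_not_le (hL.2 _) (hL.2 _) hn, hci⟩
  have hjr : IsRecord L i' j :=
    ⟨hji.lt_or_eq, hji', fun k hk hki => hL.1.trans _ _ _ (hmin k hk hki) hij.1⟩
  have hrec : ∀ m, m < j → (IsRecord L i m ↔ IsRecord L i' m) := fun m hm => by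
    constructor
    · rintro ⟨-, h2, h3⟩
      exact ⟨Or.inl (hm.trans_le hji), hL.1.trans _ _ _ h2 hlt.1,
        fun k hk hki => h3 k hk (hmin k (hk.trans hm) hki)⟩
    · rintro ⟨-, h2, h3⟩
      have h2 := hmin m hm h2
      refine ⟨?_, h2, fun k hk hki => h3 k hk (hL.1.trans _ _ _ hki hlt.1)⟩
      by_contra hn
      -- If m came after i, then i would be an earlier competitor of the record m, whence `i ≤_L m
      -- ≤_L i` and `i = m`.
      have him : i < m := not_le.1 hn
      exact him.ne (hL.1.antisymm _ _ (h3 i him hlt.1) h2)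
  obtain ⟨q, hq⟩ := hsn.exists_entry (hji.trans_lt (hsn.index_lt hx))
  obtain ⟨z, w, rfl, -⟩ := hs1 j q hq
  refine twoPow_lt_of_range hγ hb.1 hb'.1 (z := z) ?_ ?_ fun u hu => ?_
  · exact (hb'.2 z).2 ⟨j, hjr, w, hq⟩
  · intro k hk
    obtain ⟨m, hm, y₁, hy₁⟩ := (hb.2 z).1 ⟨k, hk⟩
    obtain rfl := entry_index_inj hs hy₁ hq
    exact hL.1.not_le_of_lt hij hm.2.1
  · rw [hb.2, hb'.2]
    constructor
    · rintro ⟨m, hm, y₁, hy₁⟩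
      exact ⟨m, (hrec m ((entry_lt_iff hγ hs hy₁ hq).1 hu)).1 hm, y₁, hy₁⟩
    · rintro ⟨m, hm, y₁, hy₁⟩
      exact ⟨m, (hrec m ((entry_lt_iff hγ hs hy₁ hq).1 hu)).2 hm, y₁, hy₁⟩

namespace IsImage

theorem entry (hγ : IsLinOrd γ) (h : IsImage L γ α p s t) (hx : Entry s i (pair x y))
    (hk : Entry p i j) (hb : IsBase L γ s i b) : Entry t j (pair b y) := by
  obtain ⟨-, n, hs, ht, hp, hst⟩ := h
  obtain ⟨x', y', k', b', hx', hk', hb', h⟩ := hst i (hs.index_lt hx)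
  rwa [hp.1.unique hk hk', (pair_inj.1 (hs.unique hx hx')).2, hb.unique hγ hb']

theorem exists_of_entry (h : IsImage L γ α p s t) (hz : Entry t j x) :
    ∃ i a y b, Entry s i (pair a y) ∧ Entry p i j ∧ IsBase L γ s i b ∧ x = pair b y := by
  obtain ⟨-, n, hs, ht, hp, hst⟩ := h
  obtain ⟨i, hi⟩ := hp.2.2.1 j (ht.index_lt hz)
  obtain ⟨a, y, k, b, hx, hk, hb, h⟩ := hst i (hp.1.index_lt hi)
  obtain rfl := hp.1.unique hi hk
  exact ⟨i, a, y, b, hx, hi, hb, ht.unique hz h⟩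

/-- The permutation in the definition of the image cancels the one in `D_L`: in priority order,
entry i of the image belongs to entry i of s. -/
theorem lEntry (hγ : IsLinOrd γ) (h : IsImage L γ α p s t) (hx : Entry s i (pair x y))
    (hb : IsBase L γ s i b) : LEntry L t i (pair b y) := by
  have h' := h
  obtain ⟨-, n, hs, ht, hp, hst⟩ := h'
  obtain ⟨k, hk⟩ := hp.1.exists_entry (hs.index_lt hx)
  exact ⟨n, p, k, ht, hp, hk, h.entry hγ hx hk hb⟩

end IsImage

theorem ModelsRCA0.exists_image (h : ModelsRCA0 S) (hLS : L ∈ S) (hγS : γ ∈ S)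
    (hL : IsLinOrdOnNat L) (hs : Fld (onePlusPow α γ) s) : ∃ p t, IsImage L γ α p s t := by
  obtain ⟨n, hsn, hs1, -⟩ := fld_onePlusPow.1 hs
  obtain ⟨p, hp⟩ := h.exists_perm hLS hL n
  have hX := h.comp₂ (fun M _ _ V v => ∃ i, i < v 2 ∧ Entry (v 2) i (v 0) ∧ ∃ x, x < v 3 ∧
    ∃ y, y < v 3 ∧ ∃ b, b ≤ v 1 ∧ Entry (v 3) i (pair x y) ∧ IsBase (V 0) (V 1) (v 3) i b ∧
      v 1 = pair b y) (cons L (fun _ => γ)) (cons_mem hLS fun _ => hγS) (cons p (fun _ => s))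
  change pairs (fun k z => ∃ i, i < p ∧ Entry p i k ∧ ∃ x, x < s ∧ ∃ y, y < s ∧ ∃ b, b ≤ z ∧
    Entry s i (pair x y) ∧ IsBase L γ s i b ∧ z = pair b y) ∈ S at hX
  obtain ⟨t, ht, ht'⟩ := h.exists_seq_choice hX (l := n) (fun k hk => by
    obtain ⟨i, hi⟩ := hp.2.2.1 k hk
    obtain ⟨q, hq⟩ := hsn.exists_entry (hp.1.index_lt hi)
    obtain ⟨x, y, rfl, -⟩ := hs1 i q hq
    obtain ⟨b, hb⟩ := h.exists_base hLS hγS hs i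
    exact ⟨pair b y, pair_mem_pairs.2 ⟨i, hi.index_lt, hi, x,
      (left_le_pair _ _).trans_lt hq.value_lt, y, (right_le_pair _ _).trans_lt hq.value_lt, b,
      left_le_pair _ _, hq, hb, rfl⟩⟩)
  refine ⟨p, t, hs, n, hsn, ht, hp, fun i hi => ?_⟩
  obtain ⟨k, hk⟩ := hp.1.exists_entry hi
  obtain ⟨z, hz⟩ := ht.exists_entry (hp.2.1 i k hk)
  obtain ⟨i', -, hi', x, -, y, -, b, -, hx, hb, rfl⟩ := pair_mem_pairs.1 (ht' k z hz)
  obtain rfl := hp.inj hL hk hi'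
  exact ⟨x, y, k, b, hx, hk, hb, hz⟩

theorem ModelsRCA0.image_unique (h : ModelsRCA0 S) (hγ : IsLinOrd γ) (hL : IsLinOrdOnNat L)
    {p p' : M} (ht : IsImage L γ α p s t) (ht' : IsImage L γ α p' s t') : t = t' := by
  have hi := ht
  have hi' := ht'
  obtain ⟨-, n, hs, ht, hp, -⟩ := ht
  obtain ⟨-, n', hs', ht', hp', -⟩ := ht'
  obtain rfl := hs.length_unique hs'
  obtain rfl := h.perm_unique hL hp hp'
  refine ht.ext ht' fun k hk => ?_
  obtain ⟨z, hz⟩ := ht.exists_entry hk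
  obtain ⟨i, a, y, b, hx, hk, hb, rfl⟩ := hi.exists_of_entry hz
  exact ⟨_, hz, hi'.entry hγ hx hk hb⟩

/-- There is exactly one permutation for each length, so "some p" may be replaced by "every p that
is the permutation", which gives the `Π⁰₁` form. -/
theorem ModelsRCA0.eta_mem (h : ModelsRCA0 S) (hLS : L ∈ S) (hγS : γ ∈ S) (hαS : α ∈ S)
    (hγ : IsLinOrd γ) (hL : IsLinOrdOnNat L) :
    (pairs fun s t => ∃ p, IsImage L γ α p s t) ∈ S := by
  have key := h.delta_comp
    (fun M _ _ V v => ∃ s t, v 1 = pair s t ∧ IsImage (V 0) (V 1) (V 2) (v 0) s t)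
    (fun M _ _ V v => ∃ s t, v 1 = pair s t ∧ Fld (onePlusPow (V 2) (V 1)) s ∧
      ∀ n, n ≤ s → IsSeq s n → IsPerm (V 0) n (v 0) → IsImage (V 0) (V 1) (V 2) (v 0) s t)
    (cons L (cons γ (fun _ => α))) (cons_mem hLS (cons_mem hγS fun _ => hαS)) (fun _ => 0)
    (fun q => by
      change (∃ p s t, q = pair s t ∧ IsImage L γ α p s t) ↔ ∀ p, ∃ s t, q = pair s t ∧
        Fld (onePlusPow α γ) s ∧ ∀ n, n ≤ s → IsSeq s n → IsPerm L n p → IsImage L γ α p s t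
      constructor
      · rintro ⟨p, s, t, rfl, hi⟩ p'
        refine ⟨s, t, rfl, hi.1, fun n _ hs hp' => ?_⟩
        obtain ⟨-, n', hs', -, hp, -⟩ := id hi
        obtain rfl := hs.length_unique hs'
        rwa [h.perm_unique hL hp' hp]
      · intro hq
        obtain ⟨s, t, rfl, hs, -⟩ := hq 0
        obtain ⟨n, hsn, -⟩ := fld_onePlusPow.1 hs
        obtain ⟨p, hp⟩ := h.exists_perm hLS hL n
        obtain ⟨s', t', e, -, hst⟩ := hq p
        obtain ⟨rfl, rfl⟩ := pair_inj.1 e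
        exact ⟨p, s, t, rfl, hst n hsn.length_le hsn hp⟩)
  convert key using 1
  ext q
  constructor
  · rintro ⟨s, t, e, p, hi⟩
    exact ⟨p, s, t, e, hi⟩
  · rintro ⟨p, s, t, e, hi⟩
    exact ⟨s, t, e, p, hi⟩

/-! ### The embedding and its naturality -/

theorem fld_DL {δ : Set M} : Fld (DL L δ) s ↔ ∃ l, IsSeq s l ∧ (∀ i x, Entry s i x → Fld δ x) ∧
    ∀ i j x x', i < j → Entry s i x → Entry s j x' → OrdLT δ x x' := fld_mkOrd

theorem ModelsRCA0.ordLT_DL (h : ModelsRCA0 S) (hLS : L ∈ S) (hL : IsLinOrdOnNat L) {δ : Set M} :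
    OrdLT (DL L δ) s t ↔ Fld (DL L δ) s ∧ Fld (DL L δ) t ∧ LexLT (LEntry L) (OrdLT δ) s t :=
  (ordLT_mkOrd fun _ => LexLT.irrefl (h.lEntry_existsUnique hLS hL) fun _ => OrdLT.irrefl).trans
    (by rw [fld_DL, fld_DL])

theorem ModelsRCA0.image_fld (h : ModelsRCA0 S) (hLS : L ∈ S) (hγ : IsLinOrd γ)
    (hL : IsLinOrdOnNat L) (hi : IsImage L γ α p s t) :
    Fld (DL L (prodOrd α (twoPow γ))) t := by
  obtain ⟨hs, n, hsn, htn, hp, -⟩ := id hi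
  obtain ⟨-, -, hs1, hs2⟩ := fld_onePlusPow.1 hs
  have hval : ∀ k z, Entry t k z → Fld (prodOrd α (twoPow γ)) z := fun k z hz => by
    obtain ⟨i, x, y, b, hx, -, hb, rfl⟩ := hi.exists_of_entry hz
    obtain ⟨x', y', e, -, hy⟩ := hs1 i _ hx
    rw [← (pair_inj.1 e).2] at hy
    exact fld_prodOrd.2 ⟨hb.1, hy⟩
  refine fld_DL.2 ⟨n, htn, hval, fun k k' z z' hkk hz hz' => ?_⟩
  refine ordLT_prodOrd.2 ⟨hval k z hz, hval k' z' hz', ?_⟩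
  obtain ⟨i, x, y, b, hx, hk, hb, rfl⟩ := hi.exists_of_entry hz
  obtain ⟨i', x', y', b', hx', hk', hb', rfl⟩ := hi.exists_of_entry hz'
  exact prodLT_pair.2 (Or.inr (h.base_lt hLS hγ hL hs hb hb' hx' ((hp.lt_iff hL hk hk').1 hkk)))

/-- Equal entries before j give equal bases before j. At j, a smaller exponent gives a smaller base;
an equal exponent gives the same base, and then the α-components decide. Lengths are preserved,
which settles proper initial segments. -/
theorem ModelsRCA0.image_lt (h : ModelsRCA0 S) (hLS : L ∈ S) (hγS : γ ∈ S) (hγ : IsLinOrd γ)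
    (hL : IsLinOrdOnNat L) {p p' : M} (hi : IsImage L γ α p s t) (hi' : IsImage L γ α p' s' t')
    (hlt : OrdLT (onePlusPow α γ) s s') : OrdLT (DL L (prodOrd α (twoPow γ))) t t' := by
  refine (h.ordLT_DL hLS hL).2 ⟨h.image_fld hLS hγ hL hi, h.image_fld hLS hγ hL hi', ?_⟩
  obtain ⟨hs, hs', k, l, hsk, hsl, hlt⟩ := ordLT_onePlusPow.1 hlt
  obtain ⟨-, -, hs1, hs2⟩ := fld_onePlusPow.1 hs
  obtain ⟨-, -, hs1', hs2'⟩ := fld_onePlusPow.1 hs'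
  obtain ⟨-, n, hsn, htn, -, -⟩ := id hi
  obtain ⟨-, n', hsn', htn', -, -⟩ := id hi'
  obtain rfl := hsk.length_unique hsn
  obtain rfl := hsl.length_unique hsn'
  have agree : ∀ j, (∀ i, i < j → ∃ q, Entry s i q ∧ Entry s' i q) → ∀ i, i < j →
      ∃ z, LEntry L t i z ∧ LEntry L t' i z := fun j hag i hij => by
    obtain ⟨q, hq, hq'⟩ := hag i hij
    obtain ⟨x, y, rfl, -⟩ := hs1 i q hq
    obtain ⟨b, hb⟩ := h.exists_base hLS hγS hs i
    obtain ⟨b', hb'⟩ := h.exists_base hLS hγS hs' i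
    obtain rfl := hb.eq_of_agree hγ hb' fun m hm z => exists_congr fun w => by
      obtain ⟨r, hr, hr'⟩ := hag m (hm.trans_lt hij)
      exact ⟨fun h => hsk.unique hr h ▸ hr', fun h => hsl.unique hr' h ▸ hr⟩
    exact ⟨_, hi.lEntry hγ hq hb, hi'.lEntry hγ hq' hb'⟩
  refine ⟨k, l, htn, htn', ?_⟩
  obtain ⟨j, hjk, hjl, ⟨q, q', hq, hq', hqq⟩, hag⟩ | ⟨hkl, hag⟩ := hlt
  · refine Or.inl ⟨j, hjk, hjl, ?_, agree j hag⟩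
    obtain ⟨x, y, x', y', rfl, rfl, hlt⟩ := hqq
    obtain ⟨b, hb⟩ := h.exists_base hLS hγS hs j
    obtain ⟨b', hb'⟩ := h.exists_base hLS hγS hs' j
    obtain ⟨_, _, e, -, hy⟩ := hs1 j _ hq
    rw [← (pair_inj.1 e).2] at hy
    obtain ⟨_, _, e, -, hy'⟩ := hs1' j _ hq'
    rw [← (pair_inj.1 e).2] at hy'
    refine ⟨_, _, hi.lEntry hγ hq hb, hi'.lEntry hγ hq' hb', ordLT_prodOrd.2
      ⟨fld_prodOrd.2 ⟨hb.1, hy⟩, fld_prodOrd.2 ⟨hb'.1, hy'⟩, prodLT_pair.2 ?_⟩⟩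
    obtain ⟨rfl, hlt⟩ | hlt := hlt
    · refine Or.inl ⟨hb.eq_of_agree hγ hb' fun m hm z => ?_, hlt⟩
      obtain hm | rfl := hm.lt_or_eq
      · refine exists_congr fun w => ?_
        obtain ⟨r, hr, hr'⟩ := hag m hm
        exact ⟨fun h => hsk.unique hr h ▸ hr', fun h => hsl.unique hr' h ▸ hr⟩
      · constructor
        · rintro ⟨w, hw⟩
          rw [(pair_inj.1 (hsk.unique hw hq)).1]
          exact ⟨_, hq'⟩
        · rintro ⟨w, hw⟩
          rw [(pair_inj.1 (hsl.unique hw hq')).1]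
          exact ⟨_, hq⟩
    · exact Or.inr (hb.lt_of_entry_lt hγ hL hs hs' hb' hag hq hq' hlt)
  · exact Or.inr ⟨hkl, agree k hag⟩

/-- Since the source is linear, strict monotonicity suffices. For the target one only needs that
lexicographic comparison is irreflexive and transitive. -/
theorem ModelsRCA0.isEmb_eta (h : ModelsRCA0 S) (hLS : L ∈ S) (hγS : γ ∈ S) (hγ : IsLinOrd γ)
    (hα : IsLinOrd α) (hL : IsLinOrdOnNat L) :
    IsEmb (pairs fun s t => ∃ p, IsImage L γ α p s t) (onePlusPow α γ)
      (DL L (prodOrd α (twoPow γ))) where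
  pairs := by
    rintro _ ⟨s, t, rfl, p, hi⟩
    exact ⟨s, t, rfl, hi.1, h.image_fld hLS hγ hL hi⟩
  func s hs := by
    obtain ⟨p, t, hi⟩ := h.exists_image hLS hγS hL hs
    refine ⟨t, pair_mem_pairs.2 ⟨p, hi⟩, fun t' ht' => ?_⟩
    obtain ⟨p', hi'⟩ := pair_mem_pairs.1 ht'
    exact h.image_unique hγ hL hi' hi
  le_iff s s' t t' ht ht' := by
    obtain ⟨p, hi⟩ := pair_mem_pairs.1 ht
    obtain ⟨p', hi'⟩ := pair_mem_pairs.1 ht'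
    have hlin := isLinOrd_onePlusPow hα hγ
    have hent := h.lEntry_existsUnique hLS hL
    have hδ := isLinOrd_prodOrd hα (isLinOrd_twoPow hγ)
    obtain hlt | rfl | hlt := hlin.trichotomy hi.1 hi'.1
    · exact iff_of_true hlt.1 (h.image_lt hLS hγS hγ hL hi hi' hlt).1
    · rw [h.image_unique hγ hL hi hi']
      exact iff_of_true hi.1 (h.image_fld hLS hγ hL hi')
    · refine iff_of_false (hlin.not_le_of_lt hlt) fun hle => ?_
      have hlt' := h.image_lt hLS hγS hγ hL hi' hi hlt
      by_cases e : t = t'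
      · exact hlt'.2 e.symm
      · exact LexLT.irrefl hent (fun _ => OrdLT.irrefl)
          (LexLT.trans hent (fun _ _ _ => hδ.lt_trans)
            ((h.ordLT_DL hLS hL).1 hlt').2.2 ((h.ordLT_DL hLS hL).1 ⟨hle, e⟩).2.2)

theorem ModelsRCA0.eta_natural (h : ModelsRCA0 S) (hLS : L ∈ S) (hγS : γ ∈ S) {F : Set M}
    (hFS : F ∈ S) (hγ : IsLinOrd γ) (hL : IsLinOrdOnNat L) (hF : IsEmb F α β)
    (hs : Fld (onePlusPow α γ) s) : ∃ s' t t',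
      pair s s' ∈ onePlusPowMap α γ F ∧
      pair s' t' ∈ (pairs fun s t => ∃ p, IsImage L γ β p s t) ∧
      pair s t ∈ (pairs fun s t => ∃ p, IsImage L γ α p s t) ∧
      pair t t' ∈ DLMap L (prodOrd α (twoPow γ)) (prodMap F (twoPow γ)) := by
  obtain ⟨n, hsn, hs1, hs2⟩ := fld_onePlusPow.1 hs
  have hX := h.comp₂ (fun M _ _ V v => ∃ x y, v 1 = pair x y ∧ ∃ w, w < v 2 ∧
    Entry (v 2) (v 0) (pair x w) ∧ pair w y ∈ V 0) (fun _ => F) (fun _ => hFS) (fun _ => s)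
  change pairs (fun i z => ∃ x y, z = pair x y ∧ ∃ w, w < s ∧
    Entry s i (pair x w) ∧ pair w y ∈ F) ∈ S at hX
  obtain ⟨s', hsn', hs'⟩ := h.exists_seq_choice hX (l := n) (fun i hi => by
    obtain ⟨q, hq⟩ := hsn.exists_entry hi
    obtain ⟨x, w, rfl, -, hw⟩ := hs1 i q hq
    obtain ⟨y, hy⟩ := (hF.func w hw).exists
    exact ⟨pair x y, pair_mem_pairs.2 ⟨x, y, rfl, w,
      (right_le_pair _ _).trans_lt hq.value_lt, hq, hy⟩⟩)
  replace hs' : ∀ i z, Entry s' i z → ∃ x y w, z = pair x y ∧ Entry s i (pair x w) ∧ pair w y ∈ F :=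
    fun i z hz => by
      obtain ⟨x, y, e, w, -, h⟩ := pair_mem_pairs.1 (hs' i z hz)
      exact ⟨x, y, w, e, h⟩
  have hmap : ∀ i x w, Entry s i (pair x w) → ∃ y, Entry s' i (pair x y) ∧ pair w y ∈ F := by
    intro i x w hx
    obtain ⟨z, hz⟩ := hsn'.exists_entry (hsn.index_lt hx)
    obtain ⟨x', y, w', rfl, hx', hy⟩ := hs' i z hz
    obtain ⟨rfl, rfl⟩ := pair_inj.1 (hsn.unique hx hx')
    exact ⟨y, hz, hy⟩
  have hfld : Fld (onePlusPow β γ) s' := by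
    refine fld_onePlusPow.2 ⟨n, hsn', fun i z hz => ?_, fun i j x y x' y' hij hx hx' => ?_⟩
    · obtain ⟨x, y, w, rfl, hx, hy⟩ := hs' i z hz
      obtain ⟨_, _, e, hxγ, -⟩ := hs1 i _ hx
      obtain ⟨_, _, e', -, hyβ⟩ := hF.pairs _ hy
      rw [(pair_inj.1 e).1, (pair_inj.1 e').2]
      exact ⟨_, _, rfl, hxγ, hyβ⟩
    · obtain ⟨_, _, w, e, hw, -⟩ := hs' i _ hx
      obtain ⟨_, _, w', e', hw', -⟩ := hs' j _ hx'
      rw [(pair_inj.1 e).1, (pair_inj.1 e').1]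
      exact hs2 _ _ _ _ _ _ hij hw hw'
  obtain ⟨p, t, hi⟩ := h.exists_image hLS hγS hL hs
  obtain ⟨p', t', hi'⟩ := h.exists_image hLS hγS hL hfld
  refine ⟨s', t, t', ⟨s, s', rfl, hs, n, hsn, hsn', fun i q hq => ?_⟩, pair_mem_pairs.2 ⟨p', hi'⟩,
    pair_mem_pairs.2 ⟨p, hi⟩, t, t', rfl, h.image_fld hLS hγ hL hi, ?_⟩
  · obtain ⟨x, w, rfl, hx, -⟩ := hs1 i q hq
    obtain ⟨y, hy, hwy⟩ := hmap i x w hq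
    exact ⟨_, ⟨x, w, y, rfl, hx, hwy⟩, hy⟩
  · obtain ⟨-, n₁, hsn₁, htn, hp, -⟩ := id hi
    obtain ⟨-, n₂, hsn₂, htn', hp', -⟩ := id hi'
    obtain rfl := hsn.length_unique hsn₁
    obtain rfl := hsn'.length_unique hsn₂
    obtain rfl := h.perm_unique hL hp hp'
    refine ⟨n, htn, htn', fun k z hz => ?_⟩
    obtain ⟨i, x, w, b, hx, hk, hb, rfl⟩ := hi.exists_of_entry hz
    obtain ⟨y, hy, hwy⟩ := hmap i x w hx
    obtain ⟨b', hb'⟩ := h.exists_base hLS hγS hfld i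
    -- Applying f changes only second components, so s and its image under `(1+f)^γ` have the same
    -- bases.
    obtain rfl := hb.eq_of_agree hγ hb' fun m hm z => by
      constructor
      · rintro ⟨y, hy⟩
        obtain ⟨y', hy', -⟩ := hmap _ _ _ hy
        exact ⟨y', hy'⟩
      · rintro ⟨y, hy⟩
        obtain ⟨_, _, w, e, hw, -⟩ := hs' _ _ hy
        rw [(pair_inj.1 e).1]
        exact ⟨w, hw⟩
    exact ⟨_, ⟨b, w, y, rfl, hb.1, hwy⟩, hi'.entry hγ hy hk hb'⟩

theorem ModelsRCA0.isNatFamily {θ : BFormula} (hθ : ∀ α : Set M,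
    defGraph θ L γ α = pairs fun s t => ∃ p, IsImage L γ α p s t) (h : ModelsRCA0 S) (hLS : L ∈ S)
    (hγS : γ ∈ S) (hL : IsLinOrdOnNat L) (hγ : IsLinOrd γ) : IsNatFamily S θ L γ where
  mem α hαS hα := by
    rw [hθ]
    exact h.eta_mem hLS hγS hαS hγ hL
  emb α hαS hα := by
    rw [hθ]
    exact h.isEmb_eta hLS hγS hγ hα hL
  natural α hα β hβ F hF hα' hβ' hF' s hs := by
    rw [hθ, hθ]
    exact h.eta_natural hLS hγS hF hγ hL hF' hs

end
end SOA

namespace SOA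

/-! ### Well-foundedness of `(1 + α)^γ` -/

section
variable {M : Type u} [Arith M] [RCA M] {S : Set (Set M)} {L α γ : Set M}

/-- The order `α·2^γ` is a well order to which the dilator applies. Composing a descending sequence
with the embedding, which exists as a set, would give a descent in `D_L(α·2^γ)`. -/
theorem ModelsRCA0.wellFdd_onePlusPow (h : ModelsRCA0 S) (hLS : L ∈ S) (hL : IsLinOrdOnNat L)
    (hD : DLIsDilator S L) (hγS : γ ∈ S) (hγ : IsLinOrd γ) (wγ : WellFdd S (twoPow γ))
    (hαS : α ∈ S) (hα : IsWellOrd S α) : WellFdd S (onePlusPow α γ) := by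
  have h2S := h.twoPow_mem hγS
  have h2 := isLinOrd_twoPow hγ
  have wD := hD _ (h.prodOrd_mem hαS h2S)
    ⟨isLinOrd_prodOrd hα.1 h2, h.wellFdd_prodOrd hαS h2S h2 hα.2 wγ⟩
  rintro ⟨F, hFS, hF, hdesc⟩
  have hfld : ∀ n s, pair n s ∈ F → Fld (onePlusPow α γ) s := fun n s hs => by
    obtain ⟨t, ht⟩ := (hF.2 (n + 1)).exists
    exact (ordLT_onePlusPow.1 (hdesc n s t hs ht)).2.1
  have emb := h.isEmb_eta hLS hγS hγ hα.1 hL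
  obtain ⟨G, hGS, hG, hGF⟩ := h.exists_fun_comp hFS (h.eta_mem hLS hγS hαS hγ hL) hF
    fun n s hs => emb.func s (hfld n s hs)
  refine wD ⟨G, hGS, hG, fun n t t' ht ht' => ?_⟩
  obtain ⟨s, hs, hst⟩ := (hGF _ _).1 ht
  obtain ⟨s', hs', hst'⟩ := (hGF _ _).1 ht'
  obtain ⟨p, hi⟩ := pair_mem_pairs.1 hst
  obtain ⟨p', hi'⟩ := pair_mem_pairs.1 hst'
  exact h.image_lt hLS hγS hγ hL hi' hi (hdesc n s s' hs hs')

end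

/-! ### Approximations to a failure of induction -/

section
variable {M : Type u} [Arith M]

/-- `e` has been refuted before stage `s`. -/
def Dead (Ψ : Set M) (e s : M) : Prop := ∃ n, n < s ∧ pair e n ∈ Ψ

/-- The first component of `e'` is smaller than the one of `e`. -/
def Below (γ : Set M) (e' e : M) : Prop :=
  ∃ x' m', e' = pair x' m' ∧ ∃ x m, e = pair x m ∧ OrdLT γ x' x

/-- `e` is alive at stage `s`, and all numbers with successor below `c` that are possible successors
of `e` have been refuted. -/
def StageOK (γ Ψ : Set M) (e c s : M) : Prop :=
  (∃ x m, e = pair x m ∧ Fld γ x) ∧ ¬ Dead Ψ e s ∧ (c < s ∨ c = s) ∧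
    ∀ e', e' < c → e' + 1 < c → Below γ e' e → Dead Ψ e' s

def StageDom (γ Ψ : Set M) (y : M) : Prop :=
  ∃ e d, y = pair e d ∧ ∃ c s, d = pair c s ∧ StageOK γ Ψ e c s

/-- The comparison of counters is reversed, so advancing the search for a successor of e means
descending. The stage s only breaks ties. -/
def StageLT (y y' : M) : Prop :=
  ∃ e d, y = pair e d ∧ ∃ c s, d = pair c s ∧ ∃ e' d', y' = pair e' d' ∧ ∃ c' s', d' = pair c' s' ∧
    (e < e' ∨ e = e' ∧ (c' < c ∨ c = c' ∧ s < s'))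

/-- The order of stages. -/
def stageOrd (γ Ψ : Set M) : Set M := mkOrd (StageDom γ Ψ) StageLT

/-- The condition on the entry at position `i` in the approximation `σ` of length `k + 1` at stage
`s`. -/
def ApproxAt (γ Ψ : Set M) (e₀ s σ k i : M) : Prop :=
  ∃ q, Entry σ i q ∧ ∃ x y, q = pair x y ∧ ∃ e d, y = pair e d ∧ ∃ c r, d = pair c r ∧
    (∃ x' m, e = pair x' m ∧ x' = x) ∧ (c < s ∨ c = s) ∧ (r < s ∨ r = s) ∧ (i = 0 → e = e₀) ∧
    (i < k → ∃ q', Entry σ (i + 1) q' ∧ ∃ x' y', q' = pair x' y' ∧ ∃ e' d', y' = pair e' d' ∧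
      c = e' + 1) ∧
    (i = k → ∀ e', e' < c → Below γ e' e → Dead Ψ e' s)

/-- `σ` is an approximation at stage `s` of a descending sequence of counterexamples. -/
def Approx (γ Ψ α : Set M) (e₀ s σ : M) : Prop :=
  Fld (onePlusPow α γ) σ ∧ ∃ k, IsSeq σ (k + 1) ∧ ∀ i, i < k + 1 → ApproxAt γ Ψ e₀ s σ k i

end

section
variable {f g k : Fun1.{u}} [Tm f] [Tm g] [Tm k] (X Y Z : ℕ)

instance Df.exists_entry
    {R : ∀ (M : Type u) [Arith M] [RCA M], M → (ℕ → Set M) → (ℕ → M) → Prop}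
    [hR : Df (fun M _ _ V v => R M (v 0) V (fun i => v (i + 1)))] :
    Df (fun M _ _ V v => ∃ q, Entry (f M V v) (g M V v) q ∧ R M q V v) := by
  have shift : ∀ f : Fun1.{u}, Tm f → Tm (fun M _ _ V v => f M V (fun i => v (i + 1))) := by
    intro f hf
    obtain ⟨t, ht⟩ := hf.out
    refine ⟨t.subst fun i => .var (i + 1), fun M _ _ V v => ?_⟩
    rw [NTerm.eval_subst, ← ht]; rfl
  have h1 := shift f inferInstance
  have h2 := shift g inferInstance
  exact Df.congr (P := fun M _ _ V v => ∃ q, q < f M V v ∧ Entry (f M V v) (g M V v) q ∧ R M q V v)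
    fun M _ _ V v => exists_congr fun q => ⟨fun h => ⟨h.1.value_lt, h⟩, fun h => h.2⟩

instance Df.dead : Df (fun M _ _ V v => Dead (V X) (f M V v) (g M V v)) :=
  Df.subst₂ (P := fun _ _ _ V e s => Dead (V X) e s) <| by unfold Dead; infer_instance

instance Df.below : Df (fun M _ _ V v => Below (V X) (f M V v) (g M V v)) :=
  Df.subst₂ (P := fun _ _ _ V e s => Below (V X) e s) <| by unfold Below; infer_instance

instance Df.stageOK :
    Df (fun M _ _ V v => StageOK (V X) (V Y) (f M V v) (g M V v) (k M V v)) :=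
  Df.subst₃ (P := fun _ _ _ V e c s => StageOK (V X) (V Y) e c s) <| by
    unfold StageOK; infer_instance

instance Df.stageDom : Df (fun M _ _ V v => StageDom (V X) (V Y) (f M V v)) :=
  Df.subst₁ (P := fun _ _ _ V y => StageDom (V X) (V Y) y) <| by unfold StageDom; infer_instance

instance Df.stageLT : Df (fun M _ _ V v => StageLT (f M V v) (g M V v)) :=
  Df.subst₂ (P := fun _ _ _ _ y y' => StageLT y y') <| by unfold StageLT; infer_instance

instance Df.approx :
    Df (fun M _ _ V v => Approx (V X) (V Y) (V Z) (f M V v) (g M V v) (k M V v)) :=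
  Df.subst₃ (P := fun _ _ _ V e₀ s σ => Approx (V X) (V Y) (V Z) e₀ s σ) <|
    Df.congr (P := fun M _ _ V v => Fld (onePlusPow (V Z) (V X)) (v 2) ∧ ∃ k, k < v 2 ∧
      IsSeq (v 2) (k + 1) ∧ ∀ i, i < k + 1 → ApproxAt (V X) (V Y) (v 0) (v 1) (v 2) k i)
      (h := by unfold ApproxAt; infer_instance) fun M _ _ V v =>
      and_congr_right fun _ => exists_congr fun k =>
        ⟨fun h => ⟨Arith.add_one_le_iff.1 h.1.length_le, h⟩, fun h => h.2⟩

end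

section
variable {M : Type u} [Arith M] [RCA M] {S : Set (Set M)} {α γ Ψ : Set M}
  {e e' c s s' y z k l i a b σ τ : M}

theorem Dead.mono (h : Dead Ψ e s) (hs : s ≤ s') : Dead Ψ e s' :=
  h.imp fun _ hn => ⟨hn.1.trans_le hs, hn.2⟩

theorem not_dead_zero : ¬ Dead Ψ e 0 := fun ⟨_, hn, _⟩ => Arith.not_lt_zero _ hn

theorem stageDom_pair : StageDom γ Ψ (pair e (pair c s)) ↔ StageOK γ Ψ e c s := by
  constructor
  · rintro ⟨e', d', h, c', s', rfl, hok⟩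
    rw [pair_inj, pair_inj] at h
    obtain ⟨rfl, rfl, rfl⟩ := h
    exact hok
  · exact fun h => ⟨e, _, rfl, c, s, rfl, h⟩

theorem stageLT_pair {c' : M} : StageLT (pair e (pair c s)) (pair e' (pair c' s')) ↔
    e < e' ∨ e = e' ∧ (c' < c ∨ c = c' ∧ s < s') := by
  constructor
  · rintro ⟨_, _, h, _, _, rfl, _, _, h', _, _, rfl, hlt⟩
    rw [pair_inj, pair_inj] at h h'
    obtain ⟨rfl, rfl, rfl⟩ := h
    obtain ⟨rfl, rfl, rfl⟩ := h'
    exact hlt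
  · exact fun h => ⟨_, _, rfl, _, _, rfl, _, _, rfl, _, _, rfl, h⟩

theorem StageLT.irrefl (y : M) : ¬ StageLT y y := by
  rintro ⟨e, _, rfl, c, s, rfl, e', _, h, c', s', rfl, hlt⟩
  rw [pair_inj, pair_inj] at h
  obtain ⟨rfl, rfl, rfl⟩ := h
  obtain h | ⟨-, h | ⟨-, h⟩⟩ := hlt <;> exact lt_irrefl _ h

theorem StageLT.trans (y₁ y₂ y₃ : M) (h : StageLT y₁ y₂) (h' : StageLT y₂ y₃) : StageLT y₁ y₃ := by
  obtain ⟨e₁, _, rfl, c₁, s₁, rfl, e₂, _, rfl, c₂, s₂, rfl, h⟩ := h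
  obtain ⟨_, _, e, _, _, rfl, e₃, _, rfl, c₃, s₃, rfl, h'⟩ := h'
  rw [pair_inj, pair_inj] at e
  obtain ⟨rfl, rfl, rfl⟩ := e
  rw [stageLT_pair]
  obtain h | ⟨rfl, h | ⟨rfl, h⟩⟩ := h <;> obtain h' | ⟨rfl, h' | ⟨rfl, h'⟩⟩ := h'
  exacts [Or.inl (h.trans h'), Or.inl h, Or.inl h, Or.inl h', Or.inr ⟨rfl, Or.inl (h'.trans h)⟩,
    Or.inr ⟨rfl, Or.inl h⟩, Or.inl h', Or.inr ⟨rfl, Or.inl h'⟩,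
    Or.inr ⟨rfl, Or.inr ⟨rfl, h.trans h'⟩⟩]

theorem isLinOrd_stageOrd : IsLinOrd (stageOrd γ Ψ) :=
  isLinOrd_mkOrd StageLT.irrefl StageLT.trans <| by
    rintro y z ⟨e, _, rfl, c, s, rfl, -⟩ ⟨e', _, rfl, c', s', rfl, -⟩
    rw [stageLT_pair, stageLT_pair]
    obtain h | rfl | h := lt_trichotomy e e'
    · exact Or.inl (Or.inl h)
    · obtain h | rfl | h := lt_trichotomy c' c
      · exact Or.inl (Or.inr ⟨rfl, Or.inl h⟩)
      · obtain h | rfl | h := lt_trichotomy s s'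
        · exact Or.inl (Or.inr ⟨rfl, Or.inr ⟨rfl, h⟩⟩)
        · exact Or.inr (Or.inl rfl)
        · exact Or.inr (Or.inr (Or.inr ⟨rfl, Or.inr ⟨rfl, h⟩⟩))
      · exact Or.inr (Or.inr (Or.inr ⟨rfl, Or.inl h⟩))
    · exact Or.inr (Or.inr (Or.inl h))

theorem ModelsRCA0.stageOrd_mem (h : ModelsRCA0 S) (hγ : γ ∈ S) (hΨ : Ψ ∈ S) :
    stageOrd γ Ψ ∈ S :=
  h.comp₂ (fun M _ _ V v => StageDom (V 0) (V 1) (v 0) ∧ StageDom (V 0) (V 1) (v 1) ∧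
    (v 0 = v 1 ∨ StageLT (v 0) (v 1))) (cons γ (fun _ => Ψ)) (cons_mem hγ fun _ => hΨ) (fun _ => 0)

/-- Along a descending sequence, take the least e that occurs, then the largest c occurring with it,
then the least s; the next term contradicts one of these choices. The bound on c is needed for one e
only, so its non-uniformity is harmless. -/
theorem ModelsRCA0.wellFdd_stageOrd (h : ModelsRCA0 S)
    (hbd : ∀ e, ∃ B, ∀ c s, StageOK γ Ψ e c s → c ≤ B) : WellFdd S (stageOrd γ Ψ) := by
  rintro ⟨F, hFS, hF, hdesc⟩
  have hdesc' : ∀ n e c s, pair n (pair e (pair c s)) ∈ F → ∃ e' c' s',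
      pair (n + 1) (pair e' (pair c' s')) ∈ F ∧ (e' < e ∨ e' = e ∧ (c < c' ∨ c' = c ∧ s' < s)) := by
    intro n e c s hn
    obtain ⟨y, hy⟩ := (hF.2 (n + 1)).exists
    obtain ⟨⟨e', _, rfl, c', s', rfl, -⟩, -, hlt⟩ :=
      (ordLT_mkOrd StageLT.irrefl).1 (hdesc n _ _ hn hy)
    exact ⟨e', c', s', hy, stageLT_pair.1 hlt⟩
  have hdom : ∀ n y, pair n y ∈ F → StageDom γ Ψ y := fun n y hy => by
    obtain ⟨z, hz⟩ := (hF.2 (n + 1)).exists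
    exact ((ordLT_mkOrd StageLT.irrefl).1 (hdesc n _ _ hy hz)).2.1
  have h1 := h.comp₂ (fun M _ _ V v => ∃ n d, v 1 = pair n d ∧ pair n (pair (v 0) d) ∈ V 0)
    (fun _ => F) (fun _ => hFS) (fun _ => 0)
  change pairs (fun e w => ∃ n d, w = pair n d ∧ pair n (pair e d) ∈ F) ∈ S at h1
  obtain ⟨y, hy⟩ := (hF.2 0).exists
  obtain ⟨e₁, d₁, rfl, -⟩ := hdom 0 y hy
  obtain ⟨e, ⟨w, hw⟩, hemin⟩ := h.exists_least_sigma h1 (a := e₁) (w := pair 0 d₁)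
    (pair_mem_pairs.2 ⟨0, d₁, rfl, hy⟩)
  obtain ⟨n₂, d₂, rfl, hn₂⟩ := pair_mem_pairs.1 hw
  replace hemin : ∀ n e' d, pair n (pair e' d) ∈ F → e ≤ e' := fun n e' d hn =>
    hemin e' (pair n d) (pair_mem_pairs.2 ⟨n, d, rfl, hn⟩)
  obtain ⟨B, hB⟩ := hbd e
  have hcB : ∀ n c s, pair n (pair e (pair c s)) ∈ F → c ≤ B := fun n c s hn =>
    hB c s (stageDom_pair.1 (hdom n _ hn))
  -- Maximising c below the bound `B` is rephrased as minimising its complement `b = B - c`.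
  have h2 := h.comp₂ (fun M _ _ V v => ∃ n s, v 1 = pair n s ∧ ∃ c, c ≤ v 2 ∧ v 0 + c = v 2 ∧
    pair n (pair (v 3) (pair c s)) ∈ V 0) (fun _ => F) (fun _ => hFS) (cons B (fun _ => e))
  change pairs (fun b w => ∃ n s, w = pair n s ∧ ∃ c, c ≤ B ∧ b + c = B ∧
    pair n (pair e (pair c s)) ∈ F) ∈ S at h2
  obtain ⟨e₂, _, hed, c₂, s₂, rfl, -⟩ := hdom _ _ hn₂
  obtain ⟨rfl, rfl⟩ := pair_inj.1 hed
  obtain ⟨b₂, hb₂⟩ := Arith.le_iff.1 (hcB _ _ _ hn₂)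
  obtain ⟨b, ⟨w, hw⟩, hbmin⟩ := h.exists_least_sigma h2 (a := b₂) (w := pair n₂ s₂)
    (pair_mem_pairs.2 ⟨n₂, s₂, rfl, c₂, hcB _ _ _ hn₂, by rw [hb₂, _root_.add_comm], hn₂⟩)
  obtain ⟨n₃, s₃, rfl, c, hc, hbc, hn₃⟩ := pair_mem_pairs.1 hw
  replace hbmin : ∀ n c' s, pair n (pair e (pair c' s)) ∈ F → c' ≤ c := fun n c' s hn => by
    obtain ⟨b', hb'⟩ := Arith.le_iff.1 (hcB _ _ _ hn)
    have := hbmin b' (pair n s) (pair_mem_pairs.2 ⟨n, s, rfl, c', hcB _ _ _ hn,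
      by rw [hb', _root_.add_comm], hn⟩)
    by_contra! hlt
    have : b + c < b' + c' := add_lt_add_of_le_of_lt this hlt
    rw [hbc, hb', _root_.add_comm] at this
    exact lt_irrefl _ this
  have h3 := h.comp₂ (fun M _ _ V v => pair (v 1) (pair (v 2) (pair (v 3) (v 0))) ∈ V 0)
    (fun _ => F) (fun _ => hFS) (cons e (fun _ => c))
  change pairs (fun s n => pair n (pair e (pair c s)) ∈ F) ∈ S at h3
  obtain ⟨s, ⟨n, hn⟩, hsmin⟩ := h.exists_least_sigma h3 (a := s₃) (w := n₃) (pair_mem_pairs.2 hn₃)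
  obtain ⟨e', c', s', hn', hlt | ⟨rfl, hlt | ⟨rfl, hlt⟩⟩⟩ := hdesc' n e c s (pair_mem_pairs.1 hn)
  · exact (hemin _ _ _ hn').not_gt hlt
  · exact (hbmin _ _ _ hn').not_gt hlt
  · exact (hsmin _ _ (pair_mem_pairs.2 hn')).not_gt hlt

theorem fld_stageOrd : Fld (stageOrd γ Ψ) y ↔ StageDom γ Ψ y := fld_mkOrd

/-! ### The descending sequence of approximations -/

theorem onePlusPow_restrict (hσ : Fld (onePlusPow α γ) σ) (hτ : IsSeq τ k)
    (h : ∀ i x, Entry τ i x → Entry σ i x) : Fld (onePlusPow α γ) τ := by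
  obtain ⟨l, hl, h1, h2⟩ := fld_onePlusPow.1 hσ
  exact fld_onePlusPow.2 ⟨k, hτ, fun i p hp => h1 i p (h i p hp),
    fun i j x y x' y' hij hx hx' => h2 i j x y x' y' hij (h _ _ hx) (h _ _ hx')⟩

theorem onePlusPow_append (hσ : Fld (onePlusPow α γ) σ) (hσk : IsSeq σ k) (hτ : IsSeq τ (k + 1))
    (h : ∀ i x, Entry τ i x ↔ Entry σ i x ∨ (i = k ∧ x = pair a b)) (ha : Fld γ a) (hb : Fld α b)
    (hlt : ∀ i z w, Entry σ i (pair z w) → OrdLT γ a z) : Fld (onePlusPow α γ) τ := by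
  obtain ⟨l, hl, h1, h2⟩ := fld_onePlusPow.1 hσ
  refine fld_onePlusPow.2 ⟨k + 1, hτ, fun i p hp => ?_, fun i j x y x' y' hij hx hx' => ?_⟩
  · obtain hp | ⟨-, rfl⟩ := (h i p).1 hp
    exacts [h1 i p hp, ⟨a, b, rfl, ha, hb⟩]
  · obtain hx | ⟨rfl, -⟩ := (h _ _).1 hx
    · obtain hx' | ⟨-, e⟩ := (h _ _).1 hx'
      · exact h2 _ _ _ _ _ _ hij hx hx'
      · rw [(pair_inj.1 e).1]
        exact hlt _ _ _ hx
    · exact ((Arith.lt_add_one_iff.1 (hτ.index_lt hx')).not_gt hij).elim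

/-- An approximation is smaller than the previous one if an entry has been lowered. -/
theorem onePlusPow_lt {x y' : M} (hσ : Fld (onePlusPow α γ) σ) (hτ : Fld (onePlusPow α γ) τ)
    (hag : ∀ i, i < k → ∃ q, Entry τ i q ∧ Entry σ i q) (hx : Entry σ k (pair x y))
    (hx' : Entry τ k (pair x y')) (hlt : OrdLT α y' y) : OrdLT (onePlusPow α γ) τ σ := by
  refine ordLT_onePlusPow.2 ⟨hτ, hσ, ?_⟩
  obtain ⟨l, hl, -⟩ := fld_onePlusPow.1 hσ
  obtain ⟨l', hl', -⟩ := fld_onePlusPow.1 hτ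
  exact ⟨l', l, hl', hl, Or.inl ⟨k, hl'.index_lt hx', hl.index_lt hx,
    ⟨_, _, hx', hx, prodLT_pair.2 (Or.inl ⟨rfl, hlt⟩)⟩, hag⟩⟩

theorem ModelsRCA0.exists_approx_zero (h : ModelsRCA0 S) {x m : M} (hx : Fld γ x) :
    ∃ σ, Approx γ Ψ (stageOrd γ Ψ) (pair x m) 0 σ := by
  obtain ⟨e, he⟩ := h.exists_empty_seq
  have hn : ∀ i x, ¬ Entry e i x := fun i x hx => Arith.not_lt_zero _ (he.index_lt hx)
  obtain ⟨σ, hσ, hσ'⟩ := h.exists_append he (pair x (pair (pair x m) (pair 0 0)))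
  have hent := (hσ' 0 _).2 (Or.inr ⟨rfl, rfl⟩)
  refine ⟨σ, onePlusPow_append (fld_onePlusPow.2 ⟨0, he, fun i p hp => (hn i p hp).elim,
    fun i j x y x' y' _ hx => (hn _ _ hx).elim⟩) he hσ hσ' hx ?_ fun i z w hz => (hn _ _ hz).elim,
    0, hσ, fun i hi => ?_⟩
  · exact fld_stageOrd.2 (stageDom_pair.2 ⟨⟨x, m, rfl, hx⟩, not_dead_zero, Or.inr rfl,
      fun e' he' => (Arith.not_lt_zero _ he').elim⟩)
  · obtain hi | rfl := Arith.lt_succ.1 hi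
    · exact (Arith.not_lt_zero _ hi).elim
    · exact ⟨_, hent, _, _, rfl, _, _, rfl, _, _, rfl, ⟨x, m, rfl, rfl⟩, Or.inr rfl, Or.inr rfl,
        fun _ => rfl, fun hi => (Arith.not_lt_zero _ hi).elim,
        fun _ e' he' => (Arith.not_lt_zero _ he').elim⟩

theorem le_succ_of_le {c s : M} (h : c < s ∨ c = s) : c < s + 1 ∨ c = s + 1 :=
  Or.inl (Arith.lt_succ.2 h)

/-- If a later entry has been refuted, cut it off together with everything after it; the result is a
proper initial segment. Otherwise raise the counter of the last entry, which lowers that entry, so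
that a new entry may be appended behind it without spoiling the descent. -/
theorem ModelsRCA0.exists_approx_succ (h : ModelsRCA0 S) (hγ : IsLinOrd γ) {e₀ : M}
    (he₀ : ∀ n, pair e₀ n ∉ Ψ) (hσ : Approx γ Ψ (stageOrd γ Ψ) e₀ s σ) :
    ∃ τ, Approx γ Ψ (stageOrd γ Ψ) e₀ (s + 1) τ ∧ OrdLT (onePlusPow (stageOrd γ Ψ) γ) τ σ := by
  obtain ⟨hσ, k, hσk, hat⟩ := hσ
  obtain ⟨l, hl, hσ1, hσ2⟩ := fld_onePlusPow.1 hσ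
  have hs1 : s ≤ s + 1 := (Arith.lt_add_one_iff.2 le_rfl).le
  have hlt1 : ∀ a : M, a < a + 1 := fun a => Arith.lt_add_one_iff.2 le_rfl
  have hok : ∀ i x e c r, Entry σ i (pair x (pair e (pair c r))) → Fld γ x ∧ StageOK γ Ψ e c r := by
    intro i x e c r hx
    obtain ⟨x', y', e', hx', hy'⟩ := hσ1 i _ hx
    obtain ⟨rfl, rfl⟩ := pair_inj.1 e'
    exact ⟨hx', stageDom_pair.1 (fld_stageOrd.1 hy')⟩
  by_cases hdead : ∃ i, i < k ∧ ∃ x e d, Entry σ (i + 1) (pair x (pair e d)) ∧ Dead Ψ e (s + 1)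
  · obtain ⟨i, hi, x', e', d', hx', hd⟩ := hdead
    have hik : i + 1 < k + 1 := add_lt_add_left hi 1
    obtain ⟨τ, hτ, hτ'⟩ := h.exists_restrict hσk hik.le
    have hτfld := onePlusPow_restrict hσ hτ fun j x hx => ((hτ' j x).1 hx).2
    refine ⟨τ, ⟨hτfld, i, hτ, fun j hj => ?_⟩,
      ordLT_onePlusPow.2 ⟨hτfld, hσ, i + 1, k + 1, hτ, hσk, Or.inr ⟨hik, fun j hj => ?_⟩⟩⟩
    · obtain ⟨q, hq, x, y, rfl, e, d, rfl, c, r, rfl, hex, hc, hr, h0, hnext, hlast⟩ :=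
        hat j (hj.trans hik)
      refine ⟨_, (hτ' _ _).2 ⟨hj, hq⟩, x, _, rfl, e, _, rfl, c, r, rfl, hex, le_succ_of_le hc,
        le_succ_of_le hr, h0, fun hji => ?_, fun hji => ?_⟩
      · obtain ⟨q', hq', h'⟩ := hnext (hji.trans hi)
        exact ⟨q', (hτ' _ _).2 ⟨add_lt_add_left hji 1, hq'⟩, h'⟩
      · subst hji
        -- The new last entry has counter `e₁ + 1`, where `e₁` is the refuted successor. Candidates
        -- before `e₁` are dead by the condition `e' + 1 < c` of its stage, and `e₁` itself has just
        -- died; this closes the gap of one.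
        obtain ⟨q', hq', x₁, y₁, rfl, e₁, d₁, rfl, hce⟩ := hnext hi
        have := hσk.unique hq' hx'
        rw [pair_inj, pair_inj] at this
        obtain ⟨-, rfl, -⟩ := this
        intro e'' he'' hb
        rw [hce] at he''
        obtain hlt | rfl := Arith.lt_succ.1 he''
        · have hlt' : e'' + 1 < c := by rw [hce]; exact add_lt_add_left hlt 1
          exact ((hok _ _ _ _ _ hq).2.2.2.2 e'' ((hlt1 _).trans hlt') hlt' hb).mono
            (le_trans (show r ≤ s from hr) hs1)
        · exact hd
    · obtain ⟨q, hq⟩ := hτ.exists_entry hj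
      exact ⟨q, hq, ((hτ' _ _).1 hq).2⟩
  · obtain ⟨q, hq, x, y, rfl, e, d, rfl, c, r, rfl, ⟨_, m, rfl, rfl⟩, hc, hr, h0, -, hlast⟩ :=
      hat k (hlt1 k)
    replace hlast := hlast rfl
    rename_i x
    -- The initial entry `e₀` is never refuted; for later entries this is the failure of the first
    -- case.
    have halive : ¬ Dead Ψ (pair x m) (s + 1) := by
      obtain rfl | ⟨i, rfl⟩ := Arith.eq_zero_or_succ k
      · rw [h0 rfl]
        exact fun ⟨n, _, hn⟩ => he₀ n hn
      · exact fun hd => hdead ⟨i, hlt1 i, _, _, _, hq, hd⟩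
    have hxγ := (hok _ _ _ _ _ hq).1
    have hy' : StageDom γ Ψ (pair (pair x m) (pair (c + 1) (s + 1))) := by
      refine stageDom_pair.2 ⟨⟨x, m, rfl, hxγ⟩, halive,
        hc.imp (fun h => add_lt_add_left h 1) (fun h => by rw [h]), fun e' _ he' hb => ?_⟩
      exact (hlast e' (lt_of_add_lt_add_right he') hb).mono hs1
    obtain ⟨ρ, hρ, hρ'⟩ := h.exists_restrict hσk (hlt1 k).le
    have hρfld := onePlusPow_restrict hσ hρ fun j x hx => ((hρ' j x).1 hx).2
    obtain ⟨τ, hτ, hτ'⟩ := h.exists_append hρ (pair x (pair (pair x m) (pair (c + 1) (s + 1))))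
    have hτlast := (hτ' k _).2 (Or.inr ⟨rfl, rfl⟩)
    have hτprev : ∀ i q, i < k → Entry σ i q → Entry τ i q := fun i q hi hq =>
      (hτ' _ _).2 (Or.inl ((hρ' _ _).2 ⟨hi, hq⟩))
    have hρlt : ∀ i z w, Entry ρ i (pair z w) → OrdLT γ x z := fun i z w hz => by
      obtain ⟨hi, hz⟩ := (hρ' _ _).1 hz
      exact hσ2 _ _ _ _ _ _ hi hz hq
    have hτfld := onePlusPow_append hρfld hρ hτ hτ' hxγ (fld_stageOrd.2 hy') hρlt
    have hlower : OrdLT (stageOrd γ Ψ) (pair (pair x m) (pair (c + 1) (s + 1)))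
        (pair (pair x m) (pair c r)) :=
      (ordLT_mkOrd StageLT.irrefl).2 ⟨hy', stageDom_pair.2 (hok _ _ _ _ _ hq).2,
        stageLT_pair.2 (Or.inr ⟨rfl, Or.inl (hlt1 c)⟩)⟩
    have hcs : c + 1 < s + 1 ∨ c + 1 = s + 1 :=
      hc.imp (fun h => add_lt_add_left h 1) (fun h => by rw [h])
    have hprev : ∀ υ k', k ≤ k' → (∀ i q, Entry τ i q → Entry υ i q) → ∀ i, i < k →
        ApproxAt γ Ψ e₀ (s + 1) υ k' i := by
      intro υ k' hk' hυ i hi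
      obtain ⟨q₁, hq₁, x₁, y₁, rfl, e₁, d₁, rfl, c₁, r₁, rfl, hex, hc, hr, h0, hnext, -⟩ :=
        hat i (hi.trans (hlt1 k))
      refine ⟨_, hυ _ _ (hτprev _ _ hi hq₁), x₁, _, rfl, e₁, _, rfl, c₁, r₁, rfl, hex,
        le_succ_of_le hc, le_succ_of_le hr, h0, fun _ => ?_, fun hik => ?_⟩
      · obtain ⟨q', hq', h'⟩ := hnext hi
        obtain hik | hik := (Arith.add_one_le_iff.2 hi).lt_or_eq
        · exact ⟨q', hυ _ _ (hτprev _ _ hik hq'), h'⟩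
        · rw [hik] at hq' ⊢
          refine ⟨_, hυ _ _ hτlast, _, _, rfl, _, _, rfl, ?_⟩
          obtain ⟨x', y', rfl, e', d', rfl, hce⟩ := h'
          have := hσk.unique hq' hq
          rw [pair_inj, pair_inj] at this
          rw [hce, this.2.1]
      · rw [hik] at hi
        exact (hk'.not_gt hi).elim
    have hagτ : ∀ i, i < k → ∃ q, Entry τ i q ∧ Entry σ i q := fun i hi => by
      obtain ⟨q, hq⟩ := hσk.exists_entry (hi.trans (hlt1 k))
      exact ⟨q, hτprev i q hi hq, hq⟩
    -- The number c that the counter has just passed is the next possible successor. If eligible, it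
    -- is appended with counter and stage 0, so that its own search starts afresh; otherwise all
    -- candidates below `c + 1` are dead and the search goes on.
    by_cases hcand : Below γ c (pair x m) ∧ ¬ Dead Ψ c (s + 1)
    · obtain ⟨⟨x', m', rfl, x₁, m₁, e₁, hlt⟩, hnd⟩ := hcand
      obtain ⟨rfl, rfl⟩ := pair_inj.1 e₁
      have hx'γ := hγ.fld_left hlt.1
      obtain ⟨υ, hυ, hυ'⟩ := h.exists_append hτ (pair x' (pair (pair x' m') (pair 0 0)))
      have hυτ : ∀ i q, Entry τ i q → Entry υ i q := fun i q hq => (hυ' _ _).2 (Or.inl hq)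
      have hυlast := (hυ' (k + 1) _).2 (Or.inr ⟨rfl, rfl⟩)
      have hυfld : Fld (onePlusPow (stageOrd γ Ψ) γ) υ := by
        refine onePlusPow_append hτfld hτ hυ hυ' hx'γ (fld_stageOrd.2 (stageDom_pair.2
          ⟨⟨x', m', rfl, hx'γ⟩, not_dead_zero, Or.inr rfl,
            fun e' he' => (Arith.not_lt_zero _ he').elim⟩)) fun i z w hz => ?_
        obtain hz | ⟨-, e⟩ := (hτ' _ _).1 hz
        · exact hγ.lt_trans hlt (hρlt _ _ _ hz)
        · rwa [(pair_inj.1 e).1]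
      refine ⟨υ, ⟨hυfld, k + 1, hυ, fun i hi => ?_⟩, onePlusPow_lt hσ hυfld
        (fun i hi => (hagτ i hi).imp fun q hq => ⟨hυτ _ _ hq.1, hq.2⟩) hq (hυτ _ _ hτlast) hlower⟩
      obtain hi | rfl := Arith.lt_succ.1 hi
      · obtain hi | rfl := Arith.lt_succ.1 hi
        · exact hprev υ (k + 1) (hlt1 k).le hυτ i hi
        · exact ⟨_, hυτ _ _ hτlast, x, _, rfl, _, _, rfl, _, _, rfl, ⟨x, m, rfl, rfl⟩, hcs,
            Or.inr rfl, h0, fun _ => ⟨_, hυlast, _, _, rfl, _, _, rfl, rfl⟩,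
            fun hi => ((hlt1 i).ne hi).elim⟩
      · exact ⟨_, hυlast, x', _, rfl, _, _, rfl, _, _, rfl, ⟨x', m', rfl, rfl⟩,
          Or.inl (Arith.zero_lt_succ s), Or.inl (Arith.zero_lt_succ s),
          fun h => (Arith.succ_ne_zero _ h).elim, fun h => (lt_irrefl _ h).elim,
          fun _ e' he' => (Arith.not_lt_zero _ he').elim⟩
    · refine ⟨τ, ⟨hτfld, k, hτ, fun i hi => ?_⟩, onePlusPow_lt hσ hτfld hagτ hq hτlast hlower⟩
      obtain hi | rfl := Arith.lt_succ.1 hi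
      · exact hprev τ k le_rfl (fun _ _ => id) i hi
      · refine ⟨_, hτlast, x, _, rfl, _, _, rfl, _, _, rfl, ⟨x, m, rfl, rfl⟩, hcs, Or.inr rfl, h0,
          fun h => (lt_irrefl _ h).elim, fun _ e' he' hb => ?_⟩
        obtain he' | rfl := Arith.lt_succ.1 he'
        · exact (hlast e' he' hb).mono hs1
        · by_contra hnd
          exact hcand ⟨hb, hnd⟩

/-! ### From a failure of induction to a contradiction -/

theorem ModelsRCA0.not_wellFdd_onePlusPow (h : ModelsRCA0 S) (hγS : γ ∈ S) (hΨ : Ψ ∈ S)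
    (hγ : IsLinOrd γ) {x m : M} (hx : Fld γ x) (hm : ∀ n, pair (pair x m) n ∉ Ψ) :
    ¬ WellFdd S (onePlusPow (stageOrd γ Ψ) γ) := by
  have hαS := h.stageOrd_mem hγS hΨ
  have hI := h.comp₂ (fun M _ _ V v => Approx (V 0) (V 1) (V 2) (v 2) (v 0) (v 1))
    (cons γ (cons Ψ (fun _ => stageOrd γ Ψ))) (cons_mem hγS (cons_mem hΨ fun _ => hαS))
    (fun _ => pair x m)
  have hX := h.comp₂ (fun M _ _ V v => OrdLT (onePlusPow (V 2) (V 0)) (v 1) (v 0))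
    (cons γ (cons Ψ (fun _ => stageOrd γ Ψ))) (cons_mem hγS (cons_mem hΨ fun _ => hαS))
    (fun _ => 0)
  obtain ⟨σ, hσ⟩ := h.exists_approx_zero (Ψ := Ψ) (m := m) hx
  obtain ⟨F, hFS, hF, -, hdesc⟩ := h.exists_path hI hX (a := σ) (pair_mem_pairs.2 hσ)
    (fun s σ hσ => by
      obtain ⟨τ, hτ, hlt⟩ := h.exists_approx_succ hγ hm (pair_mem_pairs.1 hσ)
      exact ⟨τ, pair_mem_pairs.2 hτ, pair_mem_pairs.2 hlt⟩)
  exact fun hw => hw ⟨F, hFS, hF, fun n σ τ hσ hτ => by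
    have hlt := pair_mem_pairs.1 (hdesc n σ τ hσ hτ)
    exact hlt⟩

/-- A counterexample produces an infinite descent of approximations, while progressivity makes the
order of stages a well order. -/
theorem ModelsRCA0.pi2Induction (h : ModelsRCA0 S) (hγS : γ ∈ S) (hγ : IsLinOrd γ)
    (hw : ∀ α ∈ S, IsWellOrd S α → WellFdd S (onePlusPow α γ)) : Pi2Induction S γ := by
  intro φ V v hV hprog x hx
  have hd : Df (fun M _ _ V v => φ.Holds V
      (cons (v (1 + 1 + 1)) (cons (v 0) (cons (v (0 + 1)) (fun i => v (i + 2 + 1 + 1)))))) := by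
    -- Inside the pair quantifiers the variables are m, x, the code e, n, and then the parameters.
    let ρ : ℕ → ℕ := fun | 0 => 3 | 1 => 0 | 2 => 1 | i + 3 => i + 4
    have e : ∀ (M : Type u) (v : ℕ → M), cons (v (1 + 1 + 1)) (cons (v 0) (cons (v (0 + 1))
        (fun i => v (i + 2 + 1 + 1)))) = fun i => v (ρ i) := fun M v => by
      funext i
      obtain _ | _ | _ | i := i <;> rfl
    exact Df.congr (h := Df.holds φ ρ) fun M _ _ V v => iff_of_eq (congrArg _ (e M v))
  have hΨ := h.comp₂ (fun M _ _ V v => ∃ x m, v 0 = pair x m ∧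
    φ.Holds V (cons (v 1) (cons m (cons x (fun i => v (i + 2)))))) V hV v
  change pairs (fun e n => ∃ x m, e = pair x m ∧ φ.Holds V (cons n (cons m (cons x v)))) ∈ S at hΨ
  set Ψ := pairs (fun e n => ∃ x m, e = pair x m ∧ φ.Holds V (cons n (cons m (cons x v))))
    with hΨdef
  have hmem : ∀ x m n, pair (pair x m) n ∈ Ψ ↔ φ.Holds V (cons n (cons m (cons x v))) := by
    intro x m n
    rw [hΨdef, pair_mem_pairs]
    constructor
    · rintro ⟨x', m', e, h⟩
      obtain ⟨rfl, rfl⟩ := pair_inj.1 e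
      exact h
    · exact fun h => ⟨x, m, rfl, h⟩
  have hfail : ∀ x, ¬ φ.Pi2 V (cons x v) → ∃ m, ∀ n, pair (pair x m) n ∉ Ψ := fun x hx => by
    simpa only [hmem, BFormula.Pi2, not_forall, not_exists] using hx
  by_contra hfx
  obtain ⟨m, hm⟩ := hfail x hfx
  refine h.not_wellFdd_onePlusPow hγS hΨ hγ hx hm (hw _ (h.stageOrd_mem hγS hΨ)
    ⟨isLinOrd_stageOrd, h.wellFdd_stageOrd fun e => ?_⟩)
  -- If n refutes e, then e is alive only at stages `s ≤ n`, and `c ≤ s` bounds the counter.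
  by_cases he : ∃ n, pair e n ∈ Ψ
  · obtain ⟨n, hn⟩ := he
    refine ⟨n, fun c s hok => ?_⟩
    by_contra! hlt
    have hcs : c ≤ s := hok.2.2.1
    exact hok.2.1 ⟨n, hlt.trans_le hcs, hn⟩
  · by_cases hex : ∃ x m, e = pair x m ∧ Fld γ x
    · obtain ⟨x', m', rfl, hx'⟩ := hex
      have hnot : ¬ φ.Pi2 V (cons x' v) := fun hp => by
        obtain ⟨n, hn⟩ := hp m'
        exact he ⟨n, (hmem _ _ _).2 hn⟩
      have : ∃ y, OrdLT γ y x' ∧ ¬ φ.Pi2 V (cons y v) := by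
        by_contra! hc
        exact hnot (hprog x' hx' hc)
      obtain ⟨y, hy, hyn⟩ := this
      obtain ⟨w, hw⟩ := hfail y hyn
      -- The counter cannot exceed this number, since the candidate `pair y w` below e would then
      -- have to be refuted, which never happens.
      refine ⟨pair y w + 1, fun c s hok => ?_⟩
      by_contra! hlt
      obtain ⟨n, -, hn⟩ := hok.2.2.2 (pair y w) ((Arith.lt_add_one_iff.2 le_rfl).trans hlt) hlt
        ⟨y, w, rfl, x', m', rfl, hy⟩
      exact hw n hn
    · exact ⟨0, fun c s hok => (hex hok.1).elim⟩

end
end SOA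

theorem corollary3p9 :
    (∃ θ : SOA.BFormula,
      ∀ (M : Type u) [SOA.Arith M] (S : Set (Set M)), SOA.ModelsRCA0 S →
        ∀ L ∈ S, ∀ γ ∈ S, SOA.IsLinOrdOnNat L → SOA.IsLinOrd γ → SOA.IsNatFamily S θ L γ) ∧
    (∀ (M : Type u) [SOA.Arith M] (S : Set (Set M)), SOA.ModelsRCA0 S →
      (∃ L ∈ S, SOA.IsLinOrdOnNat L ∧ SOA.DLIsDilator S L) → SOA.SlowTI S) := by
  constructor
  · obtain ⟨θ, hθ⟩ := SOA.exists_eta_formula.{u}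
    refine ⟨θ, fun M _ S h L hLS γ hγS hL hγ => ?_⟩
    have := h.rca
    exact h.isNatFamily (hθ M L γ) hLS hγS hL hγ
  · rintro M _ S h ⟨L, hLS, hL, hD⟩ γ hγS hγ wγ
    have := h.rca
    exact h.pi2Induction hγS hγ fun α hαS hα =>
      h.wellFdd_onePlusPow hLS hL hD hγS hγ wγ hαS hα
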